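/- All spaces are based, maps and homotopies preserve base points, and $[X,Y]$ denotes the set of based homotopy classes of based maps, with base point $0$ the class of the constant map. $\Omega Y$ is the based loop space, $\mu_3$ is concatenation of loops (so $[X,\Omega Y]$ is a group), $LY$ is the free loop space, $i\colon\Omega Y\to LY$ is the inclusion and $s\colon Y\to LY$ the section by constant loops. For spaces $Y,Z$ with multiplications and a map $f\colon Y\to Z$, an H-deviation of $f$ is a map $D\colon Y\wedge Y\to Z$ such that, up to based homotopy, $D(y\wedge y')\cdot f(y\cdot y')= f(y)\cdot f(y')$ as maps $Y\times Y\to Z$. Theorem. Let $B$ and $C$ be H-spaces, based at their units, which have the homotopy type of CW complexes, have non-degenerate base points, and whose right translations $y\mapsto y\cdot b$ are all homotopy equivalences (this is automatic if $B$ and $C$ are path connected). Let $C$ be homotopy-associative. Let $w\colon B\to C$ be any based map, and let $p\colon E\to B$ be its homotopy fibre, $E=\{(b,\lambda)\in B\times C^{[0,1]} : \lambda(0)=*,\ \lambda(1)=w(b)\}$. Give $LB$ and $LC$ the pointwise multiplications. Then there are an H-deviation $D\colon LB\wedge LB\to LC$ of $Lw$ and a map $\mathfrak D'\colon\Omega B\wedge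 B\to\Omega C$ with $i\circ\mathfrak D'\simeq D\circ(i\wedge s)$. For any such $D$ and $\mathfrak D'$ let $\mathfrak D\colon\Omega B\wedge B\to\Omega C$ represent the inverse of $\mathfrak D'$ in the group $[\Omega B\wedge B,\Omega C]$. For a based space $X$, $\alpha\in[X,\Omega B]$ and $\beta\in[X,B]$ let $\alpha\wedge_w\beta\in[X,\Omega C]$ be the class of the composite $$X\xrightarrow{\ \Delta\ }X\wedge X\xrightarrow{\ \alpha\wedge\beta\ }\Omega B\wedge B\xrightarrow{\ \mathfrak D\ }\Omega C .$$ Let $\beta\in[X,B]$ satisfy $w_\#(\beta)=0$. Then $(p_\#)^{-1}(\beta)\subset[X,E]$ is non-empty; the function $$\psi\colon[X,\Omega B]\to[X,\Omega C],\qquad \psi(\alpha)=\mu_3\bigl(\alpha\wedge_w\beta,\ (\Omega w)_\#(\alpha)\bigr)$$ is a group homomorphism; and there is a bijection between $(p_\#)^{-1}(\beta)$ and the cokernel of $\psi$. -/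

import Mathlib

open scoped unitInterval

universe u v

/-- A topological space with a base point. -/
structure PtdSpace : Type (u + 1) where
  carrier : Type u
  [top : TopologicalSpace carrier]
  pt : carrier

namespace PtdSpace

instance : CoeSort PtdSpace.{u} (Type u) := ⟨carrier⟩

instance (X : PtdSpace.{u}) : TopologicalSpace X := X.top

end PtdSpace

/-- Base-point-preserving continuous maps. -/
structure PtdMap (X : PtdSpace.{u}) (Y : PtdSpace.{v}) where
  toMap : C(X, Y)
  map_pt : toMap X.pt = Y.pt

namespace PtdMap

universe u₁ u₂ u₃ u₄

variable {X : PtdSpace.{u₁}} {Y : PtdSpace.{u₂}} {Z : PtdSpace.{u₃}} {W : PtdSpace.{u₄}}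

/-- The constant map to the base point. -/
def const (X : PtdSpace.{u₁}) (Y : PtdSpace.{u₂}) : PtdMap X Y where
  toMap := ContinuousMap.const X Y.pt
  map_pt := rfl

def comp (g : PtdMap Y Z) (f : PtdMap X Y) : PtdMap X Z where
  toMap := g.toMap.comp f.toMap
  map_pt := by simp [f.map_pt, g.map_pt]

/-- Homotopy through base-point-preserving maps. -/
def Homotopic (f g : PtdMap X Y) : Prop :=
  f.toMap.HomotopicRel g.toMap {X.pt}

theorem Homotopic.refl (f : PtdMap X Y) : f.Homotopic f :=
  ContinuousMap.HomotopicRel.refl _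

theorem Homotopic.symm {f g : PtdMap X Y} (h : f.Homotopic g) : g.Homotopic f :=
  ContinuousMap.HomotopicRel.symm h

theorem Homotopic.trans {f g h : PtdMap X Y} (h₁ : f.Homotopic g) (h₂ : g.Homotopic h) :
    f.Homotopic h :=
  ContinuousMap.HomotopicRel.trans h₁ h₂

theorem Homotopic.comp_left {f f' : PtdMap X Y} (g : PtdMap Y Z) (h : f.Homotopic f') :
    (g.comp f).Homotopic (g.comp f') :=
  ContinuousMap.HomotopicRel.comp_continuousMap h g.toMap

theorem Homotopic.comp_right {g g' : PtdMap Y Z} (h : g.Homotopic g') (f : PtdMap X Y) :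
    (g.comp f).Homotopic (g'.comp f) := by
  obtain ⟨H⟩ := h
  refine ⟨⟨⟨⟨fun p => H (p.1, f.toMap p.2), by fun_prop⟩, fun x => ?_, fun x => ?_⟩, ?_⟩⟩
  · exact H.apply_zero _
  · exact H.apply_one _
  · rintro t x rfl
    exact H.eq_fst t f.map_pt

/-- Homotopy classes of pointed maps. -/
instance setoid (X : PtdSpace.{u₁}) (Y : PtdSpace.{u₂}) : Setoid (PtdMap X Y) where
  r := Homotopic
  iseqv := ⟨Homotopic.refl, Homotopic.symm, Homotopic.trans⟩

end PtdMap

/-- The set `[X, Y]` of pointed homotopy classes of pointed maps. -/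
def HtpyClass (X : PtdSpace.{u}) (Y : PtdSpace.{v}) : Type max u v :=
  Quotient (PtdMap.setoid X Y)

noncomputable section constructions

universe u₁ u₂ u₃ u₄

variable {X : PtdSpace.{u₁}} {Y : PtdSpace.{u₂}} {Z : PtdSpace.{u₃}} {W : PtdSpace.{u₄}}

/-- The class of the constant map, the base point of `[X, Y]`. -/
def HtpyClass.zero (X : PtdSpace.{u₁}) (Y : PtdSpace.{u₂}) : HtpyClass X Y :=
  Quotient.mk _ (PtdMap.const X Y)

/-- The induced map `g_# : [X, Y] → [X, Z]`. -/
def PtdMap.sharp (g : PtdMap Y Z) : HtpyClass X Y → HtpyClass X Z :=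
  Quotient.map g.comp fun _ _ h => PtdMap.Homotopic.comp_left g h

/-! ### Products and smash products -/

def PtdSpace.prod (X : PtdSpace.{u₁}) (Y : PtdSpace.{u₂}) : PtdSpace.{max u₁ u₂} where
  carrier := X × Y
  pt := (X.pt, Y.pt)

def PtdMap.pair (f : PtdMap X Y) (g : PtdMap X Z) : PtdMap X (Y.prod Z) where
  toMap := f.toMap.prodMk g.toMap
  map_pt := Prod.ext f.map_pt g.map_pt

def PtdMap.prodMap (f : PtdMap X Y) (g : PtdMap Z W) : PtdMap (X.prod Z) (Y.prod W) where
  toMap := f.toMap.prodMap g.toMap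
  map_pt := Prod.ext f.map_pt g.map_pt

theorem PtdMap.Homotopic.pair {f f' : PtdMap X Y} {g g' : PtdMap X Z}
    (hf : f.Homotopic f') (hg : g.Homotopic g') : (f.pair g).Homotopic (f'.pair g') := by
  obtain ⟨F⟩ := hf
  obtain ⟨G⟩ := hg
  refine ⟨⟨⟨⟨fun p => (F p, G p), by fun_prop⟩, fun x => ?_, fun x => ?_⟩, ?_⟩⟩
  · exact Prod.ext (F.apply_zero _) (G.apply_zero _)
  · exact Prod.ext (F.apply_one _) (G.apply_one _)
  · intro t x hx
    exact Prod.ext (F.eq_fst t hx) (G.eq_fst t hx)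

/-- The wedge `X ∨ Y`, as a subset of `X × Y`. -/
def wedge (X : PtdSpace.{u₁}) (Y : PtdSpace.{u₂}) : Set (X × Y) :=
  {p | p.1 = X.pt ∨ p.2 = Y.pt}

/-- The equivalence relation on `X × Y` that collapses the wedge to one point. -/
def smashSetoid (X : PtdSpace.{u₁}) (Y : PtdSpace.{u₂}) : Setoid (X × Y) where
  r p q := p = q ∨ (p ∈ wedge X Y ∧ q ∈ wedge X Y)
  iseqv := by
    refine ⟨fun _ => Or.inl rfl, ?_, ?_⟩
    · rintro p q (h | h)
      · exact Or.inl h.symm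
      · exact Or.inr h.symm
    · rintro p q r (rfl | h) (rfl | h')
      · exact Or.inl rfl
      · exact Or.inr h'
      · exact Or.inr h
      · exact Or.inr ⟨h.1, h'.2⟩

/-- The smash product `X ∧ Y`, with the quotient topology. -/
def PtdSpace.smash (X : PtdSpace.{u₁}) (Y : PtdSpace.{u₂}) : PtdSpace.{max u₁ u₂} where
  carrier := Quotient (smashSetoid X Y)
  pt := Quotient.mk _ (X.pt, Y.pt)

/-- The quotient map `X × Y → X ∧ Y`. -/
def toSmash (X : PtdSpace.{u₁}) (Y : PtdSpace.{u₂}) : PtdMap (X.prod Y) (X.smash Y) where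
  toMap := ⟨Quotient.mk (smashSetoid X Y), continuous_quotient_mk'⟩
  map_pt := rfl

/-- The map `f ∧ g : X ∧ Z → Y ∧ W`. -/
def PtdMap.smashMap (f : PtdMap X Y) (g : PtdMap Z W) : PtdMap (X.smash Z) (Y.smash W) where
  toMap :=
    { toFun := Quotient.map (sa := smashSetoid X Z) (sb := smashSetoid Y W)
        (fun p => (f.toMap p.1, g.toMap p.2)) (by
          have key : ∀ p ∈ wedge X Z, (f.toMap p.1, g.toMap p.2) ∈ wedge Y W := by
            rintro ⟨x, z⟩ (rfl | rfl)
            · exact Or.inl f.map_pt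
            · exact Or.inr g.map_pt
          rintro p q (rfl | h)
          · exact Or.inl rfl
          · exact Or.inr ⟨key p h.1, key q h.2⟩)
      continuous_toFun := Continuous.quotient_map' (s := smashSetoid X Z) (t := smashSetoid Y W)
        (by fun_prop) _ }
  map_pt := congrArg (Quotient.mk (smashSetoid Y W)) (Prod.ext f.map_pt g.map_pt)

/-- The reduced diagonal `X → X ∧ X`. -/
def reducedDiagonal (X : PtdSpace.{u₁}) : PtdMap X (X.smash X) where
  toMap := (toSmash X X).toMap.comp ((ContinuousMap.id X).prodMk (ContinuousMap.id X))
  map_pt := rfl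

/-- The composite `X → X ∧ X → Y ∧ Z → W` of the reduced diagonal, `a ∧ b` and `k`. -/
def PtdMap.smashComp (k : PtdMap (Y.smash Z) W) (a : PtdMap X Y) (b : PtdMap X Z) : PtdMap X W :=
  k.comp ((a.smashMap b).comp (reducedDiagonal X))

theorem PtdMap.Homotopic.smashComp (k : PtdMap (Y.smash Z) W) {a a' : PtdMap X Y}
    {b b' : PtdMap X Z} (ha : a.Homotopic a') (hb : b.Homotopic b') :
    (k.smashComp a b).Homotopic (k.smashComp a' b') :=
  PtdMap.Homotopic.comp_left (k.comp (toSmash Y Z)) (PtdMap.Homotopic.pair ha hb)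

/-! ### Loop spaces -/

/-- The based loop space `ΩY`. -/
def PtdSpace.loop (Y : PtdSpace.{u₂}) : PtdSpace.{u₂} where
  carrier := Path Y.pt Y.pt
  pt := Path.refl Y.pt

/-- Concatenation of loops, the usual multiplication `ΩY × ΩY → ΩY`. -/
def loopMul (Y : PtdSpace.{u₂}) : PtdMap (Y.loop.prod Y.loop) Y.loop where
  toMap := ⟨fun p : Path Y.pt Y.pt × Path Y.pt Y.pt => p.1.trans p.2, Path.continuous_trans⟩
  map_pt := Path.refl_trans_refl

/-- Reversal of loops. -/
def loopInv (Y : PtdSpace.{u₂}) : PtdMap Y.loop Y.loop where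
  toMap := ⟨fun p : Path Y.pt Y.pt => p.symm, Path.continuous_symm⟩
  map_pt := Path.refl_symm

/-- The map `Ωw : ΩY → ΩZ`. -/
def loopMap (w : PtdMap Y Z) : PtdMap Y.loop Z.loop where
  toMap :=
    { toFun := fun p : Path Y.pt Y.pt =>
        ((p.map w.toMap.continuous).cast w.map_pt.symm w.map_pt.symm : Path Z.pt Z.pt)
      continuous_toFun := by
        refine Path.continuous_uncurry_iff.mp ?_
        change Continuous fun q : Path Y.pt Y.pt × I => w.toMap (q.1 q.2)
        fun_prop }
  map_pt := by
    change ((Path.refl Y.pt).map w.toMap.continuous).cast w.map_pt.symm w.map_pt.symm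
      = Path.refl Z.pt
    ext t
    exact w.map_pt

theorem loopMul_one_left (a : PtdMap X Y.loop) :
    ((loopMul Y).comp ((PtdMap.const X Y.loop).pair a)).Homotopic a := by
  have h : PtdMap.Homotopic (X := Y.loop) (Y := Y.loop)
      ⟨⟨fun p : Path Y.pt Y.pt => (Path.refl Y.pt).trans p,
        Path.continuous_trans.comp (by fun_prop : Continuous
          fun p : Path Y.pt Y.pt => (Path.refl Y.pt, p))⟩, Path.refl_trans_refl⟩
      ⟨ContinuousMap.id _, rfl⟩ := ⟨(HSpace.eHmul (X := Path Y.pt Y.pt))⟩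
  exact PtdMap.Homotopic.comp_right h a

theorem loopMul_one_right (a : PtdMap X Y.loop) :
    ((loopMul Y).comp (a.pair (PtdMap.const X Y.loop))).Homotopic a := by
  have h : PtdMap.Homotopic (X := Y.loop) (Y := Y.loop)
      ⟨⟨fun p : Path Y.pt Y.pt => p.trans (Path.refl Y.pt),
        Path.continuous_trans.comp (by fun_prop : Continuous
          fun p : Path Y.pt Y.pt => (p, Path.refl Y.pt))⟩, Path.refl_trans_refl⟩
      ⟨ContinuousMap.id _, rfl⟩ := ⟨(HSpace.hmulE (X := Path Y.pt Y.pt))⟩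
  exact PtdMap.Homotopic.comp_right h a

theorem loopMul_inv_left (a : PtdMap X Y.loop) :
    ((loopMul Y).comp (((loopInv Y).comp a).pair a)).Homotopic (PtdMap.const X Y.loop) := by
  have h : PtdMap.Homotopic (X := Y.loop) (Y := Y.loop) (PtdMap.const _ _)
      ⟨⟨fun p : Path Y.pt Y.pt => p.symm.trans p,
        Path.continuous_trans.comp (Path.continuous_symm.prodMk continuous_id)⟩, by
          change (Path.refl Y.pt).symm.trans (Path.refl Y.pt) = Path.refl Y.pt
          simp⟩ := by
    refine ⟨⟨⟨⟨fun q : I × Path Y.pt Y.pt => (Path.Homotopy.reflSymmTrans q.2).eval q.1, ?_⟩,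
      fun p => Path.Homotopy.eval_zero _, fun p => Path.Homotopy.eval_one _⟩, ?_⟩⟩
    · refine Path.continuous_uncurry_iff.mp ?_
      change Continuous fun q : (I × Path Y.pt Y.pt) × I => q.1.2.symm
        ⟨Path.Homotopy.reflTransSymmAux (q.1.1, q.2), Path.Homotopy.reflTransSymmAux_mem_I _⟩
      have : Continuous fun q : (I × Path Y.pt Y.pt) × I => q.1.2.symm :=
        Path.continuous_symm.comp (by fun_prop)
      exact this.eval (by fun_prop)
    · rintro t p rfl
      rfl
  exact PtdMap.Homotopic.comp_right h.symm a

theorem loopMul_assoc (a b c : PtdMap X Y.loop) :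
    ((loopMul Y).comp (((loopMul Y).comp (a.pair b)).pair c)).Homotopic
      ((loopMul Y).comp (a.pair ((loopMul Y).comp (b.pair c)))) := by
  have c1 : Continuous fun q : (Path Y.pt Y.pt × Path Y.pt Y.pt) × Path Y.pt Y.pt =>
      q.1.1.trans (q.1.2.trans q.2) :=
    Path.continuous_trans.comp ((by fun_prop : Continuous
      fun q : (Path Y.pt Y.pt × Path Y.pt Y.pt) × Path Y.pt Y.pt => q.1.1).prodMk
      (Path.continuous_trans.comp (by fun_prop : Continuous
      fun q : (Path Y.pt Y.pt × Path Y.pt Y.pt) × Path Y.pt Y.pt => (q.1.2, q.2))))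
  have h : PtdMap.Homotopic (X := (Y.loop.prod Y.loop).prod Y.loop) (Y := Y.loop)
      ((loopMul Y).comp ((loopMul Y).prodMap ⟨ContinuousMap.id _, rfl⟩))
      ⟨⟨fun q : (Path Y.pt Y.pt × Path Y.pt Y.pt) × Path Y.pt Y.pt =>
        q.1.1.trans (q.1.2.trans q.2), c1⟩, by
          change (Path.refl Y.pt).trans ((Path.refl Y.pt).trans (Path.refl Y.pt)) = Path.refl Y.pt
          simp⟩ := by
    refine PtdMap.Homotopic.symm ⟨⟨⟨⟨fun q : I × ((Path Y.pt Y.pt × Path Y.pt Y.pt) ×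
      Path Y.pt Y.pt) => (Path.Homotopy.transAssoc q.2.1.1 q.2.1.2 q.2.2).symm.eval q.1, ?_⟩,
      fun p => Path.Homotopy.eval_zero _, fun p => Path.Homotopy.eval_one _⟩, ?_⟩⟩
    · refine Path.continuous_uncurry_iff.mp ?_
      change Continuous fun q : (I × ((Path Y.pt Y.pt × Path Y.pt Y.pt) × Path Y.pt Y.pt)) × I =>
        (Path.Homotopy.transAssoc q.1.2.1.1 q.1.2.1.2 q.1.2.2).symm (q.1.1, q.2)
      simp only [Path.Homotopy.transAssoc, Path.Homotopy.symm_symm]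
      refine (c1.comp (by fun_prop : Continuous fun q : (I × ((Path Y.pt Y.pt × Path Y.pt Y.pt) ×
        Path Y.pt Y.pt)) × I => q.1.2)).eval ?_
      fun_prop
    · rintro t p rfl
      refine Path.ext (funext fun s => ?_)
      change ((Path.refl Y.pt).trans ((Path.refl Y.pt).trans (Path.refl Y.pt))) _
        = ((Path.refl Y.pt).trans ((Path.refl Y.pt).trans (Path.refl Y.pt))) s
      simp
  exact PtdMap.Homotopic.comp_right h ((a.pair b).pair c)

/-- The group `[X, ΩY]`; its multiplication is induced by concatenation of loops. -/
instance loopGroup (X : PtdSpace.{u₁}) (Y : PtdSpace.{u₂}) : Group (HtpyClass X Y.loop) where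
  mul := Quotient.map₂ (fun a b => (loopMul Y).comp (a.pair b)) fun _ _ ha _ _ hb =>
    PtdMap.Homotopic.comp_left (loopMul Y) (PtdMap.Homotopic.pair ha hb)
  one := HtpyClass.zero X Y.loop
  inv := (loopInv Y).sharp
  mul_assoc := by
    rintro ⟨a⟩ ⟨b⟩ ⟨c⟩
    exact Quotient.sound (loopMul_assoc a b c)
  one_mul := by
    rintro ⟨a⟩
    exact Quotient.sound (loopMul_one_left a)
  mul_one := by
    rintro ⟨a⟩
    exact Quotient.sound (loopMul_one_right a)
  inv_mul_cancel := by
    rintro ⟨a⟩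
    exact Quotient.sound (loopMul_inv_left a)

/-- The free loop space `LY`, based at the constant loop at the base point. -/
def PtdSpace.freeLoop (Y : PtdSpace.{u₂}) : PtdSpace.{u₂} where
  carrier := {γ : C(I, Y) // γ 0 = γ 1}
  pt := ⟨ContinuousMap.const I Y.pt, rfl⟩

/-- The inclusion `ΩY → LY`. -/
def loopIncl (Y : PtdSpace.{u₂}) : PtdMap Y.loop Y.freeLoop where
  toMap :=
    { toFun := fun p : Path Y.pt Y.pt =>
        (⟨p.toContinuousMap, by simp⟩ : {γ : C(I, Y) // γ 0 = γ 1})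
      continuous_toFun := Continuous.subtype_mk continuous_induced_dom _ }
  map_pt := rfl

/-- The section `Y → LY` given by the constant loops. -/
def constLoop (Y : PtdSpace.{u₂}) : PtdMap Y Y.freeLoop where
  toMap :=
    { toFun := fun y => (⟨ContinuousMap.const I y, rfl⟩ : {γ : C(I, Y) // γ 0 = γ 1})
      continuous_toFun := Continuous.subtype_mk ContinuousMap.continuous_const' _ }
  map_pt := rfl

/-- The map `Lw : LY → LZ`. -/
def freeLoopMap (w : PtdMap Y Z) : PtdMap Y.freeLoop Z.freeLoop where
  toMap :=
    { toFun := fun γ : {γ : C(I, Y) // γ 0 = γ 1} =>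
        (⟨w.toMap.comp γ.1, congrArg w.toMap γ.2⟩ : {γ : C(I, Z) // γ 0 = γ 1})
      continuous_toFun := Continuous.subtype_mk
        ((ContinuousMap.continuous_postcomp w.toMap).comp continuous_subtype_val) _ }
  map_pt := Subtype.ext (ContinuousMap.ext fun _ => w.map_pt)

/-- The pointwise multiplication on `LY` induced by a multiplication on `Y`. -/
def freeLoopMul (m : PtdMap (Y.prod Y) Y) :
    PtdMap (Y.freeLoop.prod Y.freeLoop) Y.freeLoop where
  toMap :=
    { toFun := fun p : {γ : C(I, Y) // γ 0 = γ 1} × {γ : C(I, Y) // γ 0 = γ 1} =>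
        (⟨m.toMap.comp (p.1.1.prodMk p.2.1),
          congrArg m.toMap (Prod.ext p.1.2 p.2.2)⟩ : {γ : C(I, Y) // γ 0 = γ 1})
      continuous_toFun := Continuous.subtype_mk
        ((ContinuousMap.continuous_postcomp m.toMap).comp
          (ContinuousMap.continuous_of_continuous_uncurry _ (by
            change Continuous fun q : ({γ : C(I, Y) // γ 0 = γ 1} ×
              {γ : C(I, Y) // γ 0 = γ 1}) × I => ((q.1.1.1 q.2, q.1.2.1 q.2) : Y × Y)
            fun_prop))) _ }
  map_pt := Subtype.ext (ContinuousMap.ext fun _ => m.map_pt)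

/-! ### The homotopy fibre -/

/-- The homotopy fibre `E` of `w : Y → Z`: pairs of a point `y` and a path in `Z` from the base
point to `w y`. -/
def hoFibre (w : PtdMap Y Z) : PtdSpace.{max u₂ u₃} where
  carrier := {p : Y × C(I, Z) // p.2 0 = Z.pt ∧ p.2 1 = w.toMap p.1}
  pt := ⟨(Y.pt, ContinuousMap.const I Z.pt), rfl, w.map_pt.symm⟩

/-- The projection `p : E → Y`. -/
def hoFibreProj (w : PtdMap Y Z) : PtdMap (hoFibre w) Y where
  toMap :=
    { toFun := fun e : {p : Y × C(I, Z) // p.2 0 = Z.pt ∧ p.2 1 = w.toMap p.1} => e.1.1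
      continuous_toFun := by fun_prop }
  map_pt := rfl

/-! ### H-deviations -/

/-- `D : Y ∧ Y → Z` is the H-deviation of `f : Y → Z` for the multiplications `m` on `Y` and `n`
on `Z`: up to pointed homotopy, `D (y, y') · f (y · y') = f y · f y'` on `Y × Y`. -/
def IsHDeviation (m : PtdMap (Y.prod Y) Y) (n : PtdMap (Z.prod Z) Z) (f : PtdMap Y Z)
    (D : PtdMap (Y.smash Y) Z) : Prop :=
  (n.comp ((D.comp (toSmash Y Y)).pair (f.comp m))).Homotopic (n.comp (f.prodMap f))

/-- `δ : ΩY ∧ Y → ΩZ` is obtained from the H-deviation `D : LY ∧ LY → LZ` of `Lw` as follows: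
restrict `D` along `ΩY ∧ Y → LY ∧ LY` (the inclusion smashed with the constant loops), lift the
result, up to pointed homotopy, to a map `δ' : ΩY ∧ Y → ΩZ`, and let `δ` be the inverse of `δ'`
in the group `[ΩY ∧ Y, ΩZ]`. -/
def IsLoopDeviation (m : PtdMap (Y.prod Y) Y) (n : PtdMap (Z.prod Z) Z) (w : PtdMap Y Z)
    (δ : PtdMap (Y.loop.smash Y) Z.loop) : Prop :=
  ∃ (D : PtdMap (Y.freeLoop.smash Y.freeLoop) Z.freeLoop) (δ' : PtdMap (Y.loop.smash Y) Z.loop),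
    IsHDeviation (freeLoopMul m) (freeLoopMul n) (freeLoopMap w) D ∧
    ((loopIncl Z).comp δ').Homotopic (D.comp ((loopIncl Y).smashMap (constLoop Y))) ∧
    δ.Homotopic ((loopInv Z).comp δ')

/-- The pairing `[X, ΩY] × [X, Y] → [X, ΩZ]` given by `δ : ΩY ∧ Y → ΩZ`: it sends `(α, β)` to the
composite `X → X ∧ X → ΩY ∧ Y → ΩZ` of the reduced diagonal, `α ∧ β` and `δ`. -/
def deviationPairing (δ : PtdMap (Y.loop.smash Y) Z.loop) :
    HtpyClass X Y.loop → HtpyClass X Y → HtpyClass X Z.loop :=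
  Quotient.map₂ δ.smashComp fun _ _ ha _ _ hb => PtdMap.Homotopic.smashComp δ ha hb

end constructions

/-- The cokernel of a homomorphism of groups. If `H` is abelian, the normal closure of the image
is the image itself. -/
abbrev GroupCoker {G : Type u} {H : Type v} [Group G] [Group H] (φ : G →* H) : Type v :=
  H ⧸ Subgroup.normalClosure (φ.range : Set H)

/-! ### Conditions on spaces -/

/-- `Y` has the homotopy type of a CW complex. -/
def HasCWHomotopyType (Y : Type u) [TopologicalSpace Y] : Prop :=
  ∃ (K : Type u) (_ : TopologicalSpace K) (_ : T2Space K)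
    (_ : Topology.CWComplex (Set.univ : Set K)), Nonempty (ContinuousMap.HomotopyEquiv Y K)

/-- The base point of `Y` is non-degenerate: `(Y, pt)` is an NDR pair. -/
def PtdSpace.IsWellPointed (Y : PtdSpace.{u}) : Prop :=
  ∃ (r : C(Y, I)) (h : C(I × Y, Y)),
    (∀ y, r y = 0 ↔ y = Y.pt) ∧ (∀ y, h (0, y) = y) ∧ (∀ t, h (t, Y.pt) = Y.pt) ∧
      ∀ y, r y < 1 → h (1, y) = Y.pt

section HSpaces

variable (Y : Type u) [TopologicalSpace Y] [HSpace Y]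

/-- An H-space, based at its unit. -/
def HSpace.ptd : PtdSpace.{u} where
  carrier := Y
  pt := (HSpace.e : Y)

/-- The multiplication of an H-space as a pointed map. -/
def HSpace.mulMap : PtdMap ((HSpace.ptd Y).prod (HSpace.ptd Y)) (HSpace.ptd Y) where
  toMap := HSpace.hmul (X := Y)
  map_pt := HSpace.hmul_e_e (X := Y)

/-- `(x · y) · z` and `x · (y · z)` are homotopic, relative to the base point, as maps
`Y × Y × Y → Y`. -/
def HSpace.IsHomotopyAssociative : Prop :=
  ContinuousMap.HomotopicRel
    (⟨fun p => HSpace.hmul (HSpace.hmul (p.1, p.2.1), p.2.2), by fun_prop⟩ : C(Y × Y × Y, Y))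
    (⟨fun p => HSpace.hmul (p.1, HSpace.hmul (p.2.1, p.2.2)), by fun_prop⟩ : C(Y × Y × Y, Y))
    {(HSpace.e, HSpace.e, HSpace.e)}

/-- Every right translation `y ↦ y · b` is a homotopy equivalence. Every path-connected H-space
has this property, since then each right translation is homotopic to the identity. -/
def HSpace.HasInvertibleTranslations : Prop :=
  ∀ b : Y, ∃ φ : ContinuousMap.HomotopyEquiv Y Y, ∀ y : Y, φ.toFun y = HSpace.hmul (y, b)

end HSpaces

/-! Homotopies modulo homotopy relative to their ends (tracks) make the pointed maps $X\to Y$ into a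
groupoid, in which the automorphisms of the constant map are $[X,\Omega Y]$ (`loopEquiv`). Fix a
representative $b$ of $\beta$ and a null-homotopy $l\colon *\to wb$. A map to $E$ over $b$ is a
null-homotopy of $wb$, hence of the form $\gamma l$ with $\gamma\in[X,\Omega C]$. Two of these give
the same class in $[X,E]$ exactly if they differ by $w(k)$ for a track $k\colon b\to b$
(`hoFibreClass_eq_iff`).

To replace self-tracks of $b$ by elements of $[X,\Omega B]$, use right multiplication by $b$. It is
a functor that takes the constant map to $e\cdot b\simeq b$, and it is full, so every self-track of
$b$ is conjugate to some $\alpha\cdot b$. Therefore two lifts agree exactly if they differ by a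
value of $\psi(\alpha)=c\,w(\alpha\cdot b)\,c^{-1}$, which is a homomorphism because it is built
from functors and a conjugation (`translationHom`).

The formula for $\psi$ is checked in the free loop space. There conjugation by $c$ disappears, so
$\psi(\alpha)$ becomes $Lw(i\alpha\cdot s\beta)$, and the deviation compares this with
$Lw(i\alpha)\cdot Lw(s\beta)$, whose second factor is null. On $\Omega C$ the pointwise product is
concatenation, and $[X,\Omega C]\to[X,LC]$ is injective because $C$ is an H-space. This yields
$\mathfrak D'(\alpha,\beta)\,\psi(\alpha)=(\Omega w)\alpha$ (`translationHom_eq`). The group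
$[X,\Omega C]$ is abelian, so the cokernel is the quotient by the image.

Fullness (for $B$) and existence of the deviation (for $C$) both rest on a division, a pointed
inverse of $y\mapsto y\cdot b$ depending continuously on $b$ (`HSpace.exists_isDivision`). Single
translations are invertible by hypothesis. A CW complex has a countable numerable cover whose
inclusions are homotopic to locally constant maps (`CWFlow.exists_numerable_cover`), so inverses
exist over each member of the cover, and Dold's theorem glues them (`Fam.isUnit_of_cover`).
Non-degenerate base points turn free homotopies into pointed ones and make the deviation constant on
the wedge. -/

/-! ### The groupoid of tracks -/

noncomputable section tracks

open CategoryTheory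

universe u₁ u₂ u₃

/-- Continuous maps `X → Y` that send `S` to the point `y₀`. -/
structure RelMap (X : Type u₁) [TopologicalSpace X] (Y : Type u₂) [TopologicalSpace Y]
    (S : Set X) (y₀ : Y) where
  toMap : C(X, Y)
  map_mem : ∀ x ∈ S, toMap x = y₀

variable {X : Type u₁} [TopologicalSpace X] {Y : Type u₂} [TopologicalSpace Y]
  {Z : Type u₃} [TopologicalSpace Z] {S : Set X} {y₀ : Y} {z₀ : Z}

/-- A homotopy through maps that send `S` to `y₀`, with the real line as parameter space. -/
@[ext]
structure Track (f g : RelMap X Y S y₀) where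
  toFun : ℝ → X → Y
  cont : Continuous fun p : ℝ × X => toFun p.1 p.2
  eq_left : ∀ t ≤ 0, ∀ x, toFun t x = f.toMap x
  eq_right : ∀ t, 1 ≤ t → ∀ x, toFun t x = g.toMap x
  eq_base : ∀ t, ∀ x ∈ S, toFun t x = y₀

namespace Track

variable {f g h k : RelMap X Y S y₀}

/-- A track as a continuous map. -/
def toC (F : Track f g) : C(ℝ × X, Y) := ⟨fun p => F.toFun p.1 p.2, F.cont⟩

theorem continuous_apply {T : Type*} [TopologicalSpace T] (F : Track f g) {a : T → ℝ} {b : T → X}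
    (ha : Continuous a) (hb : Continuous b) : Continuous fun t => F.toFun (a t) (b t) :=
  F.cont.comp (ha.prodMk hb)

/-- Tracks are equivalent if they are homotopic relative to the ends and to `S`. -/
instance setoid (f g : RelMap X Y S y₀) : Setoid (Track f g) where
  r F G := F.toC.HomotopicRel G.toC {p | p.1 ≤ 0 ∨ 1 ≤ p.1 ∨ p.2 ∈ S}
  iseqv := ⟨fun _ => ContinuousMap.HomotopicRel.refl _, fun h => h.symm, fun h h' => h.trans h'⟩

/-- A family of tracks, given on the unit interval, makes its ends equivalent. -/
theorem equiv_of_family {F G : Track f g} (H : ℝ → ℝ → X → Y)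
    (hc : Continuous fun p : ℝ × ℝ × X => H p.1 p.2.1 p.2.2)
    (h0 : ∀ t, 0 ≤ t → t ≤ 1 → ∀ x, H 0 t x = F.toFun t x)
    (h1 : ∀ t, 0 ≤ t → t ≤ 1 → ∀ x, H 1 t x = G.toFun t x)
    (hl : ∀ u, 0 ≤ u → u ≤ 1 → ∀ x, H u 0 x = f.toMap x)
    (hr : ∀ u, 0 ≤ u → u ≤ 1 → ∀ x, H u 1 x = g.toMap x)
    (hb : ∀ u, 0 ≤ u → u ≤ 1 → ∀ t, 0 ≤ t → t ≤ 1 → ∀ x ∈ S, H u t x = y₀) : F ≈ G := by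
  -- `H` is controlled only for times in the unit interval, so it is evaluated at the clamped time.
  -- A track does not notice this, being constant on either side of the interval.
  have key : ∀ (F : Track f g) (t : ℝ) (x : X),
      F.toFun (max 0 (min 1 t)) x = F.toFun t x := by
    intro F t x
    rcases le_total t 0 with ht | ht
    · rw [min_eq_right (by linarith), max_eq_left ht, F.eq_left _ le_rfl, F.eq_left _ ht]
    rcases le_total 1 t with ht' | ht'
    · rw [min_eq_left ht', max_eq_right zero_le_one, F.eq_right _ le_rfl, F.eq_right _ ht']
    · rw [min_eq_right ht', max_eq_right ht]
  have hm : ∀ t : ℝ, 0 ≤ max 0 (min 1 t) ∧ max 0 (min 1 t) ≤ 1 := fun t =>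
    ⟨le_max_left _ _, max_le zero_le_one (min_le_left _ _)⟩
  refine ⟨⟨⟨⟨fun p => H p.1 (max 0 (min 1 p.2.1)) p.2.2, ?_⟩, ?_, ?_⟩, ?_⟩⟩
  · exact hc.comp (by fun_prop : Continuous fun p : I × ℝ × X =>
      ((p.1 : ℝ), max 0 (min 1 p.2.1), p.2.2))
  · rintro ⟨t, x⟩
    exact (h0 _ (hm t).1 (hm t).2 x).trans (key F t x)
  · rintro ⟨t, x⟩
    exact (h1 _ (hm t).1 (hm t).2 x).trans (key G t x)
  · rintro u ⟨t, x⟩ (ht | ht | hx)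
    · have : max 0 (min 1 t) = 0 := by
        rw [min_eq_right (le_trans ht zero_le_one), max_eq_left ht]
      change H u (max 0 (min 1 t)) x = F.toFun t x
      rw [this, hl u u.2.1 u.2.2, F.eq_left t ht]
    · have : max 0 (min 1 t) = 1 := by rw [min_eq_left ht, max_eq_right zero_le_one]
      change H u (max 0 (min 1 t)) x = F.toFun t x
      rw [this, hr u u.2.1 u.2.2, F.eq_right t ht]
    · exact (hb u u.2.1 u.2.2 _ (hm t).1 (hm t).2 x hx).trans (F.eq_base t x hx).symm

/-- An equivalence of tracks is given by a family of tracks. -/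
theorem exists_family {F G : Track f g} (h : F ≈ G) : ∃ H : ℝ → ℝ → X → Y,
    (Continuous fun p : ℝ × ℝ × X => H p.1 p.2.1 p.2.2) ∧
    (∀ t x, H 0 t x = F.toFun t x) ∧ (∀ t x, H 1 t x = G.toFun t x) ∧
    (∀ u, ∀ t ≤ 0, ∀ x, H u t x = f.toMap x) ∧ (∀ u t, 1 ≤ t → ∀ x, H u t x = g.toMap x) ∧
    ∀ u t, ∀ x ∈ S, H u t x = y₀ := by
  obtain ⟨A⟩ := h
  have hp0 : Set.projIcc (0 : ℝ) 1 zero_le_one 0 = 0 := Set.projIcc_left ..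
  have hp1 : Set.projIcc (0 : ℝ) 1 zero_le_one 1 = 1 := Set.projIcc_right ..
  refine ⟨fun u t x => A (Set.projIcc 0 1 zero_le_one u, (t, x)), ?_, ?_, ?_, ?_, ?_, ?_⟩
  · have : Continuous (Set.projIcc (0 : ℝ) 1 zero_le_one) := continuous_projIcc
    fun_prop
  · intro t x
    simp only [hp0]
    exact A.apply_zero _
  · intro t x
    simp only [hp1]
    exact A.apply_one _
  · intro u t ht x
    exact (A.eq_fst _ (Or.inl ht)).trans (F.eq_left t ht x)
  · intro u t ht x
    exact (A.eq_fst _ (Or.inr (Or.inl ht))).trans (F.eq_right t ht x)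
  · intro u t x hx
    exact (A.eq_fst _ (Or.inr (Or.inr hx))).trans (F.eq_base t x hx)

def refl (f : RelMap X Y S y₀) : Track f f where
  toFun _ x := f.toMap x
  cont := by fun_prop
  eq_left _ _ _ := rfl
  eq_right _ _ _ := rfl
  eq_base _ := f.map_mem

def symm (F : Track f g) : Track g f where
  toFun t x := F.toFun (1 - t) x
  cont := F.continuous_apply (by fun_prop) (by fun_prop)
  eq_left t ht := F.eq_right _ (by linarith)
  eq_right t ht := F.eq_left _ (by linarith)
  eq_base t := F.eq_base _

def trans (F : Track f g) (G : Track g h) : Track f h where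
  toFun t x := if t ≤ 1 / 2 then F.toFun (2 * t) x else G.toFun (2 * t - 1) x
  cont := by
    refine Continuous.if_le (F.continuous_apply (by fun_prop) (by fun_prop))
      (G.continuous_apply (by fun_prop) (by fun_prop)) (by fun_prop) (by fun_prop) ?_
    rintro ⟨t, x⟩ (rfl : t = 1 / 2)
    rw [F.eq_right _ (by norm_num), G.eq_left _ (by norm_num)]
  eq_left t ht x := by
    rw [if_pos (by linarith), F.eq_left _ (by linarith)]
  eq_right t ht x := by
    rw [if_neg (by linarith), G.eq_right _ (by linarith)]
  eq_base t x hx := by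
    split_ifs
    · exact F.eq_base _ x hx
    · exact G.eq_base _ x hx

theorem trans_of_le (F : Track f g) (G : Track g h) {t : ℝ} (ht : t ≤ 1 / 2) (x : X) :
    (F.trans G).toFun t x = F.toFun (2 * t) x := if_pos ht

theorem trans_of_ge (F : Track f g) (G : Track g h) {t : ℝ} (ht : 1 / 2 ≤ t) (x : X) :
    (F.trans G).toFun t x = G.toFun (2 * t - 1) x := by
  rcases ht.lt_or_eq with ht | rfl
  · exact if_neg (not_le.mpr ht)
  · rw [trans_of_le _ _ le_rfl, F.eq_right _ (by norm_num), G.eq_left _ (by norm_num)]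

theorem trans_congr {F F' : Track f g} {G G' : Track g h} (hF : F ≈ F') (hG : G ≈ G') :
    F.trans G ≈ F'.trans G' := by
  obtain ⟨A, Ac, A0, A1, Al, Ar, Ab⟩ := exists_family hF
  obtain ⟨B, Bc, B0, B1, Bl, Br, Bb⟩ := exists_family hG
  refine equiv_of_family (fun u t x => if t ≤ 1 / 2 then A u (2 * t) x else B u (2 * t - 1) x)
    ?_ ?_ ?_ ?_ ?_ ?_
  · refine Continuous.if_le
      (Ac.comp (by fun_prop : Continuous fun p : ℝ × ℝ × X => (p.1, 2 * p.2.1, p.2.2)))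
      (Bc.comp (by fun_prop : Continuous fun p : ℝ × ℝ × X => (p.1, 2 * p.2.1 - 1, p.2.2)))
      (by fun_prop) (by fun_prop) ?_
    rintro ⟨u, t, x⟩ (rfl : t = 1 / 2)
    exact (Ar _ _ (by norm_num) x).trans (Bl _ _ (by norm_num) x).symm
  · intro t _ _ x
    simp only [A0, B0]
    rfl
  · intro t _ _ x
    simp only [A1, B1]
    rfl
  · intro u _ _ x
    rw [if_pos (by norm_num), Al _ _ (by norm_num)]
  · intro u _ _ x
    rw [if_neg (by norm_num), Br _ _ (by norm_num)]
  · intro u _ _ t _ _ x hx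
    simp only [Ab _ _ x hx, Bb _ _ x hx, ite_self]

/-- Reparametrizing a track does not change its class. -/
theorem equiv_of_reparam {F G : Track f g} (ρ τ : ℝ → ℝ) (hρ : Continuous ρ) (hτ : Continuous τ)
    {a b : RelMap X Y S y₀} (K : Track a b)
    (hF : ∀ t, 0 ≤ t → t ≤ 1 → ∀ x, K.toFun (ρ t) x = F.toFun t x)
    (hG : ∀ t, 0 ≤ t → t ≤ 1 → ∀ x, K.toFun (τ t) x = G.toFun t x)
    (hl : ∀ u, 0 ≤ u → u ≤ 1 → ∀ x, K.toFun ((1 - u) * ρ 0 + u * τ 0) x = f.toMap x)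
    (hr : ∀ u, 0 ≤ u → u ≤ 1 → ∀ x, K.toFun ((1 - u) * ρ 1 + u * τ 1) x = g.toMap x) :
    F ≈ G := by
  refine equiv_of_family (fun u t x => K.toFun ((1 - u) * ρ t + u * τ t) x)
    (K.continuous_apply (by fun_prop) (by fun_prop)) ?_ ?_ hl hr
    (fun _ _ _ _ _ _ x hx => K.eq_base _ x hx)
  · intro t h0 h1 x
    rw [← hF t h0 h1]
    congr 1
    ring
  · intro t h0 h1 x
    rw [← hG t h0 h1]
    congr 1
    ring

theorem refl_trans (F : Track f g) : (refl f).trans F ≈ F := by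
  -- On the first half `2 * t - 1` is negative, where the track still rests at `f`. Constancy
  -- outside the unit interval lets reparametrizations leave it.
  refine equiv_of_reparam (fun t => 2 * t - 1) id (by fun_prop) (by fun_prop) F ?_ ?_ ?_ ?_
  · intro t _ _ x
    rcases le_total t (1 / 2) with ht | ht
    · rw [trans_of_le _ _ ht, F.eq_left _ (by linarith)]
      rfl
    · rw [trans_of_ge _ _ ht]
  · exact fun t _ _ x => rfl
  · exact fun u h0 h1 x => F.eq_left _ (by simp; linarith) x
  · exact fun u h0 h1 x => F.eq_right _ (by simp; linarith) x

theorem trans_refl (F : Track f g) : F.trans (refl g) ≈ F := by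
  refine equiv_of_reparam (fun t => 2 * t) id (by fun_prop) (by fun_prop) F ?_ ?_ ?_ ?_
  · intro t _ _ x
    rcases le_total t (1 / 2) with ht | ht
    · rw [trans_of_le _ _ ht]
    · rw [trans_of_ge _ _ ht, F.eq_right _ (by linarith)]
      rfl
  · exact fun t _ _ x => rfl
  · exact fun u h0 h1 x => F.eq_left _ (by simp) x
  · exact fun u h0 h1 x => F.eq_right _ (by simp; linarith) x

theorem trans_symm (F : Track f g) : F.trans F.symm ≈ refl f := by
  -- Running out and back is a tent-shaped reparametrization, which shrinks linearly to time `0`.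
  refine equiv_of_reparam (fun t => min (2 * t) (2 - 2 * t)) (fun _ => 0) (by fun_prop)
    (by fun_prop) F ?_ ?_ ?_ ?_
  · intro t _ _ x
    rcases le_total t (1 / 2) with ht | ht
    · rw [trans_of_le _ _ ht, min_eq_left (by linarith)]
    · rw [trans_of_ge _ _ ht, min_eq_right (by linarith)]
      change _ = F.toFun _ _
      congr 1
      ring
  · exact fun t _ _ x => F.eq_left _ le_rfl x
  · exact fun u h0 h1 x => F.eq_left _ (by norm_num) x
  · exact fun u h0 h1 x => F.eq_left _ (by norm_num) x

theorem symm_trans (F : Track f g) : F.symm.trans F ≈ refl g := by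
  refine equiv_of_reparam (fun t => max (1 - 2 * t) (2 * t - 1)) (fun _ => 1) (by fun_prop)
    (by fun_prop) F ?_ ?_ ?_ ?_
  · intro t _ _ x
    rcases le_total t (1 / 2) with ht | ht
    · rw [trans_of_le _ _ ht, max_eq_left (by linarith)]
      rfl
    · rw [trans_of_ge _ _ ht, max_eq_right (by linarith)]
  · exact fun t _ _ x => F.eq_right _ le_rfl x
  · exact fun u h0 h1 x => F.eq_right _ (by norm_num) x
  · exact fun u h0 h1 x => F.eq_right _ (by norm_num) x

theorem trans_assoc (F : Track f g) (G : Track g h) (K : Track h k) :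
    (F.trans G).trans K ≈ F.trans (G.trans K) := by
  -- The reparametrization has slopes 1/2, 1 and 2, with breaks at 1/2 and 3/4. It is convex, hence
  -- the maximum of its three affine pieces.
  refine equiv_of_reparam id (fun t => max (t / 2) (max (t - 1 / 4) (2 * t - 1))) (by fun_prop)
    (by fun_prop) ((F.trans G).trans K) (fun _ _ _ _ => rfl) ?_ ?_ ?_
  · intro t h0 h1 x
    rcases le_total t (1 / 2) with ht | ht
    · rw [max_eq_left (max_le (by linarith) (by linarith)), trans_of_le _ _ (by linarith),
        trans_of_le _ _ (by linarith), trans_of_le _ _ ht]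
      congr 1
      ring
    rcases le_total t (3 / 4) with ht' | ht'
    · rw [max_eq_left (a := t - 1 / 4) (by linarith), max_eq_right (a := t / 2) (by linarith),
        trans_of_le _ _ (by linarith),
        trans_of_ge _ _ (by linarith), trans_of_ge _ _ ht, trans_of_le _ _ (by linarith)]
      congr 1
      ring
    · rw [max_eq_right (a := t - 1 / 4) (by linarith), max_eq_right (a := t / 2) (by linarith),
        trans_of_ge _ _ (by linarith),
        trans_of_ge _ _ ht, trans_of_ge _ _ (by linarith)]
  · intro u h0 h1 x
    exact Track.eq_left _ _ (by norm_num) x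
  · intro u h0 h1 x
    exact Track.eq_right _ _ (by norm_num) x

theorem symm_congr {F F' : Track f g} (hF : F ≈ F') : F.symm ≈ F'.symm := by
  obtain ⟨A, Ac, A0, A1, Al, Ar, Ab⟩ := exists_family hF
  refine equiv_of_family (fun u t x => A u (1 - t) x)
    (Ac.comp (by fun_prop : Continuous fun p : ℝ × ℝ × X => (p.1, 1 - p.2.1, p.2.2)))
    (fun t _ _ x => A0 _ x) (fun t _ _ x => A1 _ x) (fun u _ _ x => Ar u _ (by norm_num) x)
    (fun u _ _ x => Al u _ (by norm_num) x) (fun u _ _ t _ _ x hx => Ab _ _ x hx)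

/-- The two ways around a square of maps are equivalent tracks. -/
theorem equiv_of_square {F : Track f g} {G : Track g k} {F' : Track f h} {G' : Track h k}
    (Ψ : ℝ → ℝ → X → Y) (hc : Continuous fun p : ℝ × ℝ × X => Ψ p.1 p.2.1 p.2.2)
    (hF : ∀ t, 0 ≤ t → t ≤ 1 → ∀ x, Ψ t 0 x = F.toFun t x)
    (hG : ∀ t, 0 ≤ t → t ≤ 1 → ∀ x, Ψ 1 t x = G.toFun t x)
    (hF' : ∀ t, 0 ≤ t → t ≤ 1 → ∀ x, Ψ 0 t x = F'.toFun t x)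
    (hG' : ∀ t, 0 ≤ t → t ≤ 1 → ∀ x, Ψ t 1 x = G'.toFun t x)
    (hb : ∀ s, 0 ≤ s → s ≤ 1 → ∀ t, 0 ≤ t → t ≤ 1 → ∀ x ∈ S, Ψ s t x = y₀) :
    F.trans G ≈ F'.trans G' := by
  have hm : ∀ t : ℝ, 0 ≤ t → t ≤ 1 → 0 ≤ max 0 (2 * t - 1) ∧ max 0 (2 * t - 1) ≤ 1 :=
    fun t h0 h1 => ⟨le_max_left _ _, max_le zero_le_one (by linarith)⟩
  have hn : ∀ t : ℝ, 0 ≤ t → t ≤ 1 → 0 ≤ min 1 (2 * t) ∧ min 1 (2 * t) ≤ 1 :=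
    fun t h0 h1 => ⟨le_min zero_le_one (by linarith), min_le_left _ _⟩
  have hconv : ∀ u a b : ℝ, 0 ≤ u → u ≤ 1 → 0 ≤ a ∧ a ≤ 1 → 0 ≤ b ∧ b ≤ 1 →
      0 ≤ (1 - u) * a + u * b ∧ (1 - u) * a + u * b ≤ 1 := by
    rintro u a b h0 h1 ⟨ha, ha'⟩ ⟨hb, hb'⟩
    constructor
    · have := mul_nonneg (sub_nonneg.2 h1) ha
      have := mul_nonneg h0 hb
      linarith
    · have := mul_le_mul_of_nonneg_left ha' (sub_nonneg.2 h1)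
      have := mul_le_mul_of_nonneg_left hb' h0
      linarith
  -- The two boundary paths of the unit square from (0,0) to (1,1) are joined by straight lines,
  -- which stay inside the square by convexity.
  refine equiv_of_family (fun u t x => Ψ ((1 - u) * min 1 (2 * t) + u * max 0 (2 * t - 1))
    ((1 - u) * max 0 (2 * t - 1) + u * min 1 (2 * t)) x) ?_ ?_ ?_ ?_ ?_ ?_
  · exact hc.comp (by fun_prop : Continuous fun p : ℝ × ℝ × X =>
      ((1 - p.1) * min 1 (2 * p.2.1) + p.1 * max 0 (2 * p.2.1 - 1),
      (1 - p.1) * max 0 (2 * p.2.1 - 1) + p.1 * min 1 (2 * p.2.1), p.2.2))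
  · intro t h0 h1 x
    simp only [sub_zero, one_mul, zero_mul, add_zero]
    rcases le_total t (1 / 2) with ht | ht
    · rw [trans_of_le _ _ ht, min_eq_right (by linarith), max_eq_left (by linarith),
        hF _ (by linarith) (by linarith)]
    · rw [trans_of_ge _ _ ht, min_eq_left (by linarith), max_eq_right (by linarith),
        hG _ (by linarith) (by linarith)]
  · intro t h0 h1 x
    simp only [sub_self, one_mul, zero_mul, zero_add]
    rcases le_total t (1 / 2) with ht | ht
    · rw [trans_of_le _ _ ht, min_eq_right (by linarith), max_eq_left (by linarith),
        hF' _ (by linarith) (by linarith)]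
    · rw [trans_of_ge _ _ ht, min_eq_left (by linarith), max_eq_right (by linarith),
        hG' _ (by linarith) (by linarith)]
  · intro u h0 h1 x
    have e : min (1 : ℝ) (2 * 0) = 0 ∧ max (0 : ℝ) (2 * 0 - 1) = 0 := by norm_num
    rw [e.1, e.2, mul_zero, mul_zero, add_zero, hF _ le_rfl zero_le_one, F.eq_left _ le_rfl]
  · intro u h0 h1 x
    have e : min (1 : ℝ) (2 * 1) = 1 ∧ max (0 : ℝ) (2 * 1 - 1) = 1 := by norm_num
    rw [e.1, e.2, mul_one, mul_one, sub_add_cancel, hG _ zero_le_one le_rfl, G.eq_right _ le_rfl]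
  · intro u h0 h1 t h0' h1' x hx
    obtain ⟨a0, a1⟩ := hconv u _ _ h0 h1 (hn t h0' h1') (hm t h0' h1')
    obtain ⟨b0, b1⟩ := hconv u _ _ h0 h1 (hm t h0' h1') (hn t h0' h1')
    exact hb _ a0 a1 _ b0 b1 x hx

/-- The image of a track under a map that may depend on a parameter. -/
def post (Φ : C(X × Y, Z)) {f' g' : RelMap X Z S z₀} (F : Track f g)
    (hf : ∀ x, f'.toMap x = Φ (x, f.toMap x)) (hg : ∀ x, g'.toMap x = Φ (x, g.toMap x))
    (hΦ : ∀ x ∈ S, Φ (x, y₀) = z₀) : Track f' g' where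
  toFun t x := Φ (x, F.toFun t x)
  cont := by
    have := F.cont
    fun_prop
  eq_left t ht x := by rw [F.eq_left t ht, hf]
  eq_right t ht x := by rw [F.eq_right t ht, hg]
  eq_base t x hx := by rw [F.eq_base t x hx, hΦ x hx]

/-- The track defined by a homotopy. -/
def ofHomotopy (H : f.toMap.Homotopy g.toMap) (hb : ∀ t, ∀ x ∈ S, H (t, x) = y₀) : Track f g where
  toFun t x := H (Set.projIcc 0 1 zero_le_one t, x)
  cont := by
    have : Continuous (Set.projIcc (0 : ℝ) 1 zero_le_one) := continuous_projIcc
    fun_prop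
  eq_left t ht x := by rw [Set.projIcc_of_le_left _ ht]; exact H.apply_zero x
  eq_right t ht x := by rw [Set.projIcc_of_right_le _ ht]; exact H.apply_one x
  eq_base t x hx := hb _ x hx

theorem ofHomotopy_apply (H : f.toMap.Homotopy g.toMap) (hb : ∀ t, ∀ x ∈ S, H (t, x) = y₀)
    {t : ℝ} (h0 : 0 ≤ t) (h1 : t ≤ 1) (x : X) :
    (ofHomotopy H hb).toFun t x = H (⟨t, h0, h1⟩, x) := by
  change H (Set.projIcc 0 1 zero_le_one t, x) = _
  rw [Set.projIcc_of_mem _ ⟨h0, h1⟩]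

/-- The homotopy defined by a track. -/
def toHomotopy (F : Track f g) : f.toMap.Homotopy g.toMap where
  toFun p := F.toFun p.1 p.2
  continuous_toFun := F.continuous_apply (by fun_prop) (by fun_prop)
  map_zero_left x := F.eq_left _ le_rfl x
  map_one_left x := F.eq_right _ le_rfl x

end Track

/-- This plays the role of the fundamental groupoid of the space of maps sending `S` to `y₀`,
without a topology on that space. Keeping all maps as objects allows null-homotopies and
self-homotopies of a nonconstant map to be composed. -/
instance RelMap.groupoid : Groupoid (RelMap X Y S y₀) where
  Hom f g := Quotient (Track.setoid f g)
  id f := ⟦Track.refl f⟧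
  comp := Quotient.map₂ Track.trans fun _ _ hF _ _ hG => Track.trans_congr hF hG
  id_comp := by
    rintro _ _ ⟨F⟩
    exact Quotient.sound F.refl_trans
  comp_id := by
    rintro _ _ ⟨F⟩
    exact Quotient.sound F.trans_refl
  assoc := by
    rintro _ _ _ _ ⟨F⟩ ⟨G⟩ ⟨K⟩
    exact Quotient.sound (F.trans_assoc G K)
  inv := Quotient.map Track.symm fun _ _ h => Track.symm_congr h
  inv_comp := by
    rintro _ _ ⟨F⟩
    exact Quotient.sound F.symm_trans
  comp_inv := by
    rintro _ _ ⟨F⟩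
    exact Quotient.sound F.trans_symm

/-- The class of a track. -/
def Track.toHom {f g : RelMap X Y S y₀} (F : Track f g) : f ⟶ g := Quotient.mk (Track.setoid f g) F

theorem Track.toHom_eq_iff {f g : RelMap X Y S y₀} {F G : Track f g} :
    F.toHom = G.toHom ↔ F ≈ G := Quotient.eq

theorem Track.toHom_surjective {f g : RelMap X Y S y₀} (a : f ⟶ g) : ∃ F : Track f g, F.toHom = a :=
  Quotient.exists_rep a

theorem Track.toHom_trans {f g h : RelMap X Y S y₀} (F : Track f g) (G : Track g h) :
    (F.trans G).toHom = F.toHom ≫ G.toHom := rfl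

theorem Track.toHom_symm {f g : RelMap X Y S y₀} (F : Track f g) :
    F.symm.toHom = Groupoid.inv F.toHom := rfl

/-- Postcomposition with a map that may depend on a parameter. -/
def RelMap.post (Φ : C(X × Y, Z)) (hΦ : ∀ x ∈ S, Φ (x, y₀) = z₀) :
    RelMap X Y S y₀ ⥤ RelMap X Z S z₀ where
  obj f := ⟨⟨fun x => Φ (x, f.toMap x), by fun_prop⟩, fun x hx => by
    simp only [ContinuousMap.coe_mk, f.map_mem x hx, hΦ x hx]⟩
  map {f g} := Quotient.map
    (fun F => F.post Φ (fun _ => rfl) (fun _ => rfl) hΦ) (by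
      intro F G h
      obtain ⟨A, Ac, A0, A1, Al, Ar, Ab⟩ := Track.exists_family h
      refine Track.equiv_of_family (fun u t x => Φ (x, A u t x)) (by fun_prop) ?_ ?_ ?_ ?_ ?_
      · intro t _ _ x
        rw [A0]
        rfl
      · intro t _ _ x
        rw [A1]
        rfl
      · intro u _ _ x
        rw [Al _ _ le_rfl]
        rfl
      · intro u _ _ x
        rw [Ar _ _ le_rfl]
        rfl
      · intro u _ _ t _ _ x hx
        rw [Ab _ _ _ hx, hΦ x hx])
  map_id _ := rfl
  map_comp := by
    rintro f g h ⟨F⟩ ⟨G⟩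
    refine congrArg (Quotient.mk _) ?_
    refine Track.ext (funext fun t => funext fun x => ?_)
    exact apply_ite (fun y => Φ (x, y)) _ _ _

/-- Parametrized maps that are inverse to each other up to homotopy induce an equivalence of
groupoids. -/
theorem RelMap.post_isEquivalence (Φ : C(X × Y, Z)) (hΦ : ∀ x ∈ S, Φ (x, y₀) = z₀)
    (Ψ : C(X × Z, Y)) (hΨ : ∀ x ∈ S, Ψ (x, z₀) = y₀)
    (H : C(I × X × Y, Y)) (hH0 : ∀ x y, H (0, x, y) = Ψ (x, Φ (x, y)))
    (hH1 : ∀ x y, H (1, x, y) = y) (hHb : ∀ t, ∀ x ∈ S, H (t, x, y₀) = y₀)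
    (K : C(I × X × Z, Z)) (hK0 : ∀ x z, K (0, x, z) = Φ (x, Ψ (x, z)))
    (hK1 : ∀ x z, K (1, x, z) = z) (hKb : ∀ t, ∀ x ∈ S, K (t, x, z₀) = z₀) :
    (RelMap.post (S := S) Φ hΦ).IsEquivalence := by
  have hp : Continuous (Set.projIcc (0 : ℝ) 1 zero_le_one) := continuous_projIcc
  have hp0 : Set.projIcc (0 : ℝ) 1 zero_le_one 0 = 0 := Set.projIcc_left ..
  have hp1 : Set.projIcc (0 : ℝ) 1 zero_le_one 1 = 1 := Set.projIcc_right ..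
  let η : RelMap.post (S := S) Φ hΦ ⋙ RelMap.post Ψ hΨ ≅ 𝟭 _ :=
    NatIso.ofComponents
      (fun f => (Groupoid.isoEquivHom _ _).symm (Track.toHom
        (Track.ofHomotopy (f := (RelMap.post Φ hΦ ⋙ RelMap.post Ψ hΨ).obj f) (g := f)
        ⟨⟨fun p => H (p.1, p.2, f.toMap p.2), by fun_prop⟩, fun x => hH0 _ _, fun x => hH1 _ _⟩
        (fun t x hx => by
          change H (t, x, f.toMap x) = y₀
          rw [f.map_mem x hx, hHb t x hx])))) (by
      rintro f g ⟨F⟩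
      -- Naturality is the square obtained by applying the homotopy at time `t` to the track at time
      -- `s`.
      refine Quotient.sound (Track.equiv_of_square
        (fun s t x => H (Set.projIcc 0 1 zero_le_one t, x, F.toFun s x)) ?_ ?_ ?_ ?_ ?_ ?_)
      · have := F.cont
        have hF : Continuous fun p : ℝ × ℝ × X => F.toFun p.1 p.2.2 :=
          F.continuous_apply (by fun_prop) (by fun_prop)
        fun_prop
      · intro t _ _ x
        rw [hp0, hH0]
        rfl
      · intro t _ _ x
        rw [F.eq_right _ le_rfl]
        rfl
      · intro t _ _ x
        rw [F.eq_left _ le_rfl]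
        rfl
      · intro t _ _ x
        rw [hp1, hH1]
      · intro s _ _ t _ _ x hx
        rw [F.eq_base _ x hx, hHb _ x hx])
  let ε : RelMap.post Ψ hΨ ⋙ RelMap.post (S := S) Φ hΦ ≅ 𝟭 _ :=
    NatIso.ofComponents
      (fun f => (Groupoid.isoEquivHom _ _).symm (Track.toHom
        (Track.ofHomotopy (f := (RelMap.post Ψ hΨ ⋙ RelMap.post Φ hΦ).obj f) (g := f)
        ⟨⟨fun p => K (p.1, p.2, f.toMap p.2), by fun_prop⟩, fun x => hK0 _ _, fun x => hK1 _ _⟩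
        (fun t x hx => by
          change K (t, x, f.toMap x) = z₀
          rw [f.map_mem x hx, hKb t x hx])))) (by
      rintro f g ⟨F⟩
      refine Quotient.sound (Track.equiv_of_square
        (fun s t x => K (Set.projIcc 0 1 zero_le_one t, x, F.toFun s x)) ?_ ?_ ?_ ?_ ?_ ?_)
      · have := F.cont
        have hF : Continuous fun p : ℝ × ℝ × X => F.toFun p.1 p.2.2 :=
          F.continuous_apply (by fun_prop) (by fun_prop)
        fun_prop
      · intro t _ _ x
        rw [hp0, hK0]
        rfl
      · intro t _ _ x
        rw [F.eq_right _ le_rfl]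
        rfl
      · intro t _ _ x
        rw [F.eq_left _ le_rfl]
        rfl
      · intro t _ _ x
        rw [hp1, hK1]
      · intro s _ _ t _ _ x hx
        rw [F.eq_base _ x hx, hKb _ x hx])
  exact (CategoryTheory.Equivalence.mk _ (RelMap.post Ψ hΨ) η.symm ε).isEquivalence_functor

end tracks


/-! ### The radial flow of a CW complex -/

noncomputable section cwFlow

open Topology Metric Set

namespace CWFlow

universe u₁ u₂

variable {K : Type u₁} [TopologicalSpace K] [T2Space K] [CWComplex (univ : Set K)]
  {Z : Type u₂} [TopologicalSpace Z]

open CWComplex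

local notation "𝕂" => (Set.univ : Set K)

/-- The set is the image under the characteristic map of a closed subset of the ball, which is
compact. -/
theorem isClosed_preimage_inter_closedCell {f : K → Z} {n : ℕ} {j : cell 𝕂 n}
    (hf : ContinuousOn (fun x => f (map n j x)) (closedBall 0 1)) {A : Set Z} (hA : IsClosed A) :
    IsClosed (f ⁻¹' A ∩ closedCell n j) := by
  have h1 : IsClosed (closedBall (0 : Fin n → ℝ) 1 ∩ (fun x => f (map n j x)) ⁻¹' A) :=
    hf.preimage_isClosed_of_isClosed isClosed_closedBall hA
  have h2 : IsCompact (closedBall (0 : Fin n → ℝ) 1 ∩ (fun x => f (map n j x)) ⁻¹' A) :=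
    (isCompact_closedBall _ _).of_isClosed_subset h1 inter_subset_left
  have h3 : f ⁻¹' A ∩ closedCell n j =
      map n j '' (closedBall (0 : Fin n → ℝ) 1 ∩ (fun x => f (map n j x)) ⁻¹' A) := by
    ext y
    constructor
    · rintro ⟨hy, x, hx, rfl⟩
      exact ⟨x, ⟨hx, hy⟩, rfl⟩
    · rintro ⟨x, ⟨hx, hy⟩, rfl⟩
      exact ⟨hy, x, hx, rfl⟩
  rw [h3]
  exact (h2.image_of_continuousOn ((continuousOn n j).mono inter_subset_left)).isClosed

/-- A function on a CW complex is continuous if, cell by cell, continuity on the boundary sphere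
implies continuity on the closed ball. -/
theorem continuous_of_cellwise {f : K → Z}
    (h : ∀ n (j : cell 𝕂 n), ContinuousOn (fun x => f (map n j x)) (sphere 0 1) →
      ContinuousOn (fun x => f (map n j x)) (closedBall 0 1)) : Continuous f := by
  have key : ∀ n (j : cell 𝕂 n), ContinuousOn (fun x => f (map n j x)) (closedBall 0 1) := by
    intro n
    induction n using Nat.strong_induction_on with
    | _ n ih =>
    intro j
    apply h
    refine continuousOn_iff_isClosed.mpr fun A hA => ?_
    -- The frontier lies in closed cells of lower dimension, where the induction hypothesis applies.
    -- This gives continuity on the sphere, as `h` requires.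
    have h1 : IsClosed (f ⁻¹' A ∩ cellFrontier n j) := by
      cases n with
      | zero => rw [RelCWComplex.cellFrontier_zero_eq_empty, inter_empty]; exact isClosed_empty
      | succ n =>
        exact CWComplex.isClosed_inter_cellFrontier_succ_of_le_isClosed_inter_closedCell
          (fun m hm i => isClosed_preimage_inter_closedCell (ih m (Nat.lt_succ_of_le hm) i) hA) j
    refine ⟨_, (((continuousOn n j).mono sphere_subset_closedBall).preimage_isClosed_of_isClosed
      isClosed_sphere h1), ?_⟩
    ext x
    constructor
    · rintro ⟨hx, hs⟩
      exact ⟨⟨hs, hx, x, hs, rfl⟩, hs⟩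
    · rintro ⟨⟨hs, hx, -⟩, -⟩
      exact ⟨hx, hs⟩
  refine continuous_iff_isClosed.mpr fun A hA => ?_
  exact (CWComplex.closed 𝕂 _ (subset_univ _)).mpr
    fun n j => isClosed_preimage_inter_closedCell (key n j) hA

theorem exists_cellData (y : K) : ∃ d : Σ n, cell 𝕂 n × (Fin n → ℝ),
    ‖d.2.2‖ < 1 ∧ map d.1 d.2.1 d.2.2 = y := by
  have hy : y ∈ ⋃ (n : ℕ) (j : cell 𝕂 n), openCell n j := by
    rw [CWComplex.iUnion_openCell_eq_complex]
    trivial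
  simp only [mem_iUnion] at hy
  obtain ⟨n, j, x, hx, rfl⟩ := hy
  exact ⟨⟨n, j, x⟩, by simpa using hx, rfl⟩

/-- The open cell that contains a point, and the coordinates of the point in it. -/
def cellData (y : K) : Σ n, cell 𝕂 n × (Fin n → ℝ) := (exists_cellData y).choose

theorem norm_cellData_lt (y : K) : ‖(cellData y).2.2‖ < 1 := (exists_cellData y).choose_spec.1

theorem map_cellData (y : K) : map (cellData y).1 (cellData y).2.1 (cellData y).2.2 = y :=
  (exists_cellData y).choose_spec.2

/-- Open cells are pairwise disjoint and characteristic maps are injective on open balls, so the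
chosen data are the only possible ones. -/
theorem cellData_map (n : ℕ) (j : cell 𝕂 n) (x : Fin n → ℝ) (hx : ‖x‖ < 1) :
    cellData (map n j x) = ⟨n, j, x⟩ := by
  have h1 := norm_cellData_lt (map n j x)
  have h2 := map_cellData (map n j x)
  generalize cellData (map n j x) = d at h1 h2
  obtain ⟨m, i, z⟩ := d
  dsimp only at h1 h2
  have : (⟨m, i⟩ : Σ n, cell 𝕂 n) = ⟨n, j⟩ := by
    by_contra hne
    exact Set.disjoint_left.mp (CWComplex.disjoint_openCell_of_ne hne)
      ⟨z, by simpa using h1, h2⟩ ⟨x, by simpa using hx, rfl⟩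
  obtain ⟨rfl, h⟩ := Sigma.mk.inj_iff.mp this
  obtain rfl := eq_of_heq h
  have : z = x := by
    refine (map m i).injOn ?_ ?_ h2
    · rw [source_eq]; simpa using h1
    · rw [source_eq]; simpa using hx
  rw [this]

/-- The dimension of the open cell that contains a point. -/
def dim (y : K) : ℕ := (cellData y).1

theorem dim_map_of_norm_lt {n : ℕ} {j : cell 𝕂 n} {x : Fin n → ℝ} (hx : ‖x‖ < 1) :
    dim (map n j x) = n := by
  rw [dim, cellData_map n j x hx]

/-- This drop of dimension on the boundary sphere makes the recursions for `flow` and `level`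
terminate. -/
theorem dim_map_of_norm_eq {n : ℕ} {j : cell 𝕂 n} {x : Fin n → ℝ} (hx : ‖x‖ = 1) :
    dim (map n j x) < n := by
  obtain ⟨J, hJ⟩ := CWComplex.cellFrontier_subset_finite_openCell n j
  have := hJ ⟨x, by simpa using hx, rfl⟩
  simp only [mem_iUnion] at this
  obtain ⟨m, hm, i, -, z, hz, h⟩ := this
  rw [← h, dim_map_of_norm_lt (by simpa using hz)]
  exact hm

theorem norm_normalize {n : ℕ} {x : Fin n → ℝ} (hx : 0 < ‖x‖) : ‖‖x‖⁻¹ • x‖ = 1 := by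
  rw [norm_smul, norm_inv, norm_norm, inv_mul_cancel₀ hx.ne']

/-- The flow on a CW complex that moves each point radially away from the center of its cell. -/
def flow (s : ℝ) (y : K) : K :=
  -- Time is multiplicative: `s` scales the coordinate. Reaching the boundary uses up the factor
  -- `‖x‖⁻¹` and leaves the time `s * ‖x‖` for the boundary point. A center falls under the first
  -- case, so the last branch is never reached.
  if s * ‖(cellData y).2.2‖ ≤ 1 then map (cellData y).1 (cellData y).2.1 (s • (cellData y).2.2)
  else if 0 < ‖(cellData y).2.2‖ then flow (s * ‖(cellData y).2.2‖)
    (map (cellData y).1 (cellData y).2.1 (‖(cellData y).2.2‖⁻¹ • (cellData y).2.2))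
  else y
termination_by dim y
decreasing_by
  exact dim_map_of_norm_eq (norm_normalize ‹_›)

theorem flow_one (y : K) : flow 1 y = y := by
  rw [flow, if_pos (by rw [one_mul]; exact (norm_cellData_lt y).le), one_smul, map_cellData]

theorem flow_map_of_le {n : ℕ} {j : cell 𝕂 n} {x : Fin n → ℝ} {s : ℝ} (hx : ‖x‖ ≤ 1)
    (hs : 1 ≤ s) (h : s * ‖x‖ ≤ 1) : flow s (map n j x) = map n j (s • x) := by
  rcases hx.lt_or_eq with hx | hx
  · rw [flow, cellData_map n j x hx]
    exact if_pos h
  · rw [hx, mul_one] at h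
    rw [le_antisymm h hs, flow_one, one_smul]

/-- Together with the preceding formula this describes the flow on the whole closed ball for times
at least 1. The two agree where `s * ‖x‖ = 1`, as gluing requires. -/
theorem flow_map_of_ge {n : ℕ} {j : cell 𝕂 n} {x : Fin n → ℝ} {s : ℝ} (hx : ‖x‖ ≤ 1)
    (hx0 : 0 < ‖x‖) (h : 1 ≤ s * ‖x‖) :
    flow s (map n j x) = flow (s * ‖x‖) (map n j (‖x‖⁻¹ • x)) := by
  rcases hx.lt_or_eq with hx | hx
  · rcases h.lt_or_eq with h | h
    · rw [flow, cellData_map n j x hx]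
      dsimp only
      rw [if_neg (not_le.mpr h), if_pos hx0]
    · have hs : s = ‖x‖⁻¹ := eq_inv_of_mul_eq_one_left h.symm
      rw [flow_map_of_le hx.le ?_ h.ge, ← h, flow_one, hs]
      rw [hs]
      exact (one_le_inv₀ hx0).mpr hx.le
  · rw [hx, mul_one, inv_one, one_smul]

/-- Functions of `K` that are determined on each cell by the values on its boundary are studied by
induction on the dimension. -/
theorem dim_induction {P : K → Prop}
    (h : ∀ n (j : cell 𝕂 n) (x : Fin n → ℝ), ‖x‖ < 1 →
      (0 < ‖x‖ → P (map n j (‖x‖⁻¹ • x))) → P (map n j x)) (y : K) : P y := by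
  have key : ∀ n, ∀ y : K, dim y = n → P y := by
    intro n
    induction n using Nat.strong_induction_on with
    | _ n ih =>
    rintro y rfl
    rw [← map_cellData y]
    exact h _ _ _ (norm_cellData_lt y) fun hx =>
      ih _ (dim_map_of_norm_eq (norm_normalize hx)) _ rfl
  exact key _ y rfl

/-- The orbit is radial until it meets the boundary and then the orbit of a boundary point,
continuous by induction. The time is cut off at 1 because the formulas for the flow need times at
least 1. -/
theorem continuous_flow_left (y : K) : Continuous fun s : ℝ => flow (max 1 s) y := by
  induction y using dim_induction with
  | _ n j x hx ih =>
  rcases (norm_nonneg x).eq_or_lt with h0 | h0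
  · have : ∀ s, flow (max 1 s) (map n j x) = map n j x := by
      intro s
      rw [flow_map_of_le hx.le (le_max_left _ _) (by rw [← h0, mul_zero]; exact zero_le_one),
        norm_eq_zero.mp h0.symm, smul_zero]
    simp only [this]
    exact continuous_const
  · have c1 : ContinuousOn (fun s : ℝ => map n j (max 1 s • x)) {s | max 1 s * ‖x‖ ≤ 1} := by
      refine (continuousOn n j).comp (by fun_prop) fun s hs => ?_
      simp only [mem_closedBall, dist_zero_right, norm_smul]
      rwa [Real.norm_of_nonneg (le_trans zero_le_one (le_max_left _ _))]
    have c2 : Continuous fun s : ℝ => flow (max 1 (max 1 s * ‖x‖)) (map n j (‖x‖⁻¹ • x)) :=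
      (ih h0).comp (by fun_prop : Continuous fun s : ℝ => max 1 s * ‖x‖)
    have cl1 : IsClosed {s : ℝ | max 1 s * ‖x‖ ≤ 1} := isClosed_le (by fun_prop) (by fun_prop)
    have cl2 : IsClosed {s : ℝ | 1 ≤ max 1 s * ‖x‖} := isClosed_le (by fun_prop) (by fun_prop)
    rw [← continuousOn_univ]
    have : (univ : Set ℝ) = {s : ℝ | max 1 s * ‖x‖ ≤ 1} ∪ {s : ℝ | 1 ≤ max 1 s * ‖x‖} := by
      ext s
      simpa using le_total _ _
    rw [this]
    refine ContinuousOn.union_of_isClosed (c1.congr fun s hs => ?_)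
      (c2.continuousOn.congr fun s hs => ?_) cl1 cl2
    · exact flow_map_of_le hx.le (le_max_left _ _) hs
    · dsimp only
      rw [flow_map_of_ge hx.le h0 hs, max_eq_right (a := 1) (b := max 1 s * ‖x‖) hs]

/-- The cellwise criterion concerns maps defined on `K`, not on `ℝ × K`, so the flow is curried to a
map from `K` to `C(ℝ, K)`. Local compactness of the line allows passing back. -/
theorem continuous_flow : Continuous fun p : ℝ × K => flow (max 1 p.1) p.2 := by
  let g : K → C(ℝ, K) := fun y => ⟨fun s => flow (max 1 s) y, continuous_flow_left y⟩
  suffices hg : Continuous g by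
    have : Continuous fun p : ℝ × K => g p.2 p.1 := by fun_prop
    exact this
  refine continuous_of_cellwise fun n j hs => ?_
  rw [continuousOn_iff_continuous_domRestrict] at hs ⊢
  refine ContinuousMap.continuous_of_continuous_uncurry _ ?_
  have hs' : Continuous fun p : sphere (0 : Fin n → ℝ) 1 × ℝ => flow (max 1 p.2) (map n j p.1) := by
    have := hs.comp (continuous_fst (X := sphere (0 : Fin n → ℝ) 1) (Y := ℝ))
    exact this.eval continuous_snd
  change Continuous fun p : closedBall (0 : Fin n → ℝ) 1 × ℝ =>
    flow (max 1 p.2) (map n j (p.1 : Fin n → ℝ))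
  have hb : ∀ p : closedBall (0 : Fin n → ℝ) 1 × ℝ, ‖(p.1 : Fin n → ℝ)‖ ≤ 1 := fun p =>
    mem_closedBall_zero_iff.mp p.1.2
  set A : Set (closedBall (0 : Fin n → ℝ) 1 × ℝ) :=
    {p | max 1 p.2 * ‖(p.1 : Fin n → ℝ)‖ ≤ 1} with hA
  set B : Set (closedBall (0 : Fin n → ℝ) 1 × ℝ) :=
    {p | 1 ≤ max 1 p.2 * ‖(p.1 : Fin n → ℝ)‖} with hB
  have cl1 : IsClosed A := isClosed_le (by fun_prop) (by fun_prop)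
  have cl2 : IsClosed B := isClosed_le (by fun_prop) (by fun_prop)
  have hB0 : ∀ p ∈ B, 0 < ‖(p.1 : Fin n → ℝ)‖ := by
    intro p hp
    by_contra h
    have : ‖(p.1 : Fin n → ℝ)‖ = 0 := le_antisymm (not_lt.mp h) (norm_nonneg _)
    have hp' : 1 ≤ max 1 p.2 * ‖(p.1 : Fin n → ℝ)‖ := hp
    rw [this, mul_zero] at hp'
    linarith
  have c1 : ContinuousOn (fun p : closedBall (0 : Fin n → ℝ) 1 × ℝ =>
      map n j (max 1 p.2 • (p.1 : Fin n → ℝ))) A := by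
    refine (continuousOn n j).comp (by fun_prop) fun p hp => ?_
    simp only [mem_closedBall, dist_zero_right, norm_smul]
    rwa [Real.norm_of_nonneg (le_trans zero_le_one (le_max_left _ _))]
  have c2 : ContinuousOn (fun p : closedBall (0 : Fin n → ℝ) 1 × ℝ =>
      flow (max 1 (max 1 p.2 * ‖(p.1 : Fin n → ℝ)‖))
        (map n j (‖(p.1 : Fin n → ℝ)‖⁻¹ • (p.1 : Fin n → ℝ)))) B := by
    rw [continuousOn_iff_continuous_domRestrict]
    have hq : Continuous fun p : B => ‖(p.1.1 : Fin n → ℝ)‖⁻¹ • (p.1.1 : Fin n → ℝ) :=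
      (Continuous.inv₀ (f := fun p : B => ‖(p.1.1 : Fin n → ℝ)‖) (by fun_prop)
        fun p => (hB0 p.1 p.2).ne').smul (by fun_prop)
    exact hs'.comp ((Continuous.subtype_mk hq fun p => by
      simpa using norm_normalize (hB0 p.1 p.2)).prodMk
      (by fun_prop : Continuous fun p : B => max 1 p.1.2 * ‖(p.1.1 : Fin n → ℝ)‖))
  rw [← continuousOn_univ]
  have : univ = A ∪ B := by
    ext p
    simpa [hA, hB] using le_total _ _
  rw [this]
  refine ContinuousOn.union_of_isClosed (c1.congr fun p hp => ?_) (c2.congr fun p hp => ?_) cl1 cl2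
  · exact flow_map_of_le (hb p) (le_max_left _ _) hp
  · dsimp only
    rw [flow_map_of_ge (hb p) (hB0 p hp) hp,
      max_eq_right (a := 1) (b := max 1 p.2 * ‖(p.1 : Fin n → ℝ)‖) hp]

/-- The reciprocal of the time after which the flow takes a point into the union of the cells of
dimension less than `m`. -/
def level (m : ℕ) (y : K) : ℝ :=
  if dim y < m then 1
  else if 0 < ‖(cellData y).2.2‖ then ‖(cellData y).2.2‖ * level m
    (map (cellData y).1 (cellData y).2.1 (‖(cellData y).2.2‖⁻¹ • (cellData y).2.2))
  else 0
termination_by dim y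
decreasing_by
  exact dim_map_of_norm_eq (norm_normalize ‹_›)

theorem level_eq_one {m : ℕ} {y : K} (h : dim y < m) : level m y = 1 := by
  rw [level, if_pos h]

theorem level_map_zero {m n : ℕ} {j : cell 𝕂 n} {x : Fin n → ℝ} (hx : ‖x‖ = 0) (h : m ≤ n) :
    level m (map n j x) = 0 := by
  have hx1 : ‖x‖ < 1 := by rw [hx]; exact zero_lt_one
  rw [level, if_neg (by rw [dim_map_of_norm_lt hx1]; exact not_lt.mpr h), cellData_map n j x hx1]
  exact if_neg (by rw [hx]; exact lt_irrefl _)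

theorem level_map {m n : ℕ} {j : cell 𝕂 n} {x : Fin n → ℝ} (hx : ‖x‖ ≤ 1)
    (hx0 : 0 < ‖x‖) (h : m ≤ n) : level m (map n j x) = ‖x‖ * level m (map n j (‖x‖⁻¹ • x)) := by
  rcases hx.lt_or_eq with hx | hx
  · rw [level, if_neg (by rw [dim_map_of_norm_lt hx]; exact not_lt.mpr h), cellData_map n j x hx]
    exact if_pos hx0
  · rw [hx, one_mul, inv_one, one_smul]

theorem level_nonneg_le_one (m : ℕ) (y : K) : 0 ≤ level m y ∧ level m y ≤ 1 := by
  induction y using dim_induction with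
  | _ n j x hx ih =>
  rcases lt_or_ge n m with h | h
  · rw [level_eq_one (by rwa [dim_map_of_norm_lt hx])]
    norm_num
  rcases (norm_nonneg x).eq_or_lt with h0 | h0
  · rw [level_map_zero h0.symm h]
    norm_num
  · obtain ⟨h1, h2⟩ := ih h0
    rw [level_map hx.le h0 h]
    exact ⟨mul_nonneg h0.le h1, mul_le_one₀ hx.le h1 h2⟩

theorem level_zero (y : K) : level 0 y = 0 := by
  induction y using dim_induction with
  | _ n j x hx ih =>
  rcases (norm_nonneg x).eq_or_lt with h0 | h0
  · exact level_map_zero h0.symm (Nat.zero_le _)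
  · rw [level_map hx.le h0 (Nat.zero_le _), ih h0, mul_zero]

/-- Away from the center of a cell of dimension at least `m`, the level is the norm times the level
of the boundary point. At the center it is squeezed to zero by the norm. On cells of smaller
dimension it is constant. -/
theorem continuous_level (m : ℕ) : Continuous (level m : K → ℝ) := by
  refine continuous_of_cellwise fun n j hs => ?_
  rcases lt_or_ge n m with h | h
  · refine (continuousOn_const (c := (1 : ℝ))).congr fun x hx => level_eq_one ?_
    have hx : ‖x‖ ≤ 1 := by simpa using hx
    rcases hx.lt_or_eq with hx | hx
    · rwa [dim_map_of_norm_lt hx]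
    · exact (dim_map_of_norm_eq hx).trans h
  · intro x hx
    have hx : ‖x‖ ≤ 1 := by simpa using hx
    have hbd : ∀ z : Fin n → ℝ, ‖z‖ ≤ 1 → |level m (map n j z)| ≤ ‖z‖ := by
      intro z hz
      rcases (norm_nonneg z).eq_or_lt with h0 | h0
      · rw [level_map_zero h0.symm h, abs_zero]
        exact h0.le
      · obtain ⟨h1, h2⟩ := level_nonneg_le_one m (map n j (‖z‖⁻¹ • z))
        rw [level_map hz h0 h, abs_of_nonneg (mul_nonneg h0.le h1)]
        exact mul_le_of_le_one_right h0.le h2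
    rcases (norm_nonneg x).eq_or_lt with h0 | h0
    · have hx0 : x = 0 := norm_eq_zero.mp h0.symm
      subst hx0
      rw [ContinuousWithinAt, level_map_zero h0.symm h]
      refine squeeze_zero_norm' (a := fun z => ‖z‖) ?_ ?_
      · filter_upwards [self_mem_nhdsWithin] with z hz
        exact hbd z (by simpa using hz)
      · have : Filter.Tendsto (fun z : Fin n → ℝ => ‖z‖) (𝓝 0) (𝓝 ‖(0 : Fin n → ℝ)‖) :=
          continuous_norm.tendsto _
        rw [norm_zero] at this
        exact this.mono_left nhdsWithin_le_nhds
    · have c : ContinuousOn (fun z : Fin n → ℝ => ‖z‖ * level m (map n j (‖z‖⁻¹ • z)))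
          {z | 0 < ‖z‖} := by
        refine continuousOn_id.norm.mul (hs.comp (f := fun z : Fin n → ℝ => ‖z‖⁻¹ • z) ?_ ?_)
        · exact (continuousOn_id.norm.inv₀ fun z hz => ne_of_gt hz).smul continuousOn_id
        · intro z hz
          simpa using norm_normalize hz
      have ho : IsOpen {z : Fin n → ℝ | 0 < ‖z‖} := isOpen_lt (by fun_prop) (by fun_prop)
      have := (c.continuousAt (ho.mem_nhds h0)).continuousWithinAt (s := closedBall 0 1)
      refine this.congr_of_eventuallyEq ?_ (level_map hx h0 h)
      filter_upwards [self_mem_nhdsWithin, mem_nhdsWithin_of_mem_nhds (ho.mem_nhds h0)] with z hz hz'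
      exact level_map (by simpa using hz) hz' h

/-- At the time `(level (m + 1) y)⁻¹` the point has just entered the cells of dimension at most `m`.
Since `level m y` is smaller, it enters dimension below `m` only later or never, so its dimension is
exactly `m`. -/
theorem dim_flow {m : ℕ} {y : K} (h : level m y < level (m + 1) y) :
    dim (flow (level (m + 1) y)⁻¹ y) = m := by
  induction y using dim_induction with
  | _ n j x hx ih =>
  have hd : dim (map n j x) = n := dim_map_of_norm_lt hx
  rcases lt_or_ge n (m + 1) with hn | hn
  · rw [level_eq_one (by rwa [hd]), inv_one, flow_one, hd]
    by_contra hne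
    rw [level_eq_one (by rw [hd]; omega), level_eq_one (by rw [hd]; omega)] at h
    exact lt_irrefl _ h
  rcases (norm_nonneg x).eq_or_lt with h0 | h0
  · rw [level_map_zero h0.symm hn, level_map_zero h0.symm (by omega)] at h
    exact absurd h (lt_irrefl _)
  · rw [level_map hx.le h0 hn, level_map hx.le h0 (by omega : m ≤ n)] at h
    have h' := lt_of_mul_lt_mul_left h h0.le
    have hpos := lt_of_le_of_lt (level_nonneg_le_one m _).1 h'
    have hle := (level_nonneg_le_one (m + 1) (map n j (‖x‖⁻¹ • x))).2
    rw [level_map hx.le h0 hn]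
    have he : (‖x‖ * level (m + 1) (map n j (‖x‖⁻¹ • x)))⁻¹ * ‖x‖ =
        (level (m + 1) (map n j (‖x‖⁻¹ • x)))⁻¹ := by
      field_simp
    rw [flow_map_of_ge hx.le h0, he]
    · exact ih h0 h'
    · rw [he]
      exact (one_le_inv₀ hpos).mpr hle

/-- Level 0 vanishes and the level of index `dim y + 1` is 1, so there is a first index with
positive level, and the jump occurs just before it. -/
theorem exists_level_lt (y : K) : ∃ m, level m y < level (m + 1) y := by
  classical
  have hex : ∃ m, 0 < level m y := ⟨dim y + 1, by
    rw [level_eq_one (Nat.lt_succ_self _)]; exact zero_lt_one⟩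
  have hmin := Nat.find_spec hex
  cases hm : Nat.find hex with
  | zero => rw [hm, level_zero] at hmin; exact absurd hmin (lt_irrefl _)
  | succ m =>
    rw [hm] at hmin
    refine ⟨m, lt_of_le_of_lt ?_ hmin⟩
    exact not_lt.mp (Nat.find_min hex (by omega : m < Nat.find hex))

/-- The rest of the `n`-skeleton is closed: every other closed cell of dimension at most `n` lies
entirely in it, and all remaining open cells miss it. -/
theorem isOpen_openCell_in_dim (n : ℕ) (j : cell 𝕂 n) :
    IsOpen {z : {y : K // dim y = n} | z.1 ∈ openCell n j} := by
  have hcl : IsClosed {y : K | dim y ≤ n ∧ y ∉ openCell n j} := by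
    refine CWComplex.isClosed_of_disjoint_openCell_or_isClosed_inter_closedCell (C := 𝕂)
      (subset_univ _) fun m _ i => ?_
    by_cases hi : n < m ∨ (⟨m, i⟩ : Σ n, cell 𝕂 n) = ⟨n, j⟩
    · left
      rw [Set.disjoint_left]
      rintro _ ⟨hy, hy'⟩ ⟨x, hx, rfl⟩
      rcases hi with hi | hi
      · rw [dim_map_of_norm_lt (by simpa using hx)] at hy
        omega
      · obtain ⟨rfl, h⟩ := Sigma.mk.inj_iff.mp hi
        obtain rfl := eq_of_heq h
        exact hy' ⟨x, hx, rfl⟩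
    · right
      obtain ⟨h1, h2⟩ := not_or.mp hi
      rw [inter_eq_right.mpr]
      · exact RelCWComplex.isClosed_closedCell
      · rintro _ ⟨x, hx, rfl⟩
        rcases (mem_closedBall_zero_iff.mp hx).lt_or_eq with hx | hx
        · refine ⟨by rw [dim_map_of_norm_lt hx]; omega, fun h => ?_⟩
          exact Set.disjoint_left.mp (CWComplex.disjoint_openCell_of_ne h2)
            ⟨x, by simpa using hx, rfl⟩ h
        · have := dim_map_of_norm_eq (j := i) hx
          refine ⟨by omega, ?_⟩
          rintro ⟨z, hz, h⟩
          rw [← h, dim_map_of_norm_lt (by simpa using hz)] at this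
          omega
  convert (hcl.isOpen_compl.preimage (continuous_subtype_val (p := fun y : K => dim y = n))) using 1
  ext z
  simp [z.2]

theorem cellData_of_mem {n : ℕ} {j : cell 𝕂 n} {z : K} (hz : z ∈ openCell n j) :
    cellData z = ⟨n, j, (map n j).symm z⟩ ∧ ‖(map n j).symm z‖ < 1 := by
  obtain ⟨x, hx, rfl⟩ := hz
  rw [(map n j).left_inv (by rw [source_eq]; exact hx)]
  exact ⟨cellData_map n j x (by simpa using hx), by simpa using hx⟩

theorem mem_openCell_cellData (z : K) : z ∈ openCell (cellData z).1 (cellData z).2.1 :=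
  ⟨(cellData z).2.2, by simpa using norm_cellData_lt z, map_cellData z⟩

/-- The points of dimension `n` can be contracted to the centers of their cells. -/
theorem exists_contraction (n : ℕ) : ∃ c : C({y : K // dim y = n}, K), IsLocallyConstant c ∧
    (⟨Subtype.val, continuous_subtype_val⟩ : C({y : K // dim y = n}, K)).Homotopic c := by
  have hd : ∀ z : {y : K // dim y = n}, ∃ j : cell 𝕂 n, z.1 ∈ openCell n j := by
    rintro ⟨z, rfl⟩
    exact ⟨_, mem_openCell_cellData z⟩
  -- Cell coordinates are scaled down to zero. Cells are open among the points of dimension `n`, so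
  -- continuity can be checked on one cell, and the end map is locally constant.
  let Φ : I × {y : K // dim y = n} → K := fun p =>
    map (cellData p.2.1).1 (cellData p.2.1).2.1 ((1 - (p.1 : ℝ)) • (cellData p.2.1).2.2)
  have hΦ : Continuous Φ := by
    refine continuous_iff_continuousAt.mpr fun ⟨t, z⟩ => ?_
    obtain ⟨j, hj⟩ := hd z
    have ho : IsOpen {p : I × {y : K // dim y = n} | p.2.1 ∈ openCell n j} :=
      (isOpen_openCell_in_dim n j).preimage continuous_snd
    have hsymm : ContinuousOn (map n j).symm (openCell n j) := by
      have := continuousOn_symm (C := 𝕂) n j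
      rwa [← (map n j).image_source_eq_target, source_eq] at this
    have hsymm' : ContinuousOn (fun p : I × {y : K // dim y = n} => (map n j).symm p.2.1)
        {p | p.2.1 ∈ openCell n j} :=
      hsymm.comp (f := fun p : I × {y : K // dim y = n} => p.2.1) (by fun_prop) fun p hp => hp
    have hc : ContinuousOn (fun p : I × {y : K // dim y = n} =>
        map n j ((1 - (p.1 : ℝ)) • (map n j).symm p.2.1)) {p | p.2.1 ∈ openCell n j} := by
      refine (continuousOn n j).comp (t := closedBall 0 1)
        (f := fun p : I × {y : K // dim y = n} => (1 - (p.1 : ℝ)) • (map n j).symm p.2.1)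
        (ContinuousOn.smul (f := fun p : I × {y : K // dim y = n} => 1 - (p.1 : ℝ))
          (by fun_prop) hsymm') ?_
      rintro ⟨s, y⟩ hp
      have h1 := (cellData_of_mem hp).2
      have h2 : |1 - (s : ℝ)| ≤ 1 := by
        rw [abs_le]
        constructor <;> linarith [s.2.1, s.2.2]
      simp only [mem_closedBall, dist_zero_right, norm_smul, Real.norm_eq_abs]
      exact mul_le_one₀ h2 (norm_nonneg _) h1.le
    refine (hc.continuousAt (ho.mem_nhds hj)).congr ?_
    filter_upwards [ho.mem_nhds hj] with p hp
    change _ = map _ _ _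
    rw [(cellData_of_mem hp).1]
  have h0 : ∀ z, Φ (0, z) = z.1 := fun z => by
    change map _ _ _ = _
    rw [Set.Icc.coe_zero, sub_zero, one_smul, map_cellData]
  refine ⟨⟨fun z => Φ (1, z), by fun_prop⟩, ?_, ⟨⟨⟨Φ, hΦ⟩, h0, fun z => rfl⟩⟩⟩
  refine (IsLocallyConstant.iff_eventually_eq _).mpr fun z => ?_
  obtain ⟨j, hj⟩ := hd z
  filter_upwards [(isOpen_openCell_in_dim n j).mem_nhds hj] with y hy
  change map _ _ _ = map _ _ _
  simp only [Set.Icc.coe_one, sub_self, zero_smul]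
  rw [(cellData_of_mem hy).1, (cellData_of_mem hj).1]

/-- A CW complex has a countable numerable cover by open sets whose inclusions are homotopic to
locally constant maps. -/
theorem exists_numerable_cover : ∃ v : ℕ → K → ℝ, (∀ n, Continuous (v n)) ∧
    (∀ n y, 0 ≤ v n y ∧ v n y ≤ (1 / 2) ^ n) ∧ (∀ y, ∃ n, 0 < v n y) ∧
    ∀ n, ∃ c : C({y : K // 0 < v n y}, K), IsLocallyConstant c ∧
      (⟨Subtype.val, continuous_subtype_val⟩ : C({y : K // 0 < v n y}, K)).Homotopic c := by
  -- Positivity means that the flow carries `y` to a point of dimension exactly `n`. The factor `(1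
  -- / 2) ^ n` is what later stops Dold's construction from changing near a given point.
  refine ⟨fun n y => (1 / 2) ^ n * max 0 (level (n + 1) y - level n y), fun n => ?_, fun n y => ?_,
    fun y => ?_, fun n => ?_⟩
  · have := continuous_level (K := K) n
    have := continuous_level (K := K) (n + 1)
    fun_prop
  · refine ⟨mul_nonneg (by positivity) (le_max_left _ _),
      mul_le_of_le_one_right (by positivity) (max_le zero_le_one ?_)⟩
    linarith [(level_nonneg_le_one n y).1, (level_nonneg_le_one (n + 1) y).2]
  · obtain ⟨m, hm⟩ := exists_level_lt y
    exact ⟨m, mul_pos (by positivity) (lt_max_of_lt_right (sub_pos.mpr hm))⟩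
  · have hlt : ∀ y : {y : K // 0 < (1 / 2 : ℝ) ^ n * max 0 (level (n + 1) y - level n y)},
        level n y.1 < level (n + 1) y.1 := by
      rintro ⟨y, hy⟩
      rcases lt_max_iff.mp (pos_of_mul_pos_right hy (by positivity)) with h | h
      · exact absurd h (lt_irrefl _)
      · exact sub_pos.mp h
    have hpos : ∀ y : {y : K // 0 < (1 / 2 : ℝ) ^ n * max 0 (level (n + 1) y - level n y)},
        0 < level (n + 1) y.1 := fun y => lt_of_le_of_lt (level_nonneg_le_one n y.1).1 (hlt y)
    have hge : ∀ y : {y : K // 0 < (1 / 2 : ℝ) ^ n * max 0 (level (n + 1) y - level n y)},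
        1 ≤ (level (n + 1) y.1)⁻¹ := fun y =>
      (one_le_inv₀ (hpos y)).mpr (level_nonneg_le_one (n + 1) y.1).2
    have hinv : Continuous fun y : {y : K // 0 < (1 / 2 : ℝ) ^ n * max 0 (level (n + 1) y - level n y)} =>
        (level (n + 1) y.1)⁻¹ :=
      ((continuous_level (n + 1)).comp continuous_subtype_val).inv₀ fun y => (hpos y).ne'
    obtain ⟨c, hc, ⟨H⟩⟩ := exists_contraction (K := K) n
    have hR : ∀ y : {y : K // 0 < (1 / 2 : ℝ) ^ n * max 0 (level (n + 1) y - level n y)},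
        dim (flow (max 1 (level (n + 1) y.1)⁻¹) y.1) = n := fun y => by
      rw [max_eq_right (hge y)]
      exact dim_flow (hlt y)
    let R : C({y : K // 0 < (1 / 2 : ℝ) ^ n * max 0 (level (n + 1) y - level n y)}, {y : K // dim y = n}) :=
      ⟨fun y => ⟨flow (max 1 (level (n + 1) y.1)⁻¹) y.1, hR y⟩,
        Continuous.subtype_mk (continuous_flow.comp (hinv.prodMk continuous_subtype_val)) hR⟩
    refine ⟨c.comp R, hc.comp_continuous R.continuous, ?_⟩
    -- First flow, with time running linearly from 1 to the inverse level, into the points of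
    -- dimension `n`; then contract these to the centers.
    refine ContinuousMap.Homotopic.trans ⟨⟨⟨fun p => flow (max 1 (1 + p.1 *
      ((level (n + 1) p.2.1)⁻¹ - 1))) p.2.1, ?_⟩, fun y => ?_, fun y => ?_⟩⟩
      (ContinuousMap.Homotopic.comp ⟨H⟩ (ContinuousMap.Homotopic.refl R))
    · exact continuous_flow.comp (((continuous_const.add ((continuous_subtype_val.comp
        continuous_fst).mul ((hinv.comp continuous_snd).sub continuous_const)))).prodMk
        (continuous_subtype_val.comp continuous_snd))
    · simp [flow_one]
    · simp [R]

end CWFlow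

end cwFlow


/-! ### Families of self-maps and their inverses -/

noncomputable section families

open Set

universe u₁ u₂ u₃

/-- Families of self-maps of `Y` with parameter space `V`, up to homotopy. -/
def Fam (V : Type u₁) (Y : Type u₂) [TopologicalSpace V] [TopologicalSpace Y] : Type max u₁ u₂ :=
  Quotient (⟨ContinuousMap.Homotopic, ContinuousMap.Homotopic.equivalence⟩ : Setoid C(Y × V, Y))

namespace Fam

variable {V : Type u₁} {Y : Type u₂} [TopologicalSpace V] [TopologicalSpace Y]
  {W : Type u₃} [TopologicalSpace W]

/-- The class of a family. -/
def mk (f : C(Y × V, Y)) : Fam V Y := Quotient.mk _ f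

theorem mk_eq_iff {f g : C(Y × V, Y)} : mk f = mk g ↔ f.Homotopic g := Quotient.eq

/-- Composition over the parameter space. -/
def compMap (f g : C(Y × V, Y)) : C(Y × V, Y) := ⟨fun p => f (g p, p.2), by fun_prop⟩

theorem compMap_congr {f f' g g' : C(Y × V, Y)} (hf : f.Homotopic f') (hg : g.Homotopic g') :
    (compMap f g).Homotopic (compMap f' g') := by
  obtain ⟨F⟩ := hf
  obtain ⟨G⟩ := hg
  refine ⟨⟨⟨fun p => F (p.1, G p, p.2.2), by fun_prop⟩, fun p => ?_, fun p => ?_⟩⟩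
  · change F (0, G (0, p), p.2) = f (g p, p.2)
    rw [G.apply_zero, F.apply_zero]
  · change F (1, G (1, p), p.2) = f' (g' p, p.2)
    rw [G.apply_one, F.apply_one]

/-- The units are the fibre homotopy equivalences of `Y × V` over `V`. In this language
invertibility of all right translations together says that the class of the multiplication is a
unit. -/
instance : Monoid (Fam V Y) where
  mul := Quotient.map₂ compMap fun _ _ hf _ _ hg => compMap_congr hf hg
  one := mk ⟨Prod.fst, continuous_fst⟩
  mul_assoc := by
    rintro ⟨f⟩ ⟨g⟩ ⟨h⟩
    rfl
  one_mul := by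
    rintro ⟨f⟩
    rfl
  mul_one := by
    rintro ⟨f⟩
    rfl

theorem mk_mul_mk (f g : C(Y × V, Y)) : mk f * mk g = mk (compMap f g) := rfl

theorem one_eq_mk : (1 : Fam V Y) = mk ⟨Prod.fst, continuous_fst⟩ := rfl

/-- Change of the parameter space. -/
def pullMap (r : C(W, V)) (f : C(Y × V, Y)) : C(Y × W, Y) :=
  ⟨fun p => f (p.1, r p.2), by fun_prop⟩

/-- Change of the parameter space, on classes. -/
def pull (r : C(W, V)) : Fam V Y →* Fam W Y where
  toFun := Quotient.map (pullMap r) (by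
    rintro f g ⟨F⟩
    exact ⟨⟨⟨fun p => F (p.1, p.2.1, r p.2.2), by fun_prop⟩, fun p => F.apply_zero _,
      fun p => F.apply_one _⟩⟩)
  map_one' := rfl
  map_mul' := by
    rintro ⟨f⟩ ⟨g⟩
    rfl

theorem pull_mk (r : C(W, V)) (f : C(Y × V, Y)) : pull r (mk f) = mk (pullMap r f) := rfl

/-- A homotopy section of `f` can be deformed to a given homotopy inverse. -/
theorem exists_interpolation {f g : C(Y × V, Y)}
    (k : (compMap f g).Homotopy ⟨Prod.fst, continuous_fst⟩)
    (h : (compMap g f).Homotopic ⟨Prod.fst, continuous_fst⟩)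
    {T : Type u₃} [TopologicalSpace T] (x z : C(T, Y)) (v : C(T, V)) (ω : ℝ → T → Y)
    (hω : Continuous fun p : ℝ × T => ω p.1 p.2) (hω0 : ∀ t, ω 0 t = f (z t, v t))
    (hω1 : ∀ t, ω 1 t = x t) :
    ∃ (Z : ℝ → T → Y) (Ω : ℝ → ℝ → T → Y), (Continuous fun p : ℝ × T => Z p.1 p.2) ∧
      (Continuous fun p : ℝ × ℝ × T => Ω p.1 p.2.1 p.2.2) ∧ (∀ t, Z 0 t = z t) ∧
      (∀ t, Z 1 t = g (x t, v t)) ∧ (∀ s t, 0 ≤ s → s ≤ 1 → Ω 0 s t = ω s t) ∧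
      (∀ s t, 0 ≤ s → s ≤ 1 → Ω 1 s t = k (projIcc 0 1 zero_le_one s, x t, v t)) ∧
      (∀ r t, r ≤ 1 → Ω r 0 t = f (Z r t, v t)) ∧ ∀ r t, r ≤ 1 → Ω r 1 t = x t := by
  classical
  -- A point of `Y` is needed only to name a target for the empty set `S`.
  rcases isEmpty_or_nonempty T with hT | ⟨⟨t₀⟩⟩
  · exact ⟨fun _ => isEmptyElim, fun _ _ => isEmptyElim, continuous_of_const (by simp),
      continuous_of_const (by simp), by simp, by simp, by simp, by simp, by simp, by simp⟩
  obtain ⟨h⟩ := h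
  set y₀ : Y := x t₀
  let Φ : C(T × Y, Y) := ⟨fun p => f (p.2, v p.1), by fun_prop⟩
  have heq : (RelMap.post (S := (∅ : Set T)) (y₀ := y₀) (z₀ := y₀) Φ (by simp)).IsEquivalence :=
    RelMap.post_isEquivalence Φ (by simp) ⟨fun p => g (p.2, v p.1), by fun_prop⟩ (by simp)
      ⟨fun p => h (p.1, p.2.2, v p.2.1), by fun_prop⟩ (fun _ _ => h.apply_zero _)
      (fun _ _ => h.apply_one _) (by simp)
      ⟨fun p => k (p.1, p.2.2, v p.2.1), by fun_prop⟩ (fun _ _ => k.apply_zero _)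
      (fun _ _ => k.apply_one _) (by simp)
  let zz : RelMap T Y ∅ y₀ := ⟨z, by simp⟩
  let xx : RelMap T Y ∅ y₀ := ⟨x, by simp⟩
  let gx : RelMap T Y ∅ y₀ := ⟨⟨fun t => g (x t, v t), by fun_prop⟩, by simp⟩
  let P := RelMap.post (S := (∅ : Set T)) (y₀ := y₀) (z₀ := y₀) Φ (by simp)
  let kt : Track (P.obj gx) xx := Track.ofHomotopy
    ⟨⟨fun p => k (p.1, x p.2, v p.2), by fun_prop⟩, fun _ => k.apply_zero _, fun _ => k.apply_one _⟩
    (by simp)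
  let wt : Track (P.obj zz) xx := Track.ofHomotopy
    ⟨⟨fun p => ω p.1 p.2, by fun_prop⟩, fun _ => hω0 _, fun _ => hω1 _⟩ (by simp)
  -- Postcomposition with an invertible family is an equivalence of groupoids, hence full. So `ω`
  -- followed by the reverse of `k` is the image of a track `ζ` from `z` to `g x`.
  obtain ⟨ζ, hζ⟩ := P.map_surjective (CategoryTheory.CategoryStruct.comp wt.toHom
    (CategoryTheory.Groupoid.inv kt.toHom))
  obtain ⟨ζ, rfl⟩ := Track.toHom_surjective ζ
  have hζ' : CategoryTheory.CategoryStruct.comp (P.map ζ.toHom) kt.toHom = wt.toHom := by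
    rw [hζ, CategoryTheory.Category.assoc, CategoryTheory.Groupoid.inv_comp,
      CategoryTheory.Category.comp_id]
  set Q := (ζ.post Φ (f' := P.obj zz) (g' := P.obj gx) (fun _ => rfl) (fun _ => rfl)
    (by simp)).trans kt
  obtain ⟨A, Ac, A0, A1, Al, Ar, -⟩ := Track.exists_family
    (Track.toHom_eq_iff.mp (hζ' : Q.toHom = wt.toHom))
  -- For `r` up to 1/2 the point stays at `z` while `ω` is deformed to `Q`, which is the image of
  -- `ζ` followed by `k`. Afterwards the point runs along `ζ`, and the initial part of `Q` already
  -- covered is cut off until only `k` is left.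
  refine ⟨fun s t => ζ.toFun (2 * s - 1) t, fun r s t => if r ≤ 1 / 2 then A (1 - 2 * r) s t
    else Q.toFun ((2 * r - 1) / 2 + (1 - (2 * r - 1) / 2) * s) t,
    ζ.continuous_apply (by fun_prop) (by fun_prop), ?_, ?_, ?_, ?_, ?_, ?_, ?_⟩
  · refine Continuous.if_le (Ac.comp (by fun_prop : Continuous fun p : ℝ × ℝ × T =>
      (1 - 2 * p.1, p.2.1, p.2.2))) (Q.continuous_apply (by fun_prop) (by fun_prop))
      (by fun_prop) (by fun_prop) ?_
    rintro ⟨r, s, t⟩ (rfl : r = 1 / 2)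
    dsimp only
    rw [show (1 - 2 * (1 / 2) : ℝ) = 0 by norm_num, A0]
    congr 1
    ring
  · exact fun t => ζ.eq_left _ (by norm_num) t
  · exact fun t => ζ.eq_right _ (by norm_num) t
  · intro s t h0 h1
    dsimp only
    rw [if_pos (by norm_num), show (1 - 2 * 0 : ℝ) = 1 by norm_num, A1,
      Track.ofHomotopy_apply _ _ h0 h1]
    rfl
  · intro s t h0 h1
    dsimp only
    rw [if_neg (by norm_num), Track.trans_of_ge _ _ (by linarith)]
    rw [show (2 * ((2 * 1 - 1) / 2 + (1 - (2 * 1 - 1) / 2) * s) - 1 : ℝ) = s by ring]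
    rfl
  · intro r t hr1
    dsimp only
    split_ifs with hr
    · rw [Al _ _ le_rfl, ζ.eq_left _ (by linarith)]
      rfl
    · rw [Track.trans_of_le _ _ (by linarith)]
      rw [show (2 * ((2 * r - 1) / 2 + (1 - (2 * r - 1) / 2) * 0) : ℝ) = 2 * r - 1 by ring]
      rfl
  · intro r t hr1
    dsimp only
    split_ifs with hr
    · exact Ar _ _ le_rfl _
    · exact Q.eq_right _ (by linarith) t

/-! ### Dold's theorem: gluing homotopy sections over a numerable cover -/

/-- A section of the path fibration of a family of maps over the parameters in `W`. -/
structure IsSection {K : Type u₁} [TopologicalSpace K] (f : C(Y × K, Y)) (W : Set K)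
    (s : ℝ → Y → K → Y × Y) : Prop where
  cont : ContinuousOn (fun p : (ℝ × Y) × K => s p.1.1 p.1.2 p.2) {p | p.2 ∈ W}
  zero : ∀ x, ∀ k ∈ W, (s 0 x k).2 = f ((s 0 x k).1, k)
  one : ∀ x, ∀ k ∈ W, (s 1 x k).2 = x
  fst : ∀ t, 0 ≤ t → t ≤ 1 → ∀ x, ∀ k ∈ W, (s t x k).1 = (s 0 x k).1

theorem continuousOn_snd_mem_iff {P : Type u₁} {K : Type u₂} {Z : Type u₃} [TopologicalSpace P]
    [TopologicalSpace K] [TopologicalSpace Z] {f : P × K → Z} {O : Set K} :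
    ContinuousOn f {p | p.2 ∈ O} ↔ Continuous fun p : P × O => f (p.1, p.2.1) := by
  constructor
  · intro h
    exact h.comp_continuous (by fun_prop) fun p => p.2.2
  · intro h
    rw [continuousOn_iff_continuous_domRestrict]
    exact h.comp (by fun_prop : Continuous fun p : {p : P × K | p.2 ∈ O} =>
      ((p.1.1, ⟨p.1.2, p.2⟩) : P × O))

/-- A section over `{w > 0}` and a homotopy inverse over `{v > 0}` combine to a section over
`{w + v > 0}`, which agrees with the given section where `v` is small. -/
theorem exists_section_add {K : Type u₁} [TopologicalSpace K] {f : C(Y × K, Y)} {v w : K → ℝ}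
    (hv : Continuous v) (hw : Continuous w) (hv0 : ∀ k, 0 ≤ v k) (hw0 : ∀ k, 0 ≤ w k)
    (hu : IsUnit (pull (⟨Subtype.val, continuous_subtype_val⟩ : C({k // 0 < v k}, K)) (mk f)))
    {s : ℝ → Y → K → Y × Y} (hs : IsSection f {k | 0 < w k} s) :
    ∃ s', IsSection f {k | 0 < w k + v k} s' ∧
      ∀ t x k, 2 * v k ≤ w k → 0 < w k → 0 ≤ t → t ≤ 1 → s' t x k = s t x k := by
  obtain ⟨u, hu⟩ := hu
  obtain ⟨g, hg⟩ := Quotient.exists_rep u.inv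
  change mk g = u.inv at hg
  set fV := pullMap (⟨Subtype.val, continuous_subtype_val⟩ : C({k // 0 < v k}, K)) f with hfV
  have h1 : mk fV * mk g = 1 := by rw [hg, hfV, ← pull_mk, ← hu]; exact u.val_inv
  have h2 : mk g * mk fV = 1 := by rw [hg, hfV, ← pull_mk, ← hu]; exact u.inv_val
  rw [mk_mul_mk, one_eq_mk, mk_eq_iff] at h1 h2
  obtain ⟨k⟩ := h1
  let O : Set K := {k | 0 < v k ∧ 0 < w k}
  have hsO : Continuous fun p : (ℝ × Y) × O => s p.1.1 p.1.2 p.2.1 :=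
    hs.cont.comp_continuous (f := fun p : (ℝ × Y) × O => (p.1, p.2.1)) (by fun_prop)
      fun p => p.2.2.2
  have hsO' : ∀ {a : ℝ × (Y × O) → ℝ} (ha : Continuous a),
      Continuous fun p : ℝ × (Y × O) => s (a p) p.2.1 p.2.2.1 := fun ha =>
    hsO.comp (g := fun p : (ℝ × Y) × O => s p.1.1 p.1.2 p.2.1) (by fun_prop :
      Continuous fun p : ℝ × (Y × O) => ((_, p.2.1), p.2.2))
  -- Where `v` and `w` are both positive, the given section is deformed to the one made from `g` and
  -- `k`.
  obtain ⟨Z, Ω, Zc, Ωc, Z0, Z1, Ω0, Ω1, hΩ0, hΩ1⟩ := exists_interpolation k h2 (T := Y × O)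
    ⟨Prod.fst, continuous_fst⟩
    ⟨fun p => (s 0 p.1 p.2.1).1, (hsO.comp (by fun_prop :
      Continuous fun p : Y × O => (((0 : ℝ), p.1), p.2))).fst⟩
    ⟨fun p => ⟨p.2.1, p.2.2.1⟩, by fun_prop⟩ (fun t p => (s t p.1 p.2.1).2)
    (hsO' continuous_fst).snd (fun p => hs.zero _ _ p.2.2.2) (fun p => hs.one _ _ p.2.2.2)
  let cl : ℝ → ℝ := fun t => max 0 (min 1 t)
  have hcl : Continuous cl := by fun_prop
  have cl0 : ∀ t, 0 ≤ cl t := fun t => le_max_left _ _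
  have cl1 : ∀ t, cl t ≤ 1 := fun t => max_le zero_le_one (min_le_left _ _)
  have cl_eq : ∀ t, 0 ≤ t → t ≤ 1 → cl t = t := fun t h0 h1 => by
    simp only [cl, min_eq_right h1, max_eq_right h0]
  have cl_of_le : ∀ t ≤ 0, cl t = 0 := fun t h => by
    simp only [cl, min_eq_right (h.trans zero_le_one), max_eq_left h]
  have cl_of_ge : ∀ t, 1 ≤ t → cl t = 1 := fun t h => by
    simp only [cl, min_eq_left h, max_eq_right zero_le_one]
  -- The deformation parameter is 0 where `2 * v ≤ w` and 1 where `w ≤ v`, so the old section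
  -- survives in the first region and the local inverse takes over in the second.
  let c : K → ℝ := fun κ => cl (2 * v κ / w κ - 1)
  -- The three formulas agree on overlaps and each is continuous on an open set of a cover of `{w +
  -- v > 0}`. The last value is used only where both functions vanish.
  let s' : ℝ → Y → K → Y × Y := fun t x κ =>
    if 2 * v κ ≤ w κ ∧ 0 < w κ then s (cl t) x κ
    else if h : κ ∈ O then (Z (c κ) (x, ⟨κ, h⟩), Ω (c κ) (cl t) (x, ⟨κ, h⟩))
    else if h : 0 < v κ then (g (x, ⟨κ, h⟩), k (projIcc 0 1 zero_le_one (cl t), x, ⟨κ, h⟩))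
    else (x, x)
  have e1 : ∀ t x κ, 2 * v κ ≤ w κ → 0 < w κ → s' t x κ = s (cl t) x κ := fun t x κ h h' =>
    if_pos ⟨h, h'⟩
  have e2 : ∀ t x κ (h : κ ∈ O), s' t x κ =
      (Z (c κ) (x, ⟨κ, h⟩), Ω (c κ) (cl t) (x, ⟨κ, h⟩)) := by
    intro t x κ h
    by_cases hle : 2 * v κ ≤ w κ
    · have hc : c κ = 0 := cl_of_le _ (by
        have := (div_le_one h.2).mpr hle
        linarith)
      rw [e1 t x κ hle h.2, hc]
      refine Prod.ext ?_ ?_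
      · rw [hs.fst _ (cl0 t) (cl1 t) x κ h.2]
        exact (Z0 (x, ⟨κ, h⟩)).symm
      · exact (Ω0 _ (x, ⟨κ, h⟩) (cl0 t) (cl1 t)).symm
    · simp only [s']
      rw [if_neg (fun h => hle h.1), dif_pos h]
  have e3 : ∀ t x κ (h : w κ < v κ), s' t x κ =
      (g (x, ⟨κ, (hw0 κ).trans_lt h⟩), k (projIcc 0 1 zero_le_one (cl t), x,
        ⟨κ, (hw0 κ).trans_lt h⟩)) := by
    intro t x κ h
    by_cases hO : κ ∈ O
    · have hc : c κ = 1 := cl_of_ge _ (by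
        have := (one_le_div hO.2).mpr h.le
        rw [mul_div_assoc]
        linarith)
      rw [e2 t x κ hO, hc]
      exact Prod.ext (Z1 _) (Ω1 _ _ (cl0 t) (cl1 t))
    · simp only [s']
      rw [if_neg (fun h' => ?_), dif_neg hO, dif_pos ((hw0 κ).trans_lt h)]
      linarith [h'.1, hw0 κ]
  have hcases : ∀ κ, 0 < w κ + v κ → (2 * v κ < w κ) ∨ κ ∈ O ∨ w κ < v κ := by
    intro κ hκ
    rcases (hv0 κ).eq_or_lt with h | h
    · left
      rw [← h] at hκ ⊢
      linarith
    rcases (hw0 κ).eq_or_lt with h' | h'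
    · right; right
      rwa [← h']
    · exact Or.inr (Or.inl ⟨h, h'⟩)
  refine ⟨s', ⟨?_, ?_, ?_, ?_⟩, fun t x κ h h' h0 h1 => by rw [e1 t x κ h h', cl_eq t h0 h1]⟩
  · have o1 : IsOpen {κ | 2 * v κ < w κ} := isOpen_lt (by fun_prop) hw
    have o2 : IsOpen O := (isOpen_lt continuous_const hv).inter (isOpen_lt continuous_const hw)
    have o3 : IsOpen {κ | w κ < v κ} := isOpen_lt hw hv
    have lift : ∀ {U : Set K} (hU : IsOpen U), ContinuousOn
        (fun p : (ℝ × Y) × K => s' p.1.1 p.1.2 p.2) {p | p.2 ∈ U} → ∀ p : (ℝ × Y) × K, p.2 ∈ U →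
        ContinuousAt (fun p : (ℝ × Y) × K => s' p.1.1 p.1.2 p.2) p := fun hU h p hp =>
      h.continuousAt ((hU.preimage continuous_snd).mem_nhds hp)
    refine continuousOn_of_forall_continuousAt fun p hp => ?_
    rcases hcases p.2 hp with h | h | h
    · refine lift o1 ?_ p h
      refine (hs.cont.comp (f := fun p : (ℝ × Y) × K => ((cl p.1.1, p.1.2), p.2))
        (by fun_prop) fun q hq => ?_).congr fun q hq => e1 _ _ _ (le_of_lt hq) ?_
      · have h2 : 2 * v q.2 < w q.2 := hq
        exact (by linarith [hv0 q.2] : 0 < w q.2)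
      · have h2 : 2 * v q.2 < w q.2 := hq
        linarith [hv0 q.2]
    · refine lift o2 ?_ p h
      rw [continuousOn_snd_mem_iff]
      have : (fun p : (ℝ × Y) × O => s' p.1.1 p.1.2 p.2.1) = fun p =>
          (Z (c p.2.1) (p.1.2, p.2), Ω (c p.2.1) (cl p.1.1) (p.1.2, p.2)) :=
        funext fun q => e2 _ _ _ q.2.2
      change Continuous (fun p : (ℝ × Y) × O => s' p.1.1 p.1.2 p.2.1)
      rw [this]
      have hc : Continuous fun p : (ℝ × Y) × O => c p.2.1 :=
        hcl.comp ((Continuous.div (by fun_prop) (by fun_prop) fun q => q.2.2.2.ne').sub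
          continuous_const)
      exact (Zc.comp (hc.prodMk (by fun_prop : Continuous fun p : (ℝ × Y) × O =>
        (p.1.2, p.2)))).prodMk (Ωc.comp (hc.prodMk (by fun_prop :
          Continuous fun p : (ℝ × Y) × O => (cl p.1.1, (p.1.2, p.2)))))
    · refine lift o3 ?_ p h
      rw [continuousOn_snd_mem_iff]
      have : (fun p : (ℝ × Y) × {κ | w κ < v κ} => s' p.1.1 p.1.2 p.2.1) = fun p =>
          (g (p.1.2, ⟨p.2.1, (hw0 _).trans_lt p.2.2⟩), k (projIcc 0 1 zero_le_one (cl p.1.1),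
            p.1.2, ⟨p.2.1, (hw0 _).trans_lt p.2.2⟩)) :=
        funext fun q => e3 _ _ _ q.2.2
      change Continuous (fun p : (ℝ × Y) × {κ | w κ < v κ} => s' p.1.1 p.1.2 p.2.1)
      rw [this]
      have : Continuous (projIcc (0 : ℝ) 1 zero_le_one) := continuous_projIcc
      fun_prop
  · intro x κ hκ
    rcases hcases κ hκ with h | h | h
    · have h0 : 0 < w κ := by linarith [hv0 κ]
      rw [e1 _ _ _ h.le h0, cl_eq 0 le_rfl zero_le_one]
      exact hs.zero x κ h0
    · rw [e2 _ _ _ h, cl_eq 0 le_rfl zero_le_one]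
      exact hΩ0 _ _ (cl1 _)
    · rw [e3 _ _ _ h, cl_eq 0 le_rfl zero_le_one, projIcc_left]
      exact k.apply_zero _
  · intro x κ hκ
    rcases hcases κ hκ with h | h | h
    · have h0 : 0 < w κ := by linarith [hv0 κ]
      rw [e1 _ _ _ h.le h0, cl_eq 1 zero_le_one le_rfl]
      exact hs.one x κ h0
    · rw [e2 _ _ _ h, cl_eq 1 zero_le_one le_rfl]
      exact hΩ1 _ _ (cl1 _)
    · rw [e3 _ _ _ h, cl_eq 1 zero_le_one le_rfl, projIcc_right]
      exact k.apply_one _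
  · intro t ht0 ht1 x κ hκ
    rcases hcases κ hκ with h | h | h
    · have h0 : 0 < w κ := by linarith [hv0 κ]
      rw [e1 _ _ _ h.le h0, e1 _ _ _ h.le h0, hs.fst _ (cl0 _) (cl1 _) x κ h0,
        hs.fst _ (cl0 _) (cl1 _) x κ h0]
    · rw [e2 _ _ _ h, e2 _ _ _ h]
    · rw [e3 _ _ _ h, e3 _ _ _ h]

/-- Dold's theorem for a countable numerable cover: a family of maps that is invertible up to
homotopy over each member of the cover has a global homotopy section. -/
theorem exists_mul_eq_one {K : Type u₁} [TopologicalSpace K] {f : C(Y × K, Y)} {v : ℕ → K → ℝ}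
    (hv : ∀ n, Continuous (v n)) (hv0 : ∀ n k, 0 ≤ v n k ∧ v n k ≤ (1 / 2) ^ n)
    (hcov : ∀ k, ∃ n, 0 < v n k)
    (hu : ∀ n, IsUnit (pull (⟨Subtype.val, continuous_subtype_val⟩ : C({k // 0 < v n k}, K))
      (mk f))) : ∃ g, mk f * g = 1 := by
  let w : ℕ → K → ℝ := fun n k => ∑ i ∈ Finset.range n, v i k
  have hw : ∀ n, Continuous (w n) := fun n => by fun_prop
  have hw0 : ∀ n k, 0 ≤ w n k := fun n k => Finset.sum_nonneg fun i _ => (hv0 i k).1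
  have hws : ∀ n k, w (n + 1) k = w n k + v n k := fun n k => Finset.sum_range_succ _ _
  have hmono : ∀ {m n k}, m ≤ n → w m k ≤ w n k := fun {m n k} h =>
    Finset.sum_le_sum_of_subset_of_nonneg (Finset.range_mono h) fun i _ _ => (hv0 i k).1
  have base : IsSection f {k | 0 < w 0 k} fun _ x _ => (x, x) := by
    have h0 : ∀ k, ¬ 0 < w 0 k := fun k => by simp [w]
    refine ⟨?_, fun x k hk => absurd hk (h0 k), fun x k hk => absurd hk (h0 k),
      fun _ _ _ x k hk => absurd hk (h0 k)⟩
    fun_prop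
  have step : ∀ n s, IsSection f {k | 0 < w n k} s → ∃ s', IsSection f {k | 0 < w (n + 1) k} s' ∧
      ∀ t x k, 2 * v n k ≤ w n k → 0 < w n k → 0 ≤ t → t ≤ 1 → s' t x k = s t x k := by
    intro n s hs
    simp only [hws]
    exact exists_section_add (hv n) (hw n) (fun k => (hv0 n k).1) (hw0 n) (hu n) hs
  choose! next hnext hagree using step
  let S : ℕ → ℝ → Y → K → Y × Y := fun n => Nat.rec (fun _ x _ => (x, x)) next n
  have hS : ∀ n, IsSection f {k | 0 < w n k} (S n) := by
    intro n
    induction n with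
    | zero => exact base
    | succ n ih => exact hnext n _ ih
  -- The partial sums stay above a positive constant near `k₀` while `v n` tends to zero uniformly.
  -- Eventually `2 * v n ≤ w n`, and the sections no longer change.
  have hloc : ∀ k₀, ∃ N, ∀ᶠ k in nhds k₀, 0 < w N k ∧
      ∀ n, N ≤ n → ∀ t x, 0 ≤ t → t ≤ 1 → S n t x k = S N t x k := by
    intro k₀
    obtain ⟨m, hm⟩ := hcov k₀
    have hpos : 0 < w (m + 1) k₀ := by rw [hws]; linarith [hw0 m k₀]
    -- A quarter of the value at `k₀` suffices: twice `v n` is then below half of that value, which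
    -- is below `w n` nearby.
    obtain ⟨N, hN⟩ := exists_pow_lt_of_lt_one (half_pos (half_pos hpos))
      (by norm_num : (1 / 2 : ℝ) < 1)
    refine ⟨max N (m + 1), ?_⟩
    filter_upwards [(isOpen_lt continuous_const (hw (m + 1))).mem_nhds
      (half_lt_self hpos : w (m + 1) k₀ / 2 < w (m + 1) k₀)] with k hk
    have hbig : ∀ n, max N (m + 1) ≤ n → w (m + 1) k₀ / 2 < w n k := fun n hn =>
      lt_of_lt_of_le hk (hmono ((le_max_right _ _).trans hn))
    refine ⟨(half_pos hpos).trans (hbig _ le_rfl), fun n hn t x h0 h1 => ?_⟩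
    induction n, hn using Nat.le_induction with
    | base => rfl
    | succ n hn ih =>
      rw [← ih]
      refine hagree n _ (hS n) t x k ?_ ((half_pos hpos).trans (hbig n hn)) h0 h1
      have h2 : v n k ≤ (1 / 2) ^ N := (hv0 n k).2.trans
        (pow_le_pow_of_le_one (by norm_num) (by norm_num) ((le_max_left _ _).trans hn))
      linarith [hbig n hn]
  choose N hN using hloc
  have hNk : ∀ k, 0 < w (N k) k := fun k => (hN k).self_of_nhds.1
  let s : ℝ → Y → K → Y × Y := fun t x k => S (N k) t x k
  have hs : ∀ k₀, ∀ᶠ k in nhds k₀, ∀ t x, 0 ≤ t → t ≤ 1 → s t x k = S (N k₀) t x k := by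
    intro k₀
    filter_upwards [hN k₀] with k hk t x h0 h1
    have h3 := (hN k).self_of_nhds.2 (max (N k) (N k₀)) (le_max_left _ _) t x h0 h1
    have h4 := hk.2 (max (N k) (N k₀)) (le_max_right _ _) t x h0 h1
    exact h3.symm.trans h4
  have hc : Continuous fun p : I × Y × K => s p.1 p.2.1 p.2.2 := by
    refine continuous_iff_continuousAt.mpr fun ⟨t, x, k⟩ => ?_
    have h1 : ContinuousOn (fun p : I × Y × K => S (N k) p.1 p.2.1 p.2.2)
        {p | 0 < w (N k) p.2.2} :=
      (hS (N k)).cont.comp (f := fun p : I × Y × K => (((p.1 : ℝ), p.2.1), p.2.2)) (by fun_prop)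
        fun p hp => hp
    have ho : IsOpen {p : I × Y × K | 0 < w (N k) p.2.2} :=
      isOpen_lt continuous_const ((hw _).comp (by fun_prop))
    refine (h1.continuousAt (ho.mem_nhds (hNk k))).congr ?_
    have : Filter.Tendsto (fun p : I × Y × K => p.2.2) (nhds (t, x, k)) (nhds k) :=
      (by fun_prop : Continuous fun p : I × Y × K => p.2.2).tendsto _
    filter_upwards [this.eventually (hs k)] with p hp
    exact (hp _ _ p.1.2.1 p.1.2.2).symm
  refine ⟨mk ⟨fun p => (s ((0 : I) : ℝ) p.1 p.2).1, (hc.comp (by fun_prop :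
    Continuous fun p : Y × K => ((0 : I), p.1, p.2))).fst⟩, ?_⟩
  rw [mk_mul_mk, one_eq_mk, mk_eq_iff]
  refine ⟨⟨⟨fun p => (s p.1 p.2.1 p.2.2).2, (hc.comp (by fun_prop :
    Continuous fun p : I × Y × K => (p.1, p.2.1, p.2.2))).snd⟩, fun p => ?_, fun p => ?_⟩⟩
  · exact (hS (N p.2)).zero p.1 p.2 (hNk p.2)
  · exact (hS (N p.2)).one p.1 p.2 (hNk p.2)

/-- A family of maps that is invertible up to homotopy over each member of a countable numerable
cover is invertible up to homotopy. -/
theorem isUnit_of_cover {K : Type u₁} [TopologicalSpace K] {f : Fam K Y} {v : ℕ → K → ℝ}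
    (hv : ∀ n, Continuous (v n)) (hv0 : ∀ n k, 0 ≤ v n k ∧ v n k ≤ (1 / 2) ^ n)
    (hcov : ∀ k, ∃ n, 0 < v n k)
    (hu : ∀ n, IsUnit (pull (⟨Subtype.val, continuous_subtype_val⟩ : C({k // 0 < v n k}, K)) f)) :
    IsUnit f := by
  obtain ⟨f, rfl⟩ := Quotient.exists_rep f
  obtain ⟨g, hg⟩ := exists_mul_eq_one (f := f) hv hv0 hcov hu
  have hug : ∀ n, IsUnit (pull (⟨Subtype.val, continuous_subtype_val⟩ :
      C({k // 0 < v n k}, K)) g) := by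
    intro n
    obtain ⟨a, ha⟩ := hu n
    have h1 := congrArg (pull (⟨Subtype.val, continuous_subtype_val⟩ : C({k // 0 < v n k}, K))) hg
    rw [map_mul, map_one] at h1
    refine ⟨a⁻¹, ?_⟩
    rw [Units.inv_eq_of_mul_eq_one_right]
    rw [ha]
    exact h1
  obtain ⟨g', rfl⟩ := Quotient.exists_rep g
  -- The right inverse is itself locally invertible, being locally inverse to a unit, so it has a
  -- right inverse too. That one must be `f`, and `g'` is two-sided.
  obtain ⟨h, hh⟩ := exists_mul_eq_one (f := g') hv hv0 hcov hug
  have : mk f = h := left_inv_eq_right_inv hg hh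
  refine ⟨⟨mk f, mk g', hg, ?_⟩, rfl⟩
  rw [this]
  exact hh

/-- This permits a separate choice for each value of `c`, with no continuity in that value. -/
theorem continuous_of_isLocallyConstant {P : Type u₁} {Q : Type u₂} {Z : Type u₃} {V : Type*}
    [TopologicalSpace P] [TopologicalSpace V] [TopologicalSpace Z] {c : V → Q}
    (hc : IsLocallyConstant c) {f : Q → P → Z} (hf : ∀ q, Continuous (f q)) :
    Continuous fun p : P × V => f (c p.2) p.1 := by
  refine continuous_iff_continuousAt.mpr fun ⟨p, v⟩ => ?_
  have h : ContinuousAt (fun q : P × V => f (c v) q.1) (p, v) :=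
    ((hf (c v)).comp continuous_fst).continuousAt
  refine h.congr ?_
  have ht : Filter.Tendsto (fun q : P × V => q.2) (nhds (p, v)) (nhds v) :=
    continuous_snd.tendsto _
  filter_upwards [ht.eventually ((IsLocallyConstant.iff_eventually_eq c).mp hc v)] with q hq
  rw [hq]

/-- If all right translations of an H-space of the homotopy type of a CW complex are homotopy
equivalences, then the multiplication is invertible as a family of right translations. -/
theorem isUnit_hmul {Y : Type u₁} [TopologicalSpace Y] [HSpace Y] (hCW : HasCWHomotopyType Y)
    (ht : HSpace.HasInvertibleTranslations Y) : IsUnit (mk (HSpace.hmul : C(Y × Y, Y))) := by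
  obtain ⟨K, _, _, _, ⟨e⟩⟩ := hCW
  obtain ⟨v, hv, hv0, hcov, hc⟩ := CWFlow.exists_numerable_cover (K := K)
  -- The parameter is moved to the CW complex, where a numerable cover is available, and at the end
  -- pulled back along the homotopy equivalence.
  have hK : IsUnit (mk (pullMap e.invFun (HSpace.hmul : C(Y × Y, Y)))) := by
    refine isUnit_of_cover hv hv0 hcov fun n => ?_
    obtain ⟨c, hlc, ⟨H⟩⟩ := hc n
    choose φ hφ using ht
    have h1 : pull (⟨Subtype.val, continuous_subtype_val⟩ : C({k // 0 < v n k}, K))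
        (mk (pullMap e.invFun (HSpace.hmul : C(Y × Y, Y)))) =
        mk ⟨fun p => HSpace.hmul (p.1, e.invFun (c p.2)), by fun_prop⟩ := by
      rw [pull_mk, mk_eq_iff]
      refine ⟨⟨⟨fun p => HSpace.hmul (p.2.1, e.invFun (H (p.1, p.2.2))), by fun_prop⟩,
        fun p => ?_, fun p => ?_⟩⟩
      · change HSpace.hmul (p.1, e.invFun (H (0, p.2))) = _
        rw [H.apply_zero]
        rfl
      · change HSpace.hmul (p.1, e.invFun (H (1, p.2))) = _
        rw [H.apply_one]
        rfl
    rw [h1]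
    -- After the deformation the translating element is locally constant, so unrelated homotopy
    -- inverses of the single translations fit together continuously.
    refine ⟨⟨mk ⟨fun p => HSpace.hmul (p.1, e.invFun (c p.2)), by fun_prop⟩,
      mk ⟨fun p => (φ (e.invFun (c p.2))).invFun p.1, continuous_of_isLocallyConstant hlc
      fun q => (φ (e.invFun q)).invFun.continuous⟩, ?_, ?_⟩, rfl⟩
    · rw [mk_mul_mk, one_eq_mk, mk_eq_iff]
      refine ⟨⟨⟨fun p => (φ (e.invFun (c p.2.2))).right_inv.some (p.1, p.2.1), ?_⟩,
        fun p => ?_, fun p => ?_⟩⟩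
      · exact (continuous_of_isLocallyConstant hlc fun q =>
          (φ (e.invFun q)).right_inv.some.continuous).comp
          (by fun_prop : Continuous fun p : I × Y × {k // 0 < v n k} => ((p.1, p.2.1), p.2.2))
      · refine ((φ (e.invFun (c p.2))).right_inv.some.apply_zero p.1).trans ?_
        exact hφ _ _
      · exact (φ (e.invFun (c p.2))).right_inv.some.apply_one p.1
    · rw [mk_mul_mk, one_eq_mk, mk_eq_iff]
      refine ⟨⟨⟨fun p => (φ (e.invFun (c p.2.2))).left_inv.some (p.1, p.2.1), ?_⟩,
        fun p => ?_, fun p => ?_⟩⟩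
      · exact (continuous_of_isLocallyConstant hlc fun q =>
          (φ (e.invFun q)).left_inv.some.continuous).comp
          (by fun_prop : Continuous fun p : I × Y × {k // 0 < v n k} => ((p.1, p.2.1), p.2.2))
      · refine ((φ (e.invFun (c p.2))).left_inv.some.apply_zero p.1).trans ?_
        exact congrArg (φ (e.invFun (c p.2))).invFun (hφ _ _)
      · exact (φ (e.invFun (c p.2))).left_inv.some.apply_one p.1
  have h2 := hK.map (pull e.toFun)
  have h3 : pull e.toFun (mk (pullMap e.invFun (HSpace.hmul : C(Y × Y, Y)))) =
      mk (HSpace.hmul : C(Y × Y, Y)) := by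
    rw [pull_mk, mk_eq_iff]
    obtain ⟨L⟩ := e.left_inv
    refine ⟨⟨⟨fun p => HSpace.hmul (p.2.1, L (p.1, p.2.2)), by fun_prop⟩,
      fun p => ?_, fun p => ?_⟩⟩
    · change HSpace.hmul (p.1, L (0, p.2)) = _
      rw [L.apply_zero]
      rfl
    · change HSpace.hmul (p.1, L (1, p.2)) = _
      rw [L.apply_one]
      rfl
  rwa [h3] at h2

end Fam
end families


noncomputable section loopTracks

open CategoryTheory

universe u₁ u₂ u₃

/-! ### The Eckmann–Hilton argument -/

section eckmannHilton

variable {X : Type u₁} [TopologicalSpace X] {Y : Type u₂} [TopologicalSpace Y] [HSpace Y]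
  {S : Set X}

/-- The constant map to the unit of an H-space. -/
def RelMap.unit (X : Type u₁) [TopologicalSpace X] (Y : Type u₂) [TopologicalSpace Y] [HSpace Y]
    (S : Set X) : RelMap X Y S (HSpace.e : Y) := ⟨ContinuousMap.const X HSpace.e, fun _ _ => rfl⟩

namespace Track

/-- The pointwise product of two tracks from the unit to itself. -/
def hmul (A B : Track (RelMap.unit X Y S) (RelMap.unit X Y S)) :
    Track (RelMap.unit X Y S) (RelMap.unit X Y S) where
  toFun t x := HSpace.hmul (A.toFun t x, B.toFun t x)
  cont := by
    have := A.cont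
    have := B.cont
    fun_prop
  eq_left t ht x := by
    rw [A.eq_left t ht, B.eq_left t ht]
    exact HSpace.hmul_e_e
  eq_right t ht x := by
    rw [A.eq_right t ht, B.eq_right t ht]
    exact HSpace.hmul_e_e
  eq_base t x hx := by
    rw [A.eq_base t x hx, B.eq_base t x hx]
    exact HSpace.hmul_e_e

theorem hmul_refl (A : Track (RelMap.unit X Y S) (RelMap.unit X Y S)) :
    A.hmul (Track.refl _) ≈ A := by
  have hp : Continuous (Set.projIcc (0 : ℝ) 1 zero_le_one) := continuous_projIcc
  have hp0 : Set.projIcc (0 : ℝ) 1 zero_le_one 0 = 0 := Set.projIcc_left ..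
  have hp1 : Set.projIcc (0 : ℝ) 1 zero_le_one 1 = 1 := Set.projIcc_right ..
  have he : ∀ t : I, HSpace.hmulE (X := Y) (t, HSpace.e) = HSpace.e := fun t =>
    (HSpace.hmulE (X := Y)).eq_snd t rfl
  refine equiv_of_family (fun u t x => HSpace.hmulE (Set.projIcc 0 1 zero_le_one u, A.toFun t x))
    ?_ ?_ ?_ ?_ ?_ ?_
  · have hA : Continuous fun p : ℝ × ℝ × X => A.toFun p.2.1 p.2.2 :=
      A.continuous_apply (by fun_prop) (by fun_prop)
    exact (HSpace.hmulE (X := Y)).continuous.comp ((hp.comp continuous_fst).prodMk hA)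
  · intro t _ _ x
    simp only [hp0]
    exact HSpace.hmulE.apply_zero _
  · intro t _ _ x
    simp only [hp1]
    exact HSpace.hmulE.apply_one _
  · intro u _ _ x
    simp only [A.eq_left _ le_rfl]
    exact he _
  · intro u _ _ x
    simp only [A.eq_right _ le_rfl]
    exact he _
  · intro u _ _ t _ _ x hx
    simp only [A.eq_base _ x hx]
    exact he _

theorem refl_hmul (A : Track (RelMap.unit X Y S) (RelMap.unit X Y S)) :
    (Track.refl _).hmul A ≈ A := by
  have hp : Continuous (Set.projIcc (0 : ℝ) 1 zero_le_one) := continuous_projIcc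
  have hp0 : Set.projIcc (0 : ℝ) 1 zero_le_one 0 = 0 := Set.projIcc_left ..
  have hp1 : Set.projIcc (0 : ℝ) 1 zero_le_one 1 = 1 := Set.projIcc_right ..
  have he : ∀ t : I, HSpace.eHmul (X := Y) (t, HSpace.e) = HSpace.e := fun t =>
    (HSpace.eHmul (X := Y)).eq_snd t rfl
  refine equiv_of_family (fun u t x => HSpace.eHmul (Set.projIcc 0 1 zero_le_one u, A.toFun t x))
    ?_ ?_ ?_ ?_ ?_ ?_
  · have hA : Continuous fun p : ℝ × ℝ × X => A.toFun p.2.1 p.2.2 :=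
      A.continuous_apply (by fun_prop) (by fun_prop)
    exact (HSpace.eHmul (X := Y)).continuous.comp ((hp.comp continuous_fst).prodMk hA)
  · intro t _ _ x
    simp only [hp0]
    exact HSpace.eHmul.apply_zero _
  · intro t _ _ x
    simp only [hp1]
    exact HSpace.eHmul.apply_one _
  · intro u _ _ x
    simp only [A.eq_left _ le_rfl]
    exact he _
  · intro u _ _ x
    simp only [A.eq_right _ le_rfl]
    exact he _
  · intro u _ _ t _ _ x hx
    simp only [A.eq_base _ x hx]
    exact he _

/-- In the square with value `A s · B t`, the two ways around are `A` then `B` and `B` then `A`, up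
to multiplication by the unit. -/
theorem trans_comm (A B : Track (RelMap.unit X Y S) (RelMap.unit X Y S)) :
    A.toHom ≫ B.toHom = B.toHom ≫ A.toHom := by
  have hA : Continuous fun p : ℝ × ℝ × X => A.toFun p.1 p.2.2 :=
    A.continuous_apply (by fun_prop) (by fun_prop)
  have hB : Continuous fun p : ℝ × ℝ × X => B.toFun p.2.1 p.2.2 :=
    B.continuous_apply (by fun_prop) (by fun_prop)
  rw [← toHom_eq_iff.mpr A.hmul_refl, ← toHom_eq_iff.mpr B.refl_hmul, ← toHom_trans, ← toHom_trans,
    toHom_eq_iff]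
  refine equiv_of_square (fun s t x => HSpace.hmul (A.toFun s x, B.toFun t x)) (by fun_prop)
    ?_ ?_ ?_ ?_ ?_
  · intro t _ _ x
    rw [B.eq_left _ le_rfl]
    rfl
  · intro t _ _ x
    rw [A.eq_right _ le_rfl]
    rfl
  · intro t _ _ x
    rw [A.eq_left _ le_rfl]
    rfl
  · intro t _ _ x
    rw [B.eq_right _ le_rfl]
    rfl
  · intro s _ _ t _ _ x hx
    rw [A.eq_base _ x hx, B.eq_base _ x hx]
    exact HSpace.hmul_e_e

/-- The square with value `A s · B (s t)` has a constant edge at `s = 0` and the pointwise product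
at `t = 1`. The other way around is `A` followed by `B`. -/
theorem toHom_hmul (A B : Track (RelMap.unit X Y S) (RelMap.unit X Y S)) :
    (A.hmul B).toHom = A.toHom ≫ B.toHom := by
  have hA : Continuous fun p : ℝ × ℝ × X => A.toFun p.1 p.2.2 :=
    A.continuous_apply (by fun_prop) (by fun_prop)
  have hB : Continuous fun p : ℝ × ℝ × X => B.toFun (p.1 * p.2.1) p.2.2 :=
    B.continuous_apply (by fun_prop) (by fun_prop)
  rw [← toHom_eq_iff.mpr A.hmul_refl, ← toHom_eq_iff.mpr B.refl_hmul, ← toHom_trans,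
    ← toHom_eq_iff.mpr (A.hmul B).refl_trans, eq_comm, toHom_eq_iff]
  refine equiv_of_square (fun s t x => HSpace.hmul (A.toFun s x, B.toFun (s * t) x)) (by fun_prop)
    ?_ ?_ ?_ ?_ ?_
  · intro t _ _ x
    rw [mul_zero, B.eq_left _ le_rfl]
    rfl
  · intro t _ _ x
    rw [A.eq_right _ le_rfl, one_mul]
    rfl
  · intro t _ _ x
    rw [A.eq_left _ le_rfl, zero_mul, B.eq_left _ le_rfl]
    exact HSpace.hmul_e_e
  · intro t _ _ x
    rw [mul_one]
    rfl
  · intro s _ _ t _ _ x hx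
    rw [A.eq_base _ x hx, B.eq_base _ x hx]
    exact HSpace.hmul_e_e

end Track

end eckmannHilton

/-! ### Pointed maps and tracks -/

variable {X : PtdSpace.{u₁}} {Y : PtdSpace.{u₂}} {Z : PtdSpace.{u₃}}

theorem PtdMap.ext_toMap {f g : PtdMap X Y} (h : ∀ x, f.toMap x = g.toMap x) : f = g := by
  obtain ⟨f, hf⟩ := f
  obtain ⟨g, hg⟩ := g
  obtain rfl : f = g := ContinuousMap.ext h
  rfl

/-- A pointed map as a map relative to the base point. -/
def PtdMap.rel (f : PtdMap X Y) : RelMap X Y {X.pt} Y.pt :=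
  ⟨f.toMap, by rintro _ rfl; exact f.map_pt⟩

theorem PtdMap.homotopic_iff {f g : PtdMap X Y} : f.Homotopic g ↔ Nonempty (Track f.rel g.rel) := by
  constructor
  · rintro ⟨H⟩
    exact ⟨Track.ofHomotopy H.toHomotopy (by
      rintro t _ rfl
      exact (H.eq_fst t rfl).trans f.map_pt)⟩
  · rintro ⟨F⟩
    refine ⟨⟨F.toHomotopy, ?_⟩⟩
    rintro t _ rfl
    exact (F.eq_base t _ rfl).trans f.map_pt.symm

/-- A point of the loop space as a path. -/
def loopPath (p : Y.loop) : Path Y.pt Y.pt := p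

theorem continuous_loopPath {T : Type*} [TopologicalSpace T] {p : T → Y.loop} (hp : Continuous p)
    {t : T → I} (ht : Continuous t) : Continuous fun x => loopPath (p x) (t x) :=
  Continuous.eval (F := Path Y.pt Y.pt) hp ht

/-- A map to the loop space as a track from the constant map to itself. -/
def loopTrack (a : PtdMap X Y.loop) :
    Track (PtdMap.const X Y).rel (PtdMap.const X Y).rel where
  toFun t x := loopPath (a.toMap x) (Set.projIcc 0 1 zero_le_one t)
  cont := by
    have hp : Continuous (Set.projIcc (0 : ℝ) 1 zero_le_one) := continuous_projIcc
    exact continuous_loopPath (a.toMap.continuous.comp continuous_snd) (hp.comp continuous_fst)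
  eq_left t ht x := by
    rw [Set.projIcc_of_le_left _ ht]
    exact Path.source _
  eq_right t ht x := by
    rw [Set.projIcc_of_right_le _ ht]
    exact Path.target _
  eq_base t x hx := by
    obtain rfl := hx
    rw [a.map_pt]
    rfl

/-- A track from the constant map to itself as a map to the loop space. -/
def Track.toLoop (F : Track (PtdMap.const X Y).rel (PtdMap.const X Y).rel) : PtdMap X Y.loop where
  toMap :=
    { toFun := fun x => (⟨⟨fun t : I => F.toFun t x, F.continuous_apply (by fun_prop)
        (by fun_prop)⟩, F.eq_left 0 le_rfl x, F.eq_right 1 le_rfl x⟩ : Path Y.pt Y.pt)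
      continuous_toFun := Path.continuous_uncurry_iff.mp
        (F.continuous_apply (T := X × I) (by fun_prop) (by fun_prop)) }
  map_pt := Path.ext (funext fun t => F.eq_base t _ rfl)

theorem loopTrack_toFun (a : PtdMap X Y.loop) (t : I) (x : X) :
    (loopTrack a).toFun t x = loopPath (a.toMap x) t := by
  change loopPath (a.toMap x) (Set.projIcc 0 1 zero_le_one t) = _
  rw [Set.projIcc_val]

theorem Track.ext_of_unitInterval {X : Type u₁} [TopologicalSpace X] {Y : Type u₂}
    [TopologicalSpace Y] {S : Set X} {y₀ : Y} {f g : RelMap X Y S y₀} {F G : Track f g}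
    (h : ∀ t : I, ∀ x, F.toFun t x = G.toFun t x) : F = G := by
  refine Track.ext (funext fun t => funext fun x => ?_)
  rcases le_total t 0 with ht | ht
  · rw [F.eq_left t ht, G.eq_left t ht]
  rcases le_total 1 t with ht' | ht'
  · rw [F.eq_right t ht', G.eq_right t ht']
  · exact h ⟨t, ht, ht'⟩ x

theorem loopTrack_toLoop (F : Track (PtdMap.const X Y).rel (PtdMap.const X Y).rel) :
    loopTrack F.toLoop = F :=
  Track.ext_of_unitInterval fun t x => loopTrack_toFun _ t x

theorem loopTrack_loopMul (a b : PtdMap X Y.loop) :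
    loopTrack ((loopMul Y).comp (a.pair b)) = (loopTrack a).trans (loopTrack b) := by
  refine Track.ext_of_unitInterval fun t x => ?_
  rw [loopTrack_toFun]
  rfl

/-- By adjunction, a pointed homotopy between maps to the loop space is a homotopy of tracks
relative to the ends and the base point. -/
theorem loopTrack_homotopic_iff {a b : PtdMap X Y.loop} :
    a.Homotopic b ↔ (loopTrack a).toHom = (loopTrack b).toHom := by
  rw [Track.toHom_eq_iff]
  constructor
  · rintro ⟨H⟩
    have hp : Continuous (Set.projIcc (0 : ℝ) 1 zero_le_one) := continuous_projIcc
    refine Track.equiv_of_family (fun u t x => loopPath (H (Set.projIcc 0 1 zero_le_one u, x))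
      (Set.projIcc 0 1 zero_le_one t)) ?_ ?_ ?_ ?_ ?_ ?_
    · exact continuous_loopPath (H.continuous.comp ((hp.comp continuous_fst).prodMk
        (continuous_snd.comp continuous_snd))) (hp.comp (continuous_fst.comp continuous_snd))
    · intro t _ _ x
      simp only [Set.projIcc_left]
      have := H.apply_zero x
      exact congrArg (fun p : Path Y.pt Y.pt => p (Set.projIcc 0 1 zero_le_one t)) this
    · intro t _ _ x
      simp only [Set.projIcc_right]
      have := H.apply_one x
      exact congrArg (fun p : Path Y.pt Y.pt => p (Set.projIcc 0 1 zero_le_one t)) this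
    · intro u _ _ x
      simp only [Set.projIcc_left]
      exact Path.source _
    · intro u _ _ x
      simp only [Set.projIcc_right]
      exact Path.target _
    · rintro u _ _ t _ _ x rfl
      have h2 := (H.eq_fst (Set.projIcc 0 1 zero_le_one u) (x := X.pt) rfl).trans a.map_pt
      exact congrArg (fun p : Path Y.pt Y.pt => p (Set.projIcc 0 1 zero_le_one t)) h2
  · intro h
    obtain ⟨A, Ac, A0, A1, Al, Ar, Ab⟩ := Track.exists_family h
    refine ⟨⟨⟨⟨fun p => (⟨⟨fun t : I => A p.1 t p.2, ?_⟩, Al _ 0 le_rfl _, Ar _ 1 le_rfl _⟩ :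
      Path Y.pt Y.pt), ?_⟩, ?_, ?_⟩, ?_⟩⟩
    · exact Ac.comp (by fun_prop : Continuous fun t : I => ((p.1 : ℝ), (t : ℝ), p.2))
    · refine Path.continuous_uncurry_iff.mp ?_
      exact Ac.comp (by fun_prop : Continuous fun q : (I × X) × I =>
        ((q.1.1 : ℝ), (q.2 : ℝ), q.1.2))
    · intro x
      refine Path.ext (funext fun t => ?_)
      exact (A0 t x).trans (loopTrack_toFun a t x)
    · intro x
      refine Path.ext (funext fun t => ?_)
      exact (A1 t x).trans (loopTrack_toFun b t x)
    · rintro u _ rfl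
      refine Path.ext (funext fun t => ?_)
      refine (Ab u t _ rfl).trans ?_
      change _ = loopPath (a.toMap X.pt) t
      rw [a.map_pt]
      rfl

/-- The class in the groupoid of tracks of an element of `[X, ΩY]`. -/
def loopHom : HtpyClass X Y.loop → ((PtdMap.const X Y).rel ⟶ (PtdMap.const X Y).rel) :=
  Quotient.lift (fun a => (loopTrack a).toHom) fun _ _ h => loopTrack_homotopic_iff.mp h

theorem loopHom_mk (a : PtdMap X Y.loop) : loopHom (Quotient.mk _ a) = (loopTrack a).toHom := rfl

theorem loopHom_injective : Function.Injective (loopHom (X := X) (Y := Y)) := by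
  rintro ⟨a⟩ ⟨b⟩ h
  exact Quotient.sound (loopTrack_homotopic_iff.mpr h)

theorem loopHom_surjective : Function.Surjective (loopHom (X := X) (Y := Y)) := by
  intro F
  obtain ⟨F, rfl⟩ := Track.toHom_surjective F
  exact ⟨Quotient.mk _ F.toLoop, by rw [loopHom_mk, loopTrack_toLoop]⟩

theorem loopHom_mul (a b : HtpyClass X Y.loop) : loopHom (a * b) = loopHom a ≫ loopHom b := by
  obtain ⟨a⟩ := a
  obtain ⟨b⟩ := b
  change (loopTrack ((loopMul Y).comp (a.pair b))).toHom = _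
  rw [loopTrack_loopMul]
  rfl

end loopTracks


noncomputable section division

universe u₁ u₂ u₃ u₄

variable {X : PtdSpace.{u₁}} {Y : PtdSpace.{u₂}} {Z : PtdSpace.{u₃}} {W : PtdSpace.{u₄}}

/-! ### Well-pointed spaces -/

theorem PtdMap.homotopic_of_map {f g : PtdMap X Y} (H : C(I × X, Y)) (h0 : ∀ x, H (0, x) = f.toMap x)
    (h1 : ∀ x, H (1, x) = g.toMap x) (hb : ∀ t, H (t, X.pt) = Y.pt) : f.Homotopic g :=
  ⟨⟨⟨H, h0, h1⟩, by
    rintro t _ rfl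
    exact (hb t).trans f.map_pt.symm⟩⟩

theorem PtdMap.Homotopic.exists_map {f g : PtdMap X Y} (h : f.Homotopic g) :
    ∃ H : C(I × X, Y), (∀ x, H (0, x) = f.toMap x) ∧ (∀ x, H (1, x) = g.toMap x) ∧
      ∀ t, H (t, X.pt) = Y.pt := by
  obtain ⟨H⟩ := h
  exact ⟨H.toContinuousMap, H.apply_zero, H.apply_one,
    fun t => (H.eq_fst t rfl).trans f.map_pt⟩

/-- A path that starts at the image of a non-degenerate base point extends to a homotopy, after a
change of its parametrization. -/
theorem PtdSpace.IsWellPointed.exists_extension (hX : X.IsWellPointed) {T : Type u₂}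
    [TopologicalSpace T] (φ : C(X, T)) (ξ : C(I, T)) (hξ : ξ 0 = φ X.pt) :
    ∃ Ξ : C(I × X, T), (∀ x, Ξ (0, x) = φ x) ∧ (∀ t, ∃ t', Ξ (t, X.pt) = ξ t') ∧
      Ξ (1, X.pt) = ξ 1 := by
  obtain ⟨r, h, hr, h0, hpt, h1⟩ := hX
  have hp : Continuous (Set.projIcc (0 : ℝ) 1 zero_le_one) := continuous_projIcc
  have hr0 : r X.pt = 0 := (hr _).2 rfl
  -- The first half of the time runs `h`, which collapses `{r < 1}` to the base point. In the second
  -- half the points with `r < 1 / 2` follow `ξ`, up to a time damped by `r`. On the seam the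
  -- collapse is complete, so the formulas agree.
  refine ⟨⟨fun p => if min (2 * (p.1 : ℝ) - 1) (1 - 2 * (r p.2 : ℝ)) ≤ 0
    then φ (h (Set.projIcc 0 1 zero_le_one (2 * (p.1 : ℝ)), p.2))
    else ξ (Set.projIcc 0 1 zero_le_one (min (2 * (p.1 : ℝ) - 1) (1 - 2 * (r p.2 : ℝ)))),
    ?_⟩, ?_, ?_, ?_⟩
  · refine Continuous.if_le (by fun_prop) (by fun_prop) (by fun_prop) (by fun_prop) ?_
    intro p hp0
    have h2 : 1 / 2 ≤ (p.1 : ℝ) := by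
      have := min_le_left (2 * (p.1 : ℝ) - 1) (1 - 2 * (r p.2 : ℝ))
      linarith
    have h3 : (r p.2 : ℝ) < 1 := by
      have := min_le_right (2 * (p.1 : ℝ) - 1) (1 - 2 * (r p.2 : ℝ))
      linarith
    rw [hp0, Set.projIcc_left, Set.projIcc_of_right_le _ (by linarith)]
    exact (congrArg φ (h1 _ h3)).trans hξ.symm
  · intro x
    have : min (2 * ((0 : I) : ℝ) - 1) (1 - 2 * (r x : ℝ)) ≤ 0 :=
      (min_le_left _ _).trans (by norm_num)
    simp only [ContinuousMap.coe_mk, if_pos this]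
    rw [Set.projIcc_of_le_left _ (by norm_num)]
    exact congrArg φ (h0 x)
  · intro t
    simp only [ContinuousMap.coe_mk]
    split_ifs
    · exact ⟨0, by rw [hpt, hξ]⟩
    · exact ⟨_, rfl⟩
  · have : min (2 * ((1 : I) : ℝ) - 1) (1 - 2 * ((0 : I) : ℝ)) = 1 := by norm_num
    simp only [ContinuousMap.coe_mk, hr0, this]
    rw [if_neg (by norm_num), Set.projIcc_right]
    rfl

theorem PtdSpace.IsWellPointed.prod (hX : X.IsWellPointed) (hY : Y.IsWellPointed) :
    (X.prod Y).IsWellPointed := by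
  obtain ⟨r, h, hr, h0, hpt, h1⟩ := hX
  obtain ⟨r', h', hr', h0', hpt', h1'⟩ := hY
  refine ⟨⟨fun p : X × Y => max (r p.1) (r' p.2), ?_⟩,
    ⟨fun p : I × X × Y => ((h (p.1, p.2.1), h' (p.1, p.2.2)) : X × Y), ?_⟩, ?_, ?_, ?_, ?_⟩
  · change Continuous fun p : X × Y => max (r p.1) (r' p.2)
    fun_prop
  · change Continuous fun p : I × X × Y => ((h (p.1, p.2.1), h' (p.1, p.2.2)) : X × Y)
    fun_prop
  · rintro ⟨x, y⟩
    have hm : max (r x) (r' y) = 0 ↔ r x = 0 ∧ r' y = 0 := by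
      change max (r x) (r' y) = ⊥ ↔ _
      rw [max_eq_bot]
      rfl
    exact hm.trans ((and_congr (hr x) (hr' y)).trans (Prod.ext_iff (x := (x, y))
      (y := (X.pt, Y.pt))).symm)
  · exact fun p => Prod.ext (h0 _) (h0' _)
  · exact fun t => Prod.ext (hpt _) (hpt' _)
  · rintro ⟨x, y⟩ hxy
    obtain ⟨hx, hy⟩ := max_lt_iff.1 hxy
    exact Prod.ext (h1 _ hx) (h1' _ hy)

/-- A map on `X × X` that is null-homotopic on both axes is homotopic to a map that is constant
on the wedge. -/
theorem PtdSpace.IsWellPointed.exists_homotopic_wedge (hX : X.IsWellPointed)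
    (f : PtdMap (X.prod X) Y)
    (h1 : (f.comp (PtdMap.pair ⟨ContinuousMap.id X, rfl⟩ (PtdMap.const X X))).Homotopic
      (PtdMap.const X Y))
    (h2 : (f.comp (PtdMap.pair (PtdMap.const X X) ⟨ContinuousMap.id X, rfl⟩)).Homotopic
      (PtdMap.const X Y)) :
    ∃ g : PtdMap (X.prod X) Y, f.Homotopic g ∧ ∀ p ∈ wedge X X, g.toMap p = Y.pt := by
  obtain ⟨r, h, hr, h0, hpt, hr1⟩ := hX
  obtain ⟨a, a0, a1, ab⟩ := h1.exists_map
  obtain ⟨b, b0, b1, bb⟩ := h2.exists_map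
  replace a0 : ∀ x, a (0, x) = f.toMap (x, X.pt) := a0
  replace a1 : ∀ x, a (1, x) = Y.pt := a1
  replace b0 : ∀ x, b (0, x) = f.toMap (X.pt, x) := b0
  replace b1 : ∀ x, b (1, x) = Y.pt := b1
  have hf0 : f.toMap (X.pt, X.pt) = Y.pt := f.map_pt
  have hrpt : r X.pt = 0 := (hr _).2 rfl
  have hp : Continuous (Set.projIcc (0 : ℝ) 1 zero_le_one) := continuous_projIcc
  have hf : Continuous fun p : X × X => f.toMap p := f.toMap.continuous
  -- Precomposed with the collapse in both variables, `f` depends near an axis only on the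
  -- coordinate along it, so the null-homotopy on that axis can be applied. The factor `1 - 2 * r`
  -- damps it to time 0 at the edge `r = 1 / 2`.
  let D : I × X × X → Y := fun p => if (r p.2.1 : ℝ) ≤ 1 / 2
    then b (Set.projIcc 0 1 zero_le_one (p.1 * (1 - 2 * (r p.2.1 : ℝ))), h (1, p.2.2))
    else if (r p.2.2 : ℝ) ≤ 1 / 2
      then a (Set.projIcc 0 1 zero_le_one (p.1 * (1 - 2 * (r p.2.2 : ℝ))), h (1, p.2.1))
      else f.toMap (h (1, p.2.1), h (1, p.2.2))
  have hD : Continuous D := by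
    refine Continuous.if_le (by fun_prop) (Continuous.if_le (by fun_prop) ?_ (by fun_prop)
      (by fun_prop) ?_) (by fun_prop) (by fun_prop) ?_
    · exact hf.comp (by fun_prop : Continuous fun p : I × X × X =>
        ((h (1, p.2.1), h (1, p.2.2)) : X × X))
    · intro p hp
      rw [hp, show (p.1 : ℝ) * (1 - 2 * (1 / 2)) = 0 by ring, Set.projIcc_left,
        hr1 p.2.2 (by rw [← Subtype.coe_lt_coe, hp]; norm_num)]
      exact a0 _
    · intro p hp
      have hx : h (1, p.2.1) = X.pt := hr1 p.2.1 (by rw [← Subtype.coe_lt_coe, hp]; norm_num)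
      rw [hp, show (p.1 : ℝ) * (1 - 2 * (1 / 2)) = 0 by ring, Set.projIcc_left, hx]
      refine (b0 _).trans ?_
      split_ifs with hy
      · rw [hr1 p.2.2 (by rw [← Subtype.coe_lt_coe]; exact hy.trans_lt (by norm_num)), ab, hf0]
      · rfl
  have hD0 : ∀ x y, D (0, x, y) = f.toMap (h (1, x), h (1, y)) := by
    intro x y
    simp only [D, Set.Icc.coe_zero, zero_mul, Set.projIcc_left]
    split_ifs with hx hy
    · rw [hr1 x (by rw [← Subtype.coe_lt_coe]; exact hx.trans_lt (by norm_num))]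
      exact b0 _
    · rw [hr1 y (by rw [← Subtype.coe_lt_coe]; exact hy.trans_lt (by norm_num))]
      exact a0 _
    · rfl
  have hDb : ∀ t, D (t, X.pt, X.pt) = Y.pt := by
    intro t
    simp only [D, hrpt]
    rw [if_pos (by norm_num), hpt, bb]
  have hD1 : ∀ p ∈ wedge X X, D (1, p) = Y.pt := by
    rintro ⟨x, y⟩ (rfl | rfl)
    · simp only [D, hrpt]
      rw [if_pos (by norm_num), Set.projIcc_of_right_le _ (by norm_num)]
      exact b1 _
    · simp only [D, hrpt]
      split_ifs with hx hy
      · rw [hpt, bb]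
      · rw [Set.projIcc_of_right_le _ (by norm_num)]
        exact a1 _
      · exact absurd (by norm_num) hy
  refine ⟨⟨⟨fun p : X × X => D (1, p), hD.comp (by fun_prop : Continuous fun p : X × X =>
    ((1 : I), p))⟩, hD1 _ (Or.inl rfl)⟩, ?_, hD1⟩
  refine PtdMap.Homotopic.trans (g := ⟨⟨fun p : X × X => f.toMap (h (1, p.1), h (1, p.2)),
    hf.comp (by fun_prop : Continuous fun p : X × X => (h (1, p.1), h (1, p.2)))⟩, ?_⟩)
    (PtdMap.homotopic_of_map ⟨fun p : I × X × X => f.toMap (h (p.1, p.2.1), h (p.1, p.2.2)),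
      hf.comp (by fun_prop : Continuous fun p : I × X × X => (h (p.1, p.2.1), h (p.1, p.2.2)))⟩
      ?_ ?_ ?_) (PtdMap.homotopic_of_map ⟨D, hD⟩ ?_ ?_ ?_)
  · exact (congrArg f.toMap (Prod.ext (hpt _) (hpt _))).trans f.map_pt
  · exact fun p => congrArg f.toMap (Prod.ext (h0 _) (h0 _))
  · exact fun p => rfl
  · exact fun t => (congrArg f.toMap (Prod.ext (hpt _) (hpt _))).trans f.map_pt
  · exact fun p => hD0 _ _
  · exact fun p => rfl
  · exact hDb

/-! ### Maps to an H-space -/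

section HSpaces

variable {H : Type u₂} [TopologicalSpace H] [HSpace H]

theorem HSpace.mulMap_const_right (a : PtdMap X (HSpace.ptd H)) :
    ((HSpace.mulMap H).comp (a.pair (PtdMap.const X _))).Homotopic a := by
  have ha : Continuous fun x : X => (a.toMap x : H) := a.toMap.continuous
  refine PtdMap.homotopic_of_map ⟨fun p => HSpace.hmulE (X := H) (p.1, (a.toMap p.2 : H)), ?_⟩
    ?_ ?_ ?_
  · exact (HSpace.hmulE (X := H)).continuous.comp
      (continuous_fst.prodMk (ha.comp continuous_snd))
  · exact fun x => (HSpace.hmulE (X := H)).apply_zero _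
  · exact fun x => (HSpace.hmulE (X := H)).apply_one _
  · exact fun t => ((HSpace.hmulE (X := H)).eq_snd t (show (a.toMap X.pt : H) ∈ {HSpace.e} from
      a.map_pt)).trans a.map_pt

theorem HSpace.mulMap_const_left (a : PtdMap X (HSpace.ptd H)) :
    ((HSpace.mulMap H).comp ((PtdMap.const X _).pair a)).Homotopic a := by
  have ha : Continuous fun x : X => (a.toMap x : H) := a.toMap.continuous
  refine PtdMap.homotopic_of_map ⟨fun p => HSpace.eHmul (X := H) (p.1, (a.toMap p.2 : H)), ?_⟩
    ?_ ?_ ?_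
  · exact (HSpace.eHmul (X := H)).continuous.comp
      (continuous_fst.prodMk (ha.comp continuous_snd))
  · exact fun x => (HSpace.eHmul (X := H)).apply_zero _
  · exact fun x => (HSpace.eHmul (X := H)).apply_one _
  · exact fun t => ((HSpace.eHmul (X := H)).eq_snd t (show (a.toMap X.pt : H) ∈ {HSpace.e} from
      a.map_pt)).trans a.map_pt

/-- The product of a loop with its inverse is null-homotopic, pointwise in an H-space. -/
theorem HSpace.exists_nullhomotopy_mul_symm (κ : C(I, H)) (h0 : κ 0 = HSpace.e)
    (h1 : κ 1 = HSpace.e) :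
    ∃ ξ : C(I, C(I, H)), (∀ t, ξ 0 t = HSpace.hmul (κ t, κ (σ t))) ∧ (∀ t, ξ 1 t = HSpace.e) ∧
      ∀ s, ξ s 0 = HSpace.e ∧ ξ s 1 = HSpace.e := by
  have hp : Continuous (Set.projIcc (0 : ℝ) 1 zero_le_one) := continuous_projIcc
  let A : Track (RelMap.unit PUnit.{1} H ∅) (RelMap.unit PUnit.{1} H ∅) :=
    { toFun := fun t _ => κ (Set.projIcc 0 1 zero_le_one t)
      cont := by fun_prop
      eq_left := fun t ht x => by
        rw [Set.projIcc_of_le_left _ ht]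
        exact h0
      eq_right := fun t ht x => by
        rw [Set.projIcc_of_right_le _ ht]
        exact h1
      eq_base := fun _ _ hx => hx.elim }
  -- Pointwise products of loops are concatenations up to homotopy, so this one is a loop times its
  -- inverse.
  have hA : (A.hmul A.symm).toHom = (Track.refl (RelMap.unit PUnit.{1} H ∅)).toHom := by
    rw [Track.toHom_hmul, Track.toHom_symm, CategoryTheory.Groupoid.comp_inv]
    rfl
  obtain ⟨F, Fc, F0, F1, Fl, Fr, -⟩ := Track.exists_family (Track.toHom_eq_iff.mp hA)
  refine ⟨⟨fun s => ⟨fun t => F s t PUnit.unit, ?_⟩, ?_⟩, ?_, ?_, ?_⟩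
  · exact Fc.comp (by fun_prop : Continuous fun t : I => ((s : ℝ), (t : ℝ), PUnit.unit))
  · refine ContinuousMap.continuous_of_continuous_uncurry _ ?_
    exact Fc.comp (by fun_prop : Continuous fun p : I × I => ((p.1 : ℝ), (p.2 : ℝ), PUnit.unit))
  · intro t
    refine (F0 t _).trans ?_
    change HSpace.hmul (κ (Set.projIcc 0 1 zero_le_one t),
      κ (Set.projIcc 0 1 zero_le_one (1 - t))) = _
    rw [Set.projIcc_val, ← unitInterval.coe_symm_eq, Set.projIcc_val]
  · exact fun t => F1 t _
  · exact fun s => ⟨Fl s 0 le_rfl _, Fr s 1 le_rfl _⟩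

/-- Pointed maps from a well-pointed space to an H-space are homotopic if they are freely
homotopic. -/
theorem PtdSpace.IsWellPointed.homotopic_of_free (hX : X.IsWellPointed)
    {f g : PtdMap X (HSpace.ptd H)} (hfg : f.toMap.Homotopic g.toMap) : f.Homotopic g := by
  obtain ⟨k⟩ := hfg
  have kc : Continuous fun p : I × X => (k p : H) := k.continuous
  have kc' : Continuous fun t : I => (k (t, X.pt) : H) :=
    kc.comp (by fun_prop : Continuous fun t : I => (t, X.pt))
  obtain ⟨ξ, ξ0, ξ1, ξe⟩ := HSpace.exists_nullhomotopy_mul_symm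
    (⟨fun t => (k (t, X.pt) : H), kc'⟩ : C(I, H)) ((k.apply_zero _).trans f.map_pt)
    ((k.apply_one _).trans g.map_pt)
  -- The free homotopy is multiplied by the reversed trace of the base point. The base point then
  -- traces a null-homotopic loop.
  have hc : Continuous fun p : X × I => HSpace.hmul ((k (p.2, p.1), k (σ p.2, X.pt)) : H × H) :=
    HSpace.hmul.continuous.comp ((kc.comp (continuous_snd.prodMk continuous_fst)).prodMk
      (kc'.comp (unitInterval.continuous_symm.comp continuous_snd)))
  -- Seen as a map from `X` to paths, the corrected homotopy is dragged along the null-homotopy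
  -- until the base point stays at the unit. The ends at times 0 and 1 move through pointed maps.
  obtain ⟨Ξ, Ξ0, Ξb, Ξ1⟩ := hX.exists_extension
    (⟨fun x => ⟨fun t => HSpace.hmul ((k (t, x), k (σ t, X.pt)) : H × H),
      hc.comp (by fun_prop : Continuous fun t : I => (x, t))⟩,
      ContinuousMap.continuous_of_continuous_uncurry _ hc⟩ : C(X, C(I, H))) ξ
      (ContinuousMap.ext ξ0)
  have Ξc : Continuous fun q : (I × X) × I => Ξ q.1 q.2 := by fun_prop
  have e0 : ∀ s, Ξ (s, X.pt) 0 = (HSpace.e : H) := fun s => by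
    obtain ⟨t, ht⟩ := Ξb s
    rw [ht, (ξe t).1]
  have e1 : ∀ s, Ξ (s, X.pt) 1 = (HSpace.e : H) := fun s => by
    obtain ⟨t, ht⟩ := Ξb s
    rw [ht, (ξe t).2]
  have et : ∀ t, Ξ (1, X.pt) t = (HSpace.e : H) := fun t => by rw [Ξ1, ξ1]
  have k0 : k (0, X.pt) = (HSpace.e : H) := (k.apply_zero _).trans f.map_pt
  have k1 : k (1, X.pt) = (HSpace.e : H) := (k.apply_one _).trans g.map_pt
  let m : I → PtdMap X (HSpace.ptd H) := fun t =>
    ⟨⟨fun x => (Ξ (1, x) t : H), Ξc.comp (by fun_prop : Continuous fun x : X => (((1 : I), x), t))⟩,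
      et t⟩
  have h1 : ((HSpace.mulMap H).comp (f.pair (PtdMap.const X _))).Homotopic (m 0) :=
    PtdMap.homotopic_of_map ⟨fun p => (Ξ (p.1, p.2) 0 : H),
      Ξc.comp (by fun_prop : Continuous fun p : I × X => ((p.1, p.2), (0 : I)))⟩
      (fun x => by
        change Ξ (0, x) 0 = HSpace.hmul ((f.toMap x, HSpace.e) : H × H)
        rw [Ξ0]
        change HSpace.hmul ((k (0, x), k (σ 0, X.pt)) : H × H) = _
        rw [unitInterval.symm_zero, k1]
        exact congrArg (fun y : H => HSpace.hmul (y, HSpace.e)) (k.apply_zero x))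
      (fun x => rfl) e0
  have h2 : (m 0).Homotopic (m 1) :=
    PtdMap.homotopic_of_map ⟨fun p => (Ξ (1, p.2) p.1 : H),
      Ξc.comp (by fun_prop : Continuous fun p : I × X => (((1 : I), p.2), p.1))⟩
      (fun x => rfl) (fun x => rfl) et
  have h3 : ((HSpace.mulMap H).comp (g.pair (PtdMap.const X _))).Homotopic (m 1) :=
    PtdMap.homotopic_of_map ⟨fun p => (Ξ (p.1, p.2) 1 : H),
      Ξc.comp (by fun_prop : Continuous fun p : I × X => ((p.1, p.2), (1 : I)))⟩
      (fun x => by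
        change Ξ (0, x) 1 = HSpace.hmul ((g.toMap x, HSpace.e) : H × H)
        rw [Ξ0]
        change HSpace.hmul ((k (1, x), k (σ 1, X.pt)) : H × H) = _
        rw [unitInterval.symm_one, k0]
        exact congrArg (fun y : H => HSpace.hmul (y, HSpace.e)) (k.apply_one x))
      (fun x => rfl) e1
  exact (HSpace.mulMap_const_right f).symm.trans (h1.trans (h2.trans (h3.symm.trans
    (HSpace.mulMap_const_right g))))

/-! ### Pointed division in an H-space -/

/-- A pointed map that is a two-sided homotopy inverse of `(x, y) ↦ (x · y, y)`, up to the second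
coordinate. -/
structure HSpace.IsDivision (d : PtdMap ((HSpace.ptd H).prod (HSpace.ptd H)) (HSpace.ptd H)) :
    Prop where
  mul_div : ((HSpace.mulMap H).comp (d.pair ⟨ContinuousMap.snd, rfl⟩)).Homotopic
    ⟨ContinuousMap.fst, rfl⟩
  div_mul : (d.comp ((HSpace.mulMap H).pair ⟨ContinuousMap.snd, rfl⟩)).Homotopic
    ⟨ContinuousMap.fst, rfl⟩

/-- The multiplication is a unit among families, which gives a free inverse `d₀`. Non-degeneracy of
the base point moves `d₀` to a pointed map and makes both homotopies pointed. -/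
theorem HSpace.exists_isDivision (hH : (HSpace.ptd H).IsWellPointed) (hCW : HasCWHomotopyType H)
    (ht : HSpace.HasInvertibleTranslations H) :
    ∃ d : PtdMap ((HSpace.ptd H).prod (HSpace.ptd H)) (HSpace.ptd H), HSpace.IsDivision d := by
  obtain ⟨⟨m, q, hmq, hqm⟩, hm⟩ := Fam.isUnit_hmul hCW ht
  obtain rfl : m = _ := hm
  obtain ⟨d₀, rfl⟩ := Quotient.exists_rep q
  change Fam.mk _ * Fam.mk d₀ = 1 at hmq
  change Fam.mk d₀ * Fam.mk _ = 1 at hqm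
  rw [Fam.mk_mul_mk, Fam.one_eq_mk, Fam.mk_eq_iff] at hmq hqm
  obtain ⟨P⟩ := id hmq
  let E : H × H := (HSpace.e, HSpace.e)
  have hE : Continuous fun t : I => HSpace.hmulE (X := H) (t, d₀ E) := by fun_prop
  have hP : Continuous fun t : I => P (t, E) := by fun_prop
  -- The path from `d₀ (e, e)` to the unit passes through `d₀ (e, e) · e`, by the unit law and then
  -- by the homotopy for `mul_div`.
  let ξ : Path (d₀ E) (HSpace.e : H) :=
    Path.trans (Path.symm ⟨⟨_, hE⟩, HSpace.hmulE.apply_zero _, HSpace.hmulE.apply_one _⟩)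
      ⟨⟨_, hP⟩, P.apply_zero _, P.apply_one _⟩
  obtain ⟨Ξ, Ξ0, -, Ξ1⟩ := (hH.prod hH).exists_extension d₀ ξ.toContinuousMap ξ.source
  have Ξc : Continuous fun p : I × H × H => (Ξ p : H) := Ξ.continuous
  let d : PtdMap ((HSpace.ptd H).prod (HSpace.ptd H)) (HSpace.ptd H) :=
    ⟨⟨fun p : H × H => (Ξ ((1 : I), p) : H), Ξc.comp (by fun_prop : Continuous fun p : H × H =>
      ((1 : I), p))⟩, Ξ1.trans ξ.target⟩
  have hd : ContinuousMap.Homotopic (X := H × H) (Y := H) d.toMap d₀ :=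
    ContinuousMap.Homotopic.symm ⟨⟨Ξ, Ξ0, fun _ => rfl⟩⟩
  exact ⟨d, (hH.prod hH).homotopic_of_free
      ((Fam.compMap_congr (ContinuousMap.Homotopic.refl _) hd).trans hmq),
    (hH.prod hH).homotopic_of_free
      ((Fam.compMap_congr hd (ContinuousMap.Homotopic.refl _)).trans hqm)⟩

namespace HSpace.IsDivision

variable {d : PtdMap ((HSpace.ptd H).prod (HSpace.ptd H)) (HSpace.ptd H)}

theorem mul_div_pair (hd : HSpace.IsDivision d) (a b : PtdMap X (HSpace.ptd H)) :
    ((HSpace.mulMap H).comp ((d.comp (a.pair b)).pair b)).Homotopic a :=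
  PtdMap.Homotopic.comp_right hd.mul_div (a.pair b)

theorem div_mul_pair (hd : HSpace.IsDivision d) (a b : PtdMap X (HSpace.ptd H)) :
    (d.comp (((HSpace.mulMap H).comp (a.pair b)).pair b)).Homotopic a :=
  PtdMap.Homotopic.comp_right hd.div_mul (a.pair b)

theorem div_self (hd : HSpace.IsDivision d) (b : PtdMap X (HSpace.ptd H)) :
    (d.comp (b.pair b)).Homotopic (PtdMap.const X _) :=
  (PtdMap.Homotopic.comp_left d (PtdMap.Homotopic.pair (HSpace.mulMap_const_left b).symm
    (PtdMap.Homotopic.refl b))).trans (hd.div_mul_pair (PtdMap.const X _) b)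

end HSpace.IsDivision

/-! ### Existence of deviations -/

/-- The map `X ∧ Y → Z` induced by a map that is constant on the wedge. -/
def PtdMap.smashLift (g : PtdMap (X.prod Y) Z) (hg : ∀ p ∈ wedge X Y, g.toMap p = Z.pt) :
    PtdMap (X.smash Y) Z where
  toMap := ⟨Quotient.lift (s := smashSetoid X Y) g.toMap (by
    rintro p q (rfl | h)
    · rfl
    · rw [hg p h.1, hg q h.2]), Continuous.quotient_lift (s := smashSetoid X Y)
      g.toMap.continuous _⟩
  map_pt := g.map_pt

/-- The pointwise application of a map of two variables to free loops. -/
def freeLoopPair (f : PtdMap (X.prod Y) Z) :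
    PtdMap (X.freeLoop.prod Y.freeLoop) Z.freeLoop where
  toMap :=
    { toFun := fun p : {γ : C(I, X) // γ 0 = γ 1} × {γ : C(I, Y) // γ 0 = γ 1} =>
        (⟨f.toMap.comp (p.1.1.prodMk p.2.1),
          congrArg f.toMap (Prod.ext p.1.2 p.2.2)⟩ : {γ : C(I, Z) // γ 0 = γ 1})
      continuous_toFun := Continuous.subtype_mk
        ((ContinuousMap.continuous_postcomp f.toMap).comp
          (ContinuousMap.continuous_of_continuous_uncurry _ (by
            change Continuous fun q : ({γ : C(I, X) // γ 0 = γ 1} ×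
              {γ : C(I, Y) // γ 0 = γ 1}) × I => ((q.1.1.1 q.2, q.1.2.1 q.2) : X × Y)
            fun_prop))) _ }
  map_pt := Subtype.ext (ContinuousMap.ext fun _ => f.map_pt)

theorem PtdMap.Homotopic.freeLoopPair {f g : PtdMap (X.prod Y) Z} (h : f.Homotopic g) :
    (freeLoopPair f).Homotopic (freeLoopPair g) := by
  obtain ⟨H, H0, H1, Hb⟩ := h.exists_map
  have Hc : Continuous fun p : I × X × Y => H p := H.continuous
  have hc : Continuous fun q : (I × {γ : C(I, X) // γ 0 = γ 1} ×
      {γ : C(I, Y) // γ 0 = γ 1}) × I => H (q.1.1, (q.1.2.1.1 q.2, q.1.2.2.1 q.2)) :=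
    Hc.comp (by fun_prop : Continuous fun q : (I × {γ : C(I, X) // γ 0 = γ 1} ×
      {γ : C(I, Y) // γ 0 = γ 1}) × I => (q.1.1, (q.1.2.1.1 q.2, q.1.2.2.1 q.2)))
  refine PtdMap.homotopic_of_map ⟨fun p : I × {γ : C(I, X) // γ 0 = γ 1} ×
      {γ : C(I, Y) // γ 0 = γ 1} => (⟨⟨fun t => H (p.1, (p.2.1.1 t, p.2.2.1 t)),
        hc.comp (by fun_prop : Continuous fun t : I => (p, t))⟩, ?_⟩ :
        {γ : C(I, Z) // γ 0 = γ 1}), ?_⟩ ?_ ?_ ?_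
  · exact congrArg (fun q : X × Y => H (p.1, q)) (Prod.ext p.2.1.2 p.2.2.2)
  · exact Continuous.subtype_mk (ContinuousMap.continuous_of_continuous_uncurry _ hc) _
  · exact fun p => Subtype.ext (ContinuousMap.ext fun t => H0 _)
  · exact fun p => Subtype.ext (ContinuousMap.ext fun t => H1 _)
  · exact fun s => Subtype.ext (ContinuousMap.ext fun t => Hb s)

/-- The map `ΩX × Y → ΩZ` induced by a map `X × Y → Z` that is constant on `* × Y`. -/
def loopPair (f : PtdMap (X.prod Y) Z) (hf : ∀ y, f.toMap (X.pt, y) = Z.pt) :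
    PtdMap (X.loop.prod Y) Z.loop where
  toMap :=
    { toFun := fun p : Path X.pt X.pt × Y => (⟨⟨fun t => f.toMap (p.1 t, p.2),
        f.toMap.continuous.comp (by fun_prop : Continuous fun t : I => ((p.1 t, p.2) : X × Y))⟩,
        (congrArg (fun x : X => f.toMap (x, p.2)) p.1.source).trans (hf _),
        (congrArg (fun x : X => f.toMap (x, p.2)) p.1.target).trans (hf _)⟩ : Path Z.pt Z.pt)
      continuous_toFun := by
        refine Path.continuous_uncurry_iff.mp ?_
        exact f.toMap.continuous.comp (by fun_prop : Continuous
          fun q : (Path X.pt X.pt × Y) × I => ((q.1.1 q.2, q.1.2) : X × Y)) }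
  map_pt := Path.ext (funext fun _ => f.map_pt)

/-- The quotient of `w y · w y'` by `w (y · y')` is null-homotopic on both axes, since `b / b` is
trivial, so it can be made constant on the wedge. -/
theorem HSpace.exists_deviation {K : Type u₁} [TopologicalSpace K] [HSpace K]
    {d : PtdMap ((HSpace.ptd H).prod (HSpace.ptd H)) (HSpace.ptd H)} (hd : HSpace.IsDivision d)
    (hK : (HSpace.ptd K).IsWellPointed) (w : PtdMap (HSpace.ptd K) (HSpace.ptd H)) :
    ∃ g : PtdMap ((HSpace.ptd K).prod (HSpace.ptd K)) (HSpace.ptd H),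
      (∀ p ∈ wedge (HSpace.ptd K) (HSpace.ptd K), g.toMap p = (HSpace.ptd H).pt) ∧
      ((HSpace.mulMap H).comp (g.pair (w.comp (HSpace.mulMap K)))).Homotopic
        ((HSpace.mulMap H).comp (w.prodMap w)) := by
  have hw : w.comp (PtdMap.const (HSpace.ptd K) (HSpace.ptd K)) = PtdMap.const _ _ :=
    PtdMap.ext_toMap fun _ => w.map_pt
  obtain ⟨g, hg, hgw⟩ := hK.exists_homotopic_wedge
    (d.comp (((HSpace.mulMap H).comp (w.prodMap w)).pair (w.comp (HSpace.mulMap K)))) (by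
      change (d.comp (((HSpace.mulMap H).comp (w.pair (w.comp (PtdMap.const _ _)))).pair
        (w.comp ((HSpace.mulMap K).comp (PtdMap.pair ⟨ContinuousMap.id _, rfl⟩
          (PtdMap.const _ _)))))).Homotopic _
      rw [hw]
      refine (PtdMap.Homotopic.comp_left d (PtdMap.Homotopic.pair
        (HSpace.mulMap_const_right w) ?_)).trans (hd.div_self w)
      exact PtdMap.Homotopic.comp_left w (HSpace.mulMap_const_right _)) (by
      change (d.comp (((HSpace.mulMap H).comp ((w.comp (PtdMap.const _ _)).pair w)).pair
        (w.comp ((HSpace.mulMap K).comp (PtdMap.pair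
          (PtdMap.const _ _) ⟨ContinuousMap.id _, rfl⟩))))).Homotopic _
      rw [hw]
      refine (PtdMap.Homotopic.comp_left d (PtdMap.Homotopic.pair
        (HSpace.mulMap_const_left w) ?_)).trans (hd.div_self w)
      exact PtdMap.Homotopic.comp_left w (HSpace.mulMap_const_left _))
  refine ⟨g, hgw, ?_⟩
  exact (PtdMap.Homotopic.comp_left (HSpace.mulMap H) (hg.symm.pair (PtdMap.Homotopic.refl _))).trans
    (hd.mul_div_pair _ _)

/-- A deviation of `w` applied pointwise to loops is a deviation of `Lw`. On a based loop and a
constant loop it already has values in based loops, so the lift exists strictly. -/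
theorem HSpace.exists_isLoopDeviation {K : Type u₁} [TopologicalSpace K] [HSpace K]
    {d : PtdMap ((HSpace.ptd H).prod (HSpace.ptd H)) (HSpace.ptd H)} (hd : HSpace.IsDivision d)
    (hK : (HSpace.ptd K).IsWellPointed) (w : PtdMap (HSpace.ptd K) (HSpace.ptd H)) :
    ∃ δ, IsLoopDeviation (HSpace.mulMap K) (HSpace.mulMap H) w δ := by
  obtain ⟨g, hg, h⟩ := HSpace.exists_deviation hd hK w
  refine ⟨_, (freeLoopPair g).smashLift ?_, (loopPair g fun y => hg _ (Or.inl rfl)).smashLift ?_,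
    h.freeLoopPair, ?_, PtdMap.Homotopic.refl _⟩
  · rintro ⟨γ, γ'⟩ (rfl | rfl)
    · exact Subtype.ext (ContinuousMap.ext fun t => hg _ (Or.inl rfl))
    · exact Subtype.ext (ContinuousMap.ext fun t => hg _ (Or.inr rfl))
  · rintro ⟨p, y⟩ (rfl | rfl)
    · exact Path.ext (funext fun t => hg _ (Or.inl rfl))
    · exact Path.ext (funext fun t => hg _ (Or.inr rfl))
  · have : ∀ {f f' : PtdMap ((HSpace.ptd K).loop.smash (HSpace.ptd K)) (HSpace.ptd H).freeLoop},
        f = f' → f.Homotopic f' := by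
      rintro f _ rfl
      exact PtdMap.Homotopic.refl f
    refine this (PtdMap.ext_toMap ?_)
    rintro ⟨p⟩
    rfl

end HSpaces

end division


noncomputable section freeLoops

open CategoryTheory

universe u₁ u₂ u₃

variable {X : PtdSpace.{u₁}} {Y : PtdSpace.{u₂}} {Z : PtdSpace.{u₃}}

/-! ### Free loops and conjugation -/

/-- A track from a pointed map to itself as a map to the free loop space. -/
def Track.toFreeLoop {b : PtdMap X Y} (F : Track b.rel b.rel) : PtdMap X Y.freeLoop where
  toMap :=
    { toFun := fun x => (⟨⟨fun t : I => F.toFun t x, F.continuous_apply (by fun_prop)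
        (by fun_prop)⟩, (F.eq_left 0 le_rfl x).trans (F.eq_right 1 le_rfl x).symm⟩ :
        {γ : C(I, Y) // γ 0 = γ 1})
      continuous_toFun := Continuous.subtype_mk (ContinuousMap.continuous_of_continuous_uncurry _
        (F.continuous_apply (T := X × I) (by fun_prop) (by fun_prop))) _ }
  map_pt := Subtype.ext (ContinuousMap.ext fun t => F.eq_base t _ rfl)

theorem loopTrack_toFreeLoop (a : PtdMap X Y.loop) :
    (loopTrack a).toFreeLoop (b := PtdMap.const X Y) = (loopIncl Y).comp a :=
  PtdMap.ext_toMap fun x => Subtype.ext (ContinuousMap.ext fun t => loopTrack_toFun a t x)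

theorem Track.toFreeLoop_congr {b : PtdMap X Y} {F G : Track b.rel b.rel}
    (h : F.toHom = G.toHom) : F.toFreeLoop.Homotopic G.toFreeLoop := by
  obtain ⟨A, Ac, A0, A1, Al, Ar, Ab⟩ := Track.exists_family (Track.toHom_eq_iff.mp h)
  refine PtdMap.homotopic_of_map ⟨fun p : I × X => (⟨⟨fun t : I => A p.1 t p.2, ?_⟩,
    (Al _ 0 le_rfl _).trans (Ar _ 1 le_rfl _).symm⟩ : {γ : C(I, Y) // γ 0 = γ 1}), ?_⟩ ?_ ?_ ?_
  · exact Ac.comp (by fun_prop : Continuous fun t : I => ((p.1 : ℝ), (t : ℝ), p.2))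
  · refine Continuous.subtype_mk (ContinuousMap.continuous_of_continuous_uncurry _ ?_) _
    exact Ac.comp (by fun_prop : Continuous fun q : (I × X) × I =>
      ((q.1.1 : ℝ), (q.2 : ℝ), q.1.2))
  · exact fun x => Subtype.ext (ContinuousMap.ext fun t => A0 _ _)
  · exact fun x => Subtype.ext (ContinuousMap.ext fun t => A1 _ _)
  · exact fun u => Subtype.ext (ContinuousMap.ext fun t => Ab _ _ _ rfl)

/-- Inside the conjugate, `F` occupies the times from 1/4 to 1/2. The window from `(1 - s) / 4` to
`(1 + s) / 2` grows from there to everything, and its two ends agree because `K` is traversed in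
opposite directions. -/
theorem Track.toFreeLoop_conj {b c : PtdMap X Y} (F : Track b.rel b.rel) (K : Track b.rel c.rel) :
    F.toFreeLoop.Homotopic ((K.symm.trans F).trans K).toFreeLoop := by
  let G := (K.symm.trans F).trans K
  have hG : ∀ s : ℝ, 0 ≤ s → s ≤ 1 → ∀ x, G.toFun ((1 - s) / 4) x = G.toFun ((1 + s) / 2) x := by
    intro s h0 h1 x
    simp only [G]
    rw [Track.trans_of_le _ _ (by linarith), Track.trans_of_le _ _ (by linarith),
      Track.trans_of_ge _ _ (by linarith)]
    change K.toFun _ x = _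
    congr 1
    ring
  have hc : Continuous fun q : (I × X) × I =>
      G.toFun ((1 - q.1.1) / 4 + q.2 * ((1 + q.1.1) / 2 - (1 - q.1.1) / 4)) q.1.2 :=
    G.continuous_apply (by fun_prop) (by fun_prop)
  refine PtdMap.homotopic_of_map ⟨fun p : I × X => (⟨⟨fun t : I =>
    G.toFun ((1 - p.1) / 4 + t * ((1 + p.1) / 2 - (1 - p.1) / 4)) p.2, ?_⟩, ?_⟩ :
    {γ : C(I, Y) // γ 0 = γ 1}), ?_⟩ ?_ ?_ ?_
  · exact hc.comp (by fun_prop : Continuous fun t : I => (p, t))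
  · have := hG p.1 p.1.2.1 p.1.2.2 p.2
    simpa using this
  · exact Continuous.subtype_mk (ContinuousMap.continuous_of_continuous_uncurry _ hc) _
  · intro x
    refine Subtype.ext (ContinuousMap.ext fun t => ?_)
    change G.toFun ((1 - ((0 : I) : ℝ)) / 4 + t * ((1 + ((0 : I) : ℝ)) / 2 - (1 - ((0 : I) : ℝ)) / 4)) x
      = F.toFun t x
    have := t.2.1
    have := t.2.2
    simp only [G, Set.Icc.coe_zero]
    rw [Track.trans_of_le _ _ (by linarith), Track.trans_of_ge _ _ (by linarith)]
    congr 1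
    ring
  · intro x
    refine Subtype.ext (ContinuousMap.ext fun t => ?_)
    change G.toFun ((1 - ((1 : I) : ℝ)) / 4 + t * ((1 + ((1 : I) : ℝ)) / 2 - (1 - ((1 : I) : ℝ)) / 4)) x
      = G.toFun t x
    congr 1
    simp
  · exact fun u => Subtype.ext (ContinuousMap.ext fun t => G.eq_base _ _ rfl)

/-- Conjugate loops are freely homotopic, so the conjugating track can be forgotten in the free loop
space. -/
theorem loopIncl_homotopic_of_conj (a : PtdMap X Y.loop) {b : PtdMap X Y} (F : Track b.rel b.rel)
    (c : (PtdMap.const X Y).rel ⟶ b.rel)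
    (h : loopHom (Quotient.mk _ a) = c ≫ F.toHom ≫ Groupoid.inv c) :
    ((loopIncl Y).comp a).Homotopic F.toFreeLoop := by
  obtain ⟨C, rfl⟩ := Track.toHom_surjective c
  have e : (loopTrack a).toHom = ((C.symm.symm.trans F).trans C.symm).toHom := by
    rw [Track.toHom_trans, Track.toHom_trans, Track.toHom_symm, Track.toHom_symm,
      Groupoid.inv_eq_inv, Groupoid.inv_eq_inv, IsIso.inv_inv, Category.assoc,
      ← Groupoid.inv_eq_inv, ← h]
    rfl
  have h' := Track.toFreeLoop_congr (b := PtdMap.const X Y) e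
  rw [loopTrack_toFreeLoop] at h'
  exact h'.trans (F.toFreeLoop_conj C.symm).symm

/-! ### Loops in an H-space -/

section HSpaces

variable {H : Type u₂} [TopologicalSpace H] [HSpace H]

theorem HSpace.track_comm (F G : (PtdMap.const X (HSpace.ptd H)).rel ⟶
    (PtdMap.const X (HSpace.ptd H)).rel) : F ≫ G = G ≫ F := by
  obtain ⟨A, rfl⟩ := Track.toHom_surjective F
  obtain ⟨B, rfl⟩ := Track.toHom_surjective G
  let A' : Track (RelMap.unit X H {X.pt}) (RelMap.unit X H {X.pt}) := A
  let B' : Track (RelMap.unit X H {X.pt}) (RelMap.unit X H {X.pt}) := B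
  exact Track.trans_comm A' B'

theorem HSpace.loopGroup_comm (a b : HtpyClass X (HSpace.ptd H).loop) : a * b = b * a :=
  loopHom_injective (by rw [loopHom_mul, loopHom_mul, HSpace.track_comm])

/-- A free homotopy moves the starting points of the loops along a track `c` from the constant map
to itself, and its square reads `c b = a c`. Commutativity lets `c` cancel. -/
theorem HSpace.homotopic_of_loopIncl {a b : PtdMap X (HSpace.ptd H).loop}
    (h : ((loopIncl (HSpace.ptd H)).comp a).Homotopic ((loopIncl (HSpace.ptd H)).comp b)) :
    a.Homotopic b := by
  obtain ⟨G, G0, G1, Gb⟩ := h.exists_map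
  have hp : Continuous (Set.projIcc (0 : ℝ) 1 zero_le_one) := continuous_projIcc
  let g : I × X → {γ : C(I, HSpace.ptd H) // γ 0 = γ 1} := G
  have hg : Continuous g := G.continuous
  have hΨ : Continuous fun p : ℝ × ℝ × X => (g (Set.projIcc 0 1 zero_le_one p.1, p.2.2)).1
      (Set.projIcc 0 1 zero_le_one p.2.1) := by fun_prop
  let c : Track (PtdMap.const X (HSpace.ptd H)).rel (PtdMap.const X (HSpace.ptd H)).rel :=
    { toFun := fun s x => (g (Set.projIcc 0 1 zero_le_one s, x)).1 0
      cont := by fun_prop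
      eq_left := fun s hs x => by
        rw [Set.projIcc_of_le_left _ hs]
        exact (congrArg (fun γ : {γ : C(I, HSpace.ptd H) // γ 0 = γ 1} => γ.1 0) (G0 x)).trans
          (Path.source _)
      eq_right := fun s hs x => by
        rw [Set.projIcc_of_right_le _ hs]
        exact (congrArg (fun γ : {γ : C(I, HSpace.ptd H) // γ 0 = γ 1} => γ.1 0) (G1 x)).trans
          (Path.source _)
      eq_base := fun s x hx => by
        obtain rfl := hx
        exact congrArg (fun γ : {γ : C(I, HSpace.ptd H) // γ 0 = γ 1} => γ.1 0) (Gb _) }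
  have key : c.trans (loopTrack b) ≈ (loopTrack a).trans c := by
    refine Track.equiv_of_square (fun s t x => (g (Set.projIcc 0 1 zero_le_one s, x)).1
      (Set.projIcc 0 1 zero_le_one t)) hΨ ?_ ?_ ?_ ?_ ?_
    · intro t _ _ x
      rw [Set.projIcc_left]
      rfl
    · intro t _ _ x
      rw [Set.projIcc_right]
      exact congrArg (fun γ : {γ : C(I, HSpace.ptd H) // γ 0 = γ 1} => γ.1 _) (G1 x)
    · intro t _ _ x
      rw [Set.projIcc_left]
      exact congrArg (fun γ : {γ : C(I, HSpace.ptd H) // γ 0 = γ 1} => γ.1 _) (G0 x)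
    · intro t _ _ x
      rw [Set.projIcc_right]
      exact (g _).2.symm
    · rintro s _ _ t _ _ x rfl
      exact congrArg (fun γ : {γ : C(I, HSpace.ptd H) // γ 0 = γ 1} => γ.1 _) (Gb _)
  rw [← Track.toHom_eq_iff, Track.toHom_trans, Track.toHom_trans,
    HSpace.track_comm (loopTrack a).toHom] at key
  rw [loopTrack_homotopic_iff]
  exact ((cancel_epi _).1 key).symm

/-- Up to homotopy, concatenation of loops is the pointwise product. -/
theorem HSpace.loopIncl_loopMul (a b : PtdMap X (HSpace.ptd H).loop) :
    ((loopIncl (HSpace.ptd H)).comp ((loopMul (HSpace.ptd H)).comp (a.pair b))).Homotopic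
      ((freeLoopMul (HSpace.mulMap H)).comp (((loopIncl (HSpace.ptd H)).comp a).pair
        ((loopIncl (HSpace.ptd H)).comp b))) := by
  let A : Track (RelMap.unit X H {X.pt}) (RelMap.unit X H {X.pt}) := loopTrack a
  let B : Track (RelMap.unit X H {X.pt}) (RelMap.unit X H {X.pt}) := loopTrack b
  have h : Track.toHom ((loopTrack a).trans (loopTrack b)) = Track.toHom (A.hmul B) :=
    (Track.toHom_hmul A B).symm
  have h' := Track.toFreeLoop_congr (b := PtdMap.const X (HSpace.ptd H)) h
  rw [← loopTrack_loopMul, loopTrack_toFreeLoop] at h'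
  refine h'.trans ?_
  have e : Track.toFreeLoop (b := PtdMap.const X (HSpace.ptd H)) (A.hmul B) =
      ((freeLoopMul (HSpace.mulMap H)).comp (((loopIncl (HSpace.ptd H)).comp a).pair
        ((loopIncl (HSpace.ptd H)).comp b))) := by
    refine PtdMap.ext_toMap fun x => Subtype.ext (ContinuousMap.ext fun t => ?_)
    exact congrArg (fun q : H × H => HSpace.hmul q)
      (Prod.ext (loopTrack_toFun a t x) (loopTrack_toFun b t x))
  rw [e]
  exact PtdMap.Homotopic.refl _

end HSpaces

end freeLoops


noncomputable section fibre

open CategoryTheory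

universe u₁ u₂ u₃

variable {X : PtdSpace.{u₁}} {Y : PtdSpace.{u₂}} {Z : PtdSpace.{u₃}}

/-! ### Maps to the homotopy fibre -/

/-- Postcomposition with a pointed map, on tracks. -/
def PtdMap.post (w : PtdMap Y Z) (X : PtdSpace.{u₁}) :
    RelMap X Y {X.pt} Y.pt ⥤ RelMap X Z {X.pt} Z.pt :=
  RelMap.post ⟨fun p : X × Y => w.toMap p.2, by fun_prop⟩ fun _ _ => w.map_pt

/-- The map to the homotopy fibre given by a pointed map and a null-homotopy. -/
def toHoFibre {w : PtdMap Y Z} (b : PtdMap X Y)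
    (l : Track (PtdMap.const X Z).rel (w.comp b).rel) : PtdMap X (hoFibre w) where
  toMap :=
    { toFun := fun x => (⟨(b.toMap x, ⟨fun t : I => l.toFun t x, l.continuous_apply (by fun_prop)
        (by fun_prop)⟩), l.eq_left 0 le_rfl x, l.eq_right 1 le_rfl x⟩ :
        {p : Y × C(I, Z) // p.2 0 = Z.pt ∧ p.2 1 = w.toMap p.1})
      continuous_toFun := Continuous.subtype_mk (b.toMap.continuous.prodMk
        (ContinuousMap.continuous_of_continuous_uncurry _
          (l.continuous_apply (T := X × I) (by fun_prop) (by fun_prop)))) _ }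
  map_pt := Subtype.ext (Prod.ext b.map_pt (ContinuousMap.ext fun t => l.eq_base t _ rfl))

theorem exists_toHoFibre {w : PtdMap Y Z} (f : PtdMap X (hoFibre w)) :
    ∃ l : Track (PtdMap.const X Z).rel (w.comp ((hoFibreProj w).comp f)).rel,
      toHoFibre _ l = f := by
  have hp : Continuous (Set.projIcc (0 : ℝ) 1 zero_le_one) := continuous_projIcc
  let g : X → {p : Y × C(I, Z) // p.2 0 = Z.pt ∧ p.2 1 = w.toMap p.1} := f.toMap
  have hg : Continuous g := f.toMap.continuous
  refine ⟨⟨fun t x => (g x).1.2 (Set.projIcc 0 1 zero_le_one t), by fun_prop, ?_, ?_, ?_⟩, ?_⟩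
  · intro t ht x
    rw [Set.projIcc_of_le_left _ ht]
    exact (g x).2.1
  · intro t ht x
    rw [Set.projIcc_of_right_le _ ht]
    exact (g x).2.2
  · rintro t _ rfl
    exact congrArg (fun e : {p : Y × C(I, Z) // p.2 0 = Z.pt ∧ p.2 1 = w.toMap p.1} => e.1.2 _)
      f.map_pt
  · refine PtdMap.ext_toMap fun x => Subtype.ext (Prod.ext rfl (ContinuousMap.ext fun t => ?_))
    exact congrArg (g x).1.2 (Set.projIcc_val _ t)

theorem toHoFibre_congr {w : PtdMap Y Z} {b : PtdMap X Y}
    {l l' : Track (PtdMap.const X Z).rel (w.comp b).rel} (h : l.toHom = l'.toHom) :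
    (toHoFibre b l).Homotopic (toHoFibre b l') := by
  obtain ⟨A, Ac, A0, A1, Al, Ar, Ab⟩ := Track.exists_family (Track.toHom_eq_iff.mp h)
  refine PtdMap.homotopic_of_map ⟨fun p : I × X => (⟨(b.toMap p.2,
    ⟨fun t : I => A p.1 t p.2, ?_⟩), Al _ 0 le_rfl _, Ar _ 1 le_rfl _⟩ :
    {p : Y × C(I, Z) // p.2 0 = Z.pt ∧ p.2 1 = w.toMap p.1}), ?_⟩ ?_ ?_ ?_
  · exact Ac.comp (by fun_prop : Continuous fun t : I => ((p.1 : ℝ), (t : ℝ), p.2))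
  · refine Continuous.subtype_mk ((b.toMap.continuous.comp continuous_snd).prodMk
      (ContinuousMap.continuous_of_continuous_uncurry _ ?_)) _
    exact Ac.comp (by fun_prop : Continuous fun q : (I × X) × I =>
      ((q.1.1 : ℝ), (q.2 : ℝ), q.1.2))
  · exact fun x => Subtype.ext (Prod.ext rfl (ContinuousMap.ext fun t => A0 _ _))
  · exact fun x => Subtype.ext (Prod.ext rfl (ContinuousMap.ext fun t => A1 _ _))
  · exact fun u => Subtype.ext (Prod.ext b.map_pt (ContinuousMap.ext fun t => Ab _ _ _ rfl))

/-- While the point runs along `k` up to time `s`, its path is `l'` continued by `w k` up to time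
`s`; this is the concatenation restricted to times at most `(1 + s) / 2`. -/
theorem toHoFibre_trans {w : PtdMap Y Z} {b b' : PtdMap X Y}
    (l' : Track (PtdMap.const X Z).rel (w.comp b').rel) (k : Track b'.rel b.rel)
    (wk : Track (w.comp b').rel (w.comp b).rel)
    (hwk : ∀ t x, wk.toFun t x = w.toMap (k.toFun t x)) :
    (toHoFibre b' l').Homotopic (toHoFibre b (l'.trans wk)) := by
  have hc : Continuous fun q : (I × X) × I =>
      (l'.trans wk).toFun (q.2 * ((1 + q.1.1) / 2)) q.1.2 :=
    Track.continuous_apply _ (by fun_prop) (by fun_prop)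
  have hk : Continuous fun p : I × X => k.toFun p.1 p.2 :=
    Track.continuous_apply _ (by fun_prop) (by fun_prop)
  refine PtdMap.homotopic_of_map ⟨fun p : I × X => (⟨(k.toFun p.1 p.2,
    ⟨fun t : I => (l'.trans wk).toFun (t * ((1 + p.1) / 2)) p.2, ?_⟩), ?_, ?_⟩ :
    {p : Y × C(I, Z) // p.2 0 = Z.pt ∧ p.2 1 = w.toMap p.1}), ?_⟩ ?_ ?_ ?_
  · exact hc.comp (by fun_prop : Continuous fun t : I => (p, t))
  · exact (l'.trans wk).eq_left _ (by norm_num) _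
  · have := p.1.2.1
    change (l'.trans wk).toFun (((1 : I) : ℝ) * ((1 + p.1) / 2)) p.2 = w.toMap (k.toFun p.1 p.2)
    rw [Set.Icc.coe_one, Track.trans_of_ge _ _ (by linarith), hwk]
    congr 2
    ring
  · exact Continuous.subtype_mk (hk.prodMk (ContinuousMap.continuous_of_continuous_uncurry _ hc)) _
  · intro x
    refine Subtype.ext (Prod.ext (k.eq_left _ le_rfl _) (ContinuousMap.ext fun t => ?_))
    change (l'.trans wk).toFun (t * ((1 + ((0 : I) : ℝ)) / 2)) x = l'.toFun t x
    have := t.2.2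
    rw [Set.Icc.coe_zero, Track.trans_of_le _ _ (by linarith)]
    congr 1
    ring
  · intro x
    refine Subtype.ext (Prod.ext (k.eq_right _ le_rfl _) (ContinuousMap.ext fun t => ?_))
    change (l'.trans wk).toFun (t * ((1 + ((1 : I) : ℝ)) / 2)) x = (l'.trans wk).toFun t x
    congr 1
    norm_num
  · exact fun u => Subtype.ext (Prod.ext (k.eq_base _ _ rfl)
      (ContinuousMap.ext fun t => (l'.trans wk).eq_base _ _ rfl))

/-- A homotopy of maps to the fibre is a homotopy `k` of the points together with a square of paths.
One edge is constant, as all paths start at the base point, and the opposite edge is `w k`. -/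
theorem toHoFibre_homotopic_iff {w : PtdMap Y Z} {b b' : PtdMap X Y}
    {l' : Track (PtdMap.const X Z).rel (w.comp b').rel}
    {l : Track (PtdMap.const X Z).rel (w.comp b).rel} :
    (toHoFibre b' l').Homotopic (toHoFibre b l) ↔
      ∃ k : b'.rel ⟶ b.rel, l.toHom = l'.toHom ≫ (w.post X).map k := by
  constructor
  · intro h
    obtain ⟨G, G0, G1, Gb⟩ := h.exists_map
    have hp : Continuous (Set.projIcc (0 : ℝ) 1 zero_le_one) := continuous_projIcc
    let g : I × X → {p : Y × C(I, Z) // p.2 0 = Z.pt ∧ p.2 1 = w.toMap p.1} := G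
    have hg : Continuous g := G.continuous
    let k : Track b'.rel b.rel :=
      { toFun := fun s x => (g (Set.projIcc 0 1 zero_le_one s, x)).1.1
        cont := by fun_prop
        eq_left := fun s hs x => by
          rw [Set.projIcc_of_le_left _ hs]
          exact congrArg (fun e : {p : Y × C(I, Z) // p.2 0 = Z.pt ∧ p.2 1 = w.toMap p.1} =>
            e.1.1) (G0 x)
        eq_right := fun s hs x => by
          rw [Set.projIcc_of_right_le _ hs]
          exact congrArg (fun e : {p : Y × C(I, Z) // p.2 0 = Z.pt ∧ p.2 1 = w.toMap p.1} =>
            e.1.1) (G1 x)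
        eq_base := fun s x hx => by
          obtain rfl := hx
          exact congrArg (fun e : {p : Y × C(I, Z) // p.2 0 = Z.pt ∧ p.2 1 = w.toMap p.1} =>
            e.1.1) (Gb _) }
    refine ⟨k.toHom, ?_⟩
    rw [← Category.id_comp l.toHom]
    refine Track.toHom_eq_iff.mpr (Track.equiv_of_square (F := Track.refl _)
      (fun s t x => (g (Set.projIcc 0 1 zero_le_one s, x)).1.2 (Set.projIcc 0 1 zero_le_one t))
      (by fun_prop) ?_ ?_ ?_ ?_ ?_)
    · intro t _ _ x
      rw [Set.projIcc_left]
      exact (g _).2.1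
    · intro t h0 h1 x
      rw [Set.projIcc_right, Set.projIcc_of_mem _ ⟨h0, h1⟩]
      exact congrArg (fun e : {p : Y × C(I, Z) // p.2 0 = Z.pt ∧ p.2 1 = w.toMap p.1} =>
        e.1.2 ⟨t, h0, h1⟩) (G1 x)
    · intro t h0 h1 x
      rw [Set.projIcc_left, Set.projIcc_of_mem _ ⟨h0, h1⟩]
      exact congrArg (fun e : {p : Y × C(I, Z) // p.2 0 = Z.pt ∧ p.2 1 = w.toMap p.1} =>
        e.1.2 ⟨t, h0, h1⟩) (G0 x)
    · intro t _ _ x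
      rw [Set.projIcc_right]
      exact (g _).2.2
    · rintro s _ _ t _ _ x rfl
      exact congrArg (fun e : {p : Y × C(I, Z) // p.2 0 = Z.pt ∧ p.2 1 = w.toMap p.1} =>
        e.1.2 _) (Gb _)
  · rintro ⟨k, hk⟩
    obtain ⟨k, rfl⟩ := Track.toHom_surjective k
    let wk : Track (w.comp b').rel (w.comp b).rel :=
      k.post ⟨fun p : X × Y => w.toMap p.2, by fun_prop⟩ (fun _ => rfl) (fun _ => rfl)
        (fun _ _ => w.map_pt)
    have e : (l'.trans wk).toHom = l.toHom := hk.symm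
    exact (toHoFibre_trans l' k wk fun _ _ => rfl).trans (toHoFibre_congr e)

/-- The class in `[X, E]` of a pointed map and the class of a null-homotopy. -/
def hoFibreClass {w : PtdMap Y Z} (b : PtdMap X Y) :
    ((PtdMap.const X Z).rel ⟶ (w.comp b).rel) → HtpyClass X (hoFibre w) :=
  Quotient.lift (fun l => Quotient.mk _ (toHoFibre b l)) fun _ _ h =>
    Quotient.sound (toHoFibre_congr (Track.toHom_eq_iff.mpr h))

theorem hoFibreClass_eq_iff {w : PtdMap Y Z} {b b' : PtdMap X Y}
    {l' : (PtdMap.const X Z).rel ⟶ (w.comp b').rel} {l : (PtdMap.const X Z).rel ⟶ (w.comp b).rel} :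
    hoFibreClass b' l' = hoFibreClass b l ↔
      ∃ k : b'.rel ⟶ b.rel, l = l' ≫ (w.post X).map k := by
  obtain ⟨l, rfl⟩ := Track.toHom_surjective l
  obtain ⟨l', rfl⟩ := Track.toHom_surjective l'
  exact Quotient.eq.trans toHoFibre_homotopic_iff

theorem hoFibreProj_sharp_hoFibreClass {w : PtdMap Y Z} (b : PtdMap X Y)
    (l : (PtdMap.const X Z).rel ⟶ (w.comp b).rel) :
    (hoFibreProj w).sharp (hoFibreClass b l) = Quotient.mk _ b := by
  obtain ⟨l, rfl⟩ := Track.toHom_surjective l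
  rfl

/-- A lift of the class of `b` lies over a map homotopic to `b`; transporting its null-homotopy
along the homotopy puts it over `b` itself. -/
theorem exists_hoFibreClass {w : PtdMap Y Z} (b : PtdMap X Y) (f : HtpyClass X (hoFibre w))
    (hf : (hoFibreProj w).sharp f = Quotient.mk _ b) : ∃ l, hoFibreClass b l = f := by
  obtain ⟨f⟩ := f
  obtain ⟨k⟩ := PtdMap.homotopic_iff.mp (Quotient.exact hf)
  obtain ⟨l, hl⟩ := exists_toHoFibre f
  refine ⟨l.toHom ≫ (w.post X).map k.toHom, ?_⟩
  have : hoFibreClass _ l.toHom = Quotient.mk _ f := congrArg (Quotient.mk _) hl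
  exact (hoFibreClass_eq_iff.mpr ⟨k.toHom, rfl⟩).symm.trans this

/-! ### The homomorphism -/

theorem PtdMap.pair_pt (b : PtdMap X Y) : ((Y.pt, b.toMap X.pt) : Y.prod Y) = (Y.prod Y).pt :=
  Prod.ext rfl b.map_pt

/-- The map `(x, y) ↦ y · b x`. -/
def PtdMap.mulRightMap (m : PtdMap (Y.prod Y) Y) (b : PtdMap X Y) : C(X × Y, Y) :=
  ⟨fun p : X × Y => m.toMap (p.2, b.toMap p.1), m.toMap.continuous.comp
    (by fun_prop : Continuous fun p : X × Y => ((p.2, b.toMap p.1) : Y × Y))⟩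

theorem PtdMap.mulRightMap_pt (m : PtdMap (Y.prod Y) Y) (b : PtdMap X Y) :
    ∀ x ∈ ({X.pt} : Set X), m.mulRightMap b (x, Y.pt) = Y.pt := by
  rintro _ rfl
  exact (congrArg m.toMap b.pair_pt).trans m.map_pt

/-- Multiplication by a map on the right, on tracks. -/
def PtdMap.mulRight (m : PtdMap (Y.prod Y) Y) (b : PtdMap X Y) :
    RelMap X Y {X.pt} Y.pt ⥤ RelMap X Y {X.pt} Y.pt :=
  RelMap.post (m.mulRightMap b) (m.mulRightMap_pt b)

/-- Division by `b x` is inverse to multiplication by `b x` up to pointed homotopy, so the functor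
is an equivalence. Fullness later writes every self-track of `b` as the translate of a loop, up to
conjugation. -/
theorem HSpace.IsDivision.mulRight_full {H : Type u₂} [TopologicalSpace H] [HSpace H]
    {d : PtdMap ((HSpace.ptd H).prod (HSpace.ptd H)) (HSpace.ptd H)} (hd : HSpace.IsDivision d)
    (b : PtdMap X (HSpace.ptd H)) : ((HSpace.mulMap H).mulRight b).Full := by
  obtain ⟨P, P0, P1, Pb⟩ := hd.div_mul.exists_map
  obtain ⟨Q, Q0, Q1, Qb⟩ := hd.mul_div.exists_map
  have hb : Continuous fun p : I × X × HSpace.ptd H =>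
      ((p.1, (p.2.2, b.toMap p.2.1)) : I × HSpace.ptd H × HSpace.ptd H) := by fun_prop
  have : ((HSpace.mulMap H).mulRight b).IsEquivalence := RelMap.post_isEquivalence (S := {X.pt}) (y₀ := (HSpace.ptd H).pt)
    (z₀ := (HSpace.ptd H).pt)
    ((HSpace.mulMap H).mulRightMap b) ((HSpace.mulMap H).mulRightMap_pt b)
    (d.mulRightMap b) (d.mulRightMap_pt b)
    ⟨fun p => P (p.1, (p.2.2, b.toMap p.2.1)), P.continuous.comp hb⟩
    (fun x y => P0 _) (fun x y => P1 _)
    (by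
      rintro t _ rfl
      exact (congrArg (fun z => P (t, z)) b.pair_pt).trans (Pb t))
    ⟨fun p => Q (p.1, (p.2.2, b.toMap p.2.1)), Q.continuous.comp hb⟩
    (fun x y => Q0 _) (fun x y => Q1 _)
    (by
      rintro t _ rfl
      exact (congrArg (fun z => Q (t, z)) b.pair_pt).trans (Qb t))
  exact Functor.IsEquivalence.full

end fibre


/-! ### The homomorphism ψ and its cokernel -/

noncomputable section deviationHom

open CategoryTheory

universe u₁ u₂ u₃

variable {X : PtdSpace.{u₁}} {Y : PtdSpace.{u₂}} {Z : PtdSpace.{u₃}}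

/-- `[X, ΩY]` as the automorphisms of the constant map. -/
def loopEquiv (X : PtdSpace.{u₁}) (Y : PtdSpace.{u₂}) :
    HtpyClass X Y.loop ≃ ((PtdMap.const X Y).rel ⟶ (PtdMap.const X Y).rel) :=
  Equiv.ofBijective loopHom ⟨loopHom_injective, loopHom_surjective⟩

/-- Right multiplication by `b`, followed by `w`, on `[X, ΩY]`, with values in `[X, ΩZ]` by means of
a null-homotopy. -/
def translationHom (m : PtdMap (Y.prod Y) Y) (w : PtdMap Y Z) (b : PtdMap X Y)
    (c : (PtdMap.const X Z).rel ⟶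
      (w.post X).obj ((m.mulRight b).obj (PtdMap.const X Y).rel)) :
    HtpyClass X Y.loop →* HtpyClass X Z.loop :=
  MonoidHom.mk' (fun a => (loopEquiv X Z).symm
    (c ≫ (w.post X).map ((m.mulRight b).map (loopHom a)) ≫ Groupoid.inv c)) fun a a' => by
      refine loopHom_injective ?_
      have e : ∀ F, loopHom ((loopEquiv X Z).symm F) = F := (loopEquiv X Z).apply_symm_apply
      rw [e, loopHom_mul, loopHom_mul, e, e, Functor.map_comp, Functor.map_comp]
      simp

theorem loopHom_translationHom (m : PtdMap (Y.prod Y) Y) (w : PtdMap Y Z) (b : PtdMap X Y)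
    (c : (PtdMap.const X Z).rel ⟶
      (w.post X).obj ((m.mulRight b).obj (PtdMap.const X Y).rel)) (a : HtpyClass X Y.loop) :
    loopHom (translationHom m w b c a) =
      c ≫ (w.post X).map ((m.mulRight b).map (loopHom a)) ≫ Groupoid.inv c :=
  (loopEquiv X Z).apply_symm_apply _

/-- Conjugation by `c` is invisible to free loops, which leaves the loop `t ↦ w (a t · b)`. -/
theorem loopIncl_translationHom (m : PtdMap (Y.prod Y) Y) (w : PtdMap Y Z) (b : PtdMap X Y)
    (c : (PtdMap.const X Z).rel ⟶
      (w.post X).obj ((m.mulRight b).obj (PtdMap.const X Y).rel)) (a : PtdMap X Y.loop)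
    (p : PtdMap X Z.loop) (hp : translationHom m w b c (Quotient.mk _ a) = Quotient.mk _ p) :
    ((loopIncl Z).comp p).Homotopic ((freeLoopMap w).comp ((freeLoopMul m).comp
      (((loopIncl Y).comp a).pair ((constLoop Y).comp b)))) := by
  let F : Track ((m.mulRight b).obj (PtdMap.const X Y).rel)
      ((m.mulRight b).obj (PtdMap.const X Y).rel) :=
    (loopTrack a).post (m.mulRightMap b) (fun _ => rfl) (fun _ => rfl) (m.mulRightMap_pt b)
  let G : Track (w.comp (m.comp ((PtdMap.const X Y).pair b))).rel
      (w.comp (m.comp ((PtdMap.const X Y).pair b))).rel :=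
    F.post ⟨fun p : X × Y => w.toMap p.2, by fun_prop⟩ (fun _ => rfl) (fun _ => rfl)
      (fun _ _ => w.map_pt)
  have h := loopIncl_homotopic_of_conj p (b := w.comp (m.comp ((PtdMap.const X Y).pair b))) G c
    ((congrArg loopHom hp.symm).trans (loopHom_translationHom m w b c _))
  have e : G.toFreeLoop = ((freeLoopMap w).comp ((freeLoopMul m).comp
      (((loopIncl Y).comp a).pair ((constLoop Y).comp b)))) := by
    refine PtdMap.ext_toMap fun x => Subtype.ext (ContinuousMap.ext fun t => ?_)
    exact congrArg (fun y : Y => w.toMap (m.toMap ((y, b.toMap x) : Y × Y))) (loopTrack_toFun a t x)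
  rwa [e] at h

section HSpaces

variable {H : Type u₃} [TopologicalSpace H] [HSpace H]

/-- Evaluated at the loop `a` and the constant loop `b`, the deviation equation becomes
$\delta'(a,b)\cdot\psi(a)=(\Omega w)a$, because `w b` is null. Solving for $\psi(a)$ explains the
inverse in the definition of `δ`. -/
theorem translationHom_eq (m : PtdMap (Y.prod Y) Y) (w : PtdMap Y (HSpace.ptd H)) (b : PtdMap X Y)
    (hb : (w.comp b).Homotopic (PtdMap.const X _))
    (c : (PtdMap.const X (HSpace.ptd H)).rel ⟶
      (w.post X).obj ((m.mulRight b).obj (PtdMap.const X Y).rel))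
    {δ : PtdMap (Y.loop.smash Y) (HSpace.ptd H).loop}
    (hδ : IsLoopDeviation m (HSpace.mulMap H) w δ) (α : HtpyClass X Y.loop) :
    translationHom m w b c α = deviationPairing δ α (Quotient.mk _ b) * (loopMap w).sharp α := by
  obtain ⟨D, δ', hD, hδ', hδ⟩ := hδ
  obtain ⟨a⟩ := α
  obtain ⟨p, hp⟩ := Quotient.exists_rep (translationHom m w b c (Quotient.mk _ a))
  let e : HtpyClass X (HSpace.ptd H).loop := Quotient.mk _ (δ'.smashComp a b)
  have h1 : deviationPairing δ (Quotient.mk _ a) (Quotient.mk _ b) = e⁻¹ :=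
    Quotient.sound (hδ.comp_right ((a.smashMap b).comp (reducedDiagonal X)))
  let j := loopIncl (HSpace.ptd H)
  let n := freeLoopMul (HSpace.mulMap H)
  have h2 : (j.comp ((loopMul _).comp ((δ'.smashComp a b).pair p))).Homotopic
      (j.comp ((loopMul _).comp (((loopMap w).comp a).pair (PtdMap.const _ _)))) := by
    refine (HSpace.loopIncl_loopMul _ _).trans ?_
    refine PtdMap.Homotopic.trans ?_ (HSpace.loopIncl_loopMul _ _).symm
    let r : PtdMap X (Y.freeLoop.prod Y.freeLoop) :=
      ((loopIncl Y).comp a).pair ((constLoop Y).comp b)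
    have q : (n.comp (((D.comp (toSmash _ _)).comp r).pair
        ((freeLoopMap w).comp ((freeLoopMul m).comp r)))).Homotopic
        (n.comp (((freeLoopMap w).comp ((loopIncl Y).comp a)).pair
          ((freeLoopMap w).comp ((constLoop Y).comp b)))) := hD.comp_right r
    have q1 : (j.comp (δ'.smashComp a b)).Homotopic ((D.comp (toSmash _ _)).comp r) :=
      hδ'.comp_right ((a.smashMap b).comp (reducedDiagonal X))
    have q2 := loopIncl_translationHom m w b c a p hp.symm
    have q3 : ((freeLoopMap w).comp ((constLoop Y).comp b)).Homotopic
        (j.comp (PtdMap.const X (HSpace.ptd H).loop)) :=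
      PtdMap.Homotopic.comp_left (constLoop (HSpace.ptd H)) hb
    have q4 : ((freeLoopMap w).comp ((loopIncl Y).comp a)).Homotopic
        (j.comp ((loopMap w).comp a)) := PtdMap.Homotopic.refl _
    exact (PtdMap.Homotopic.comp_left n (q1.pair q2)).trans
      (q.trans (PtdMap.Homotopic.comp_left n (q4.pair q3)))
  let p' : HtpyClass X (HSpace.ptd H).loop := Quotient.mk _ p
  -- The equation was obtained for free loops; injectivity of the map to the free loop space brings
  -- it back to based loops.
  have h3 : e * p' = (loopMap w).sharp (Quotient.mk _ a) * 1 :=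
    Quotient.sound (HSpace.homotopic_of_loopIncl h2)
  rw [mul_one] at h3
  change translationHom m w b c (Quotient.mk _ a) = deviationPairing δ (Quotient.mk _ a) _ *
    (loopMap w).sharp (Quotient.mk _ a)
  rw [h1, ← h3, inv_mul_cancel_left, ← hp]

/-- Two null-homotopies $\gamma l$ and $\gamma'l$ give the same lift if $\gamma' l=\gamma l\,w(k)$
for a self-track `k` of `b`. Writing `k` as the conjugate by `ν` of a translated loop `α` turns this
into $\gamma^{-1}\gamma'=\psi(\alpha)$. -/
theorem hoFibreClass_loopHom_eq_iff (m : PtdMap (Y.prod Y) Y) (w : PtdMap Y (HSpace.ptd H))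
    (b : PtdMap X Y) (l : (PtdMap.const X (HSpace.ptd H)).rel ⟶ (w.post X).obj b.rel)
    (ν : b.rel ⟶ (m.mulRight b).obj (PtdMap.const X Y).rel) (hm : (m.mulRight b).Full)
    (γ γ' : HtpyClass X (HSpace.ptd H).loop) :
    hoFibreClass b (loopHom γ ≫ l) = hoFibreClass b (loopHom γ' ≫ l) ↔
      γ⁻¹ * γ' ∈ (translationHom m w b (l ≫ (w.post X).map ν)).range := by
  refine hoFibreClass_eq_iff.trans ?_
  change (∃ k : b.rel ⟶ b.rel, loopHom γ' ≫ l = (loopHom γ ≫ l) ≫ (w.post X).map k) ↔ _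
  constructor
  · rintro ⟨k, hk⟩
    obtain ⟨F, hF⟩ := (m.mulRight b).map_surjective (Groupoid.inv ν ≫ k ≫ ν)
    obtain ⟨α, rfl⟩ := loopHom_surjective F
    refine ⟨α, eq_inv_mul_of_mul_eq (loopHom_injective ?_)⟩
    rw [loopHom_mul, loopHom_translationHom, hF, ← cancel_mono l, hk]
    simp
  · rintro ⟨α, hα⟩
    refine ⟨ν ≫ (m.mulRight b).map (loopHom α) ≫ Groupoid.inv ν, ?_⟩
    rw [← mul_inv_cancel_left γ γ', ← hα, loopHom_mul, loopHom_translationHom]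
    simp

theorem nonempty_equiv_groupCoker (m : PtdMap (Y.prod Y) Y) (w : PtdMap Y (HSpace.ptd H))
    (b : PtdMap X Y) (hb : (w.comp b).Homotopic (PtdMap.const X _))
    (l : (PtdMap.const X (HSpace.ptd H)).rel ⟶ (w.comp b).rel)
    (ν : b.rel ⟶ (m.mulRight b).obj (PtdMap.const X Y).rel) (hm : (m.mulRight b).Full)
    {δ : PtdMap (Y.loop.smash Y) (HSpace.ptd H).loop}
    (hδ : IsLoopDeviation m (HSpace.mulMap H) w δ) :
    ((hoFibreProj w).sharp ⁻¹' {Quotient.mk _ b} : Set (HtpyClass X (hoFibre w))).Nonempty ∧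
      ∃ ψ : HtpyClass X Y.loop →* HtpyClass X (HSpace.ptd H).loop,
        (∀ α, ψ α = deviationPairing δ α (Quotient.mk _ b) * (loopMap w).sharp α) ∧
        Nonempty (((hoFibreProj w).sharp ⁻¹' {Quotient.mk _ b} : Set (HtpyClass X (hoFibre w))) ≃
          GroupCoker ψ) := by
  refine ⟨⟨hoFibreClass b l, hoFibreProj_sharp_hoFibreClass b l⟩,
    translationHom m w b (l ≫ (w.post X).map ν), translationHom_eq m w b hb _ hδ, ?_⟩
  let ψ := translationHom m w b (l ≫ (w.post X).map ν)
  -- By Eckmann–Hilton the target is abelian, so the normal closure in the cokernel is the range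
  -- itself.
  have hψ : ψ.range.Normal := ⟨fun n hn g => by
    rwa [HSpace.loopGroup_comm g n, mul_inv_cancel_right]⟩
  have key : ∀ γ γ' : HtpyClass X (HSpace.ptd H).loop,
      hoFibreClass b (loopHom γ ≫ l) = hoFibreClass b (loopHom γ' ≫ l) ↔
        (QuotientGroup.mk γ : GroupCoker ψ) = QuotientGroup.mk γ' := fun γ γ' => by
    rw [QuotientGroup.eq, Subgroup.normalClosure_eq_self]
    exact hoFibreClass_loopHom_eq_iff m w b l ν hm γ γ'
  refine ⟨(Equiv.ofBijective (Quotient.lift (fun γ => (⟨hoFibreClass b (loopHom γ ≫ l),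
    hoFibreProj_sharp_hoFibreClass b _⟩ :
      ((hoFibreProj w).sharp ⁻¹' {Quotient.mk _ b} : Set (HtpyClass X (hoFibre w)))))
    fun γ γ' h => Subtype.ext ((key γ γ').mpr (Quotient.sound h))) ⟨?_, ?_⟩).symm⟩
  · rintro ⟨γ⟩ ⟨γ'⟩ h
    exact (key γ γ').mp (congrArg Subtype.val h)
  · rintro ⟨f, hf⟩
    obtain ⟨l', rfl⟩ := exists_hoFibreClass b f hf
    -- Any null-homotopy of `w b` differs from `l` by an automorphism of the constant map, that is,
    -- by an element of $[X,\Omega C]$.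
    obtain ⟨γ, hγ⟩ := loopHom_surjective (l' ≫ Groupoid.inv l)
    refine ⟨QuotientGroup.mk γ, Subtype.ext ?_⟩
    change hoFibreClass b (loopHom γ ≫ l) = hoFibreClass b l'
    rw [hγ]
    simp

end HSpaces

end deviationHom

theorem mainTheorem3 (X : PtdSpace.{u})
    (B : Type*) [TopologicalSpace B] [HSpace B] (C : Type*) [TopologicalSpace C] [HSpace C]
    (hB : HasCWHomotopyType B) (hC : HasCWHomotopyType C)
    (hB' : (HSpace.ptd B).IsWellPointed) (hC' : (HSpace.ptd C).IsWellPointed)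
    (hBt : HSpace.HasInvertibleTranslations B) (hCt : HSpace.HasInvertibleTranslations C)
    (hCa : HSpace.IsHomotopyAssociative C)
    (w : PtdMap (HSpace.ptd B) (HSpace.ptd C)) :
    (∃ δ, IsLoopDeviation (HSpace.mulMap B) (HSpace.mulMap C) w δ) ∧
    ∀ δ, IsLoopDeviation (HSpace.mulMap B) (HSpace.mulMap C) w δ →
    ∀ β : HtpyClass X (HSpace.ptd B), w.sharp β = HtpyClass.zero X (HSpace.ptd C) →
      ((hoFibreProj w).sharp ⁻¹' {β} : Set (HtpyClass X (hoFibre w))).Nonempty ∧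
      ∃ ψ : HtpyClass X (HSpace.ptd B).loop →* HtpyClass X (HSpace.ptd C).loop,
        (∀ α, ψ α = deviationPairing δ α β * (loopMap w).sharp α) ∧
        Nonempty (((hoFibreProj w).sharp ⁻¹' {β} : Set (HtpyClass X (hoFibre w))) ≃
          GroupCoker ψ) := by
  obtain ⟨dB, hdB⟩ := HSpace.exists_isDivision hB' hB hBt
  obtain ⟨dC, hdC⟩ := HSpace.exists_isDivision hC' hC hCt
  refine ⟨HSpace.exists_isLoopDeviation hdC hB' w, fun δ hδ β hβ => ?_⟩
  obtain ⟨b⟩ := β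
  have hb : (w.comp b).Homotopic (PtdMap.const X _) := Quotient.exact hβ
  obtain ⟨l⟩ := PtdMap.homotopic_iff.mp hb.symm
  -- The unit law `b ≃ e · b` links `b` to the image of the constant map under right multiplication
  -- by `b`.
  obtain ⟨ν⟩ := PtdMap.homotopic_iff.mp (HSpace.mulMap_const_left b).symm
  exact nonempty_equiv_groupCoker (HSpace.mulMap B) w b hb l.toHom ν.toHom (hdB.mulRight_full b) hδ
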